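/- **Conventions.** Let $N=\mathbb Z^n$, $M=\mathrm{Hom}(N,\mathbb Z)$, $N_{\mathbb R}=\mathbb R^n$. A *fan* $\Sigma$ in $N_{\mathbb R}$ is a finite collection of strictly convex rational polyhedral cones, closed under taking faces, any two of which meet in a common face; $\Sigma(k)$ is the set of its $k$-dimensional cones. It is *complete* if its cones cover $N_{\mathbb R}$. A *cone complex* is a topological space $X$ with a finite collection $\Sigma_X$ of closed subsets (cones) and, for each $\sigma\in\Sigma_X$, a finitely generated group $M(\sigma)$ of continuous functions $\sigma\to\mathbb R$, such that: the natural map $\sigma\to\mathrm{Hom}(M(\sigma),\mathbb R)$ is a homeomorphism onto a convex rational polyhedral cone; the preimage $\tau$ of each face of this cone is in $\Sigma_X$, with $M(\tau)=\{m|_\tau: m\in M(\sigma)\}$; and $X$ is the disjoint union of the relative interiors $\mathrm{Int}(\sigma)$, $\sigma\in\Sigma_X$. A function $\varphi:X\to\mathbb R$ is *piecewise linear* if $\varphi|_\sigma\in M(\sigma)$ for all $\sigma\in\Sigma_X$. A *morphism* $f:(X',\Sigma_{X'})\to(X,\Sigma_X)$ is a continuous map such that for every $\sigma'\in\Sigma_{X'}$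 there is $\sigma\in\Sigma_X$ with $f(\sigma')\subset\sigma$ and $f^*M(\sigma)\subset M(\sigma')$. A *weight* is a function $\mu:X\to\mathbb Z_{>0}$ that is constant on each $\mathrm{Int}(\sigma)$; the constant is written $\mu(\sigma)$. Put $Tr_f(\mu)(x)=\sum_{x'\in f^{-1}(x)}\mu(x')$. A fan $\Sigma$ makes $N_{\mathbb R}$ a cone complex when it is complete, with $M(\sigma)=\{m|_\sigma:m\in M\}$. A *tropical Lagrangian multi-section of rank $r$* over a complete fan $\Sigma$ is $\mathbb L=(L,\Sigma_L,\mu,\pi,\varphi)$, where $(L,\Sigma_L)$ is a cone complex with weight $\mu$, $\varphi$ is piecewise linear on it, and $\pi:L\to N_{\mathbb R}$ is a branched covering map with $Tr_\pi(\mu)=r$; that is, $\pi$ is a surjective morphism, it maps every $\sigma'\in\Sigma_L$ homeomorphically onto a cone $\pi(\sigma')\in\Sigma$ with $M(\sigma')=\pi^*M(\pi(\sigma'))$, and for every connected open $U\subset N_{\mathbb R}$ and every connected component $V$ of $\pi^{-1}(U)$ the function $Tr_{\pi|_V}(\mu)$ is constant on $U$. $\mathbb L$ is *connected* if $L$ is.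 For $\mathbb L_1,\mathbb L_2$ of the same rank, $\mathbb L_1\le\mathbb L_2$ means that there is a surjective morphism $f:L_2\to L_1$ of cone complexes with $\pi_1\circ f=\pi_2$, $Tr_f(\mu_2)=\mu_1$ and $\varphi_1\circ f=\varphi_2$. For connected $\mathbb L_1,\mathbb L_2$ of the same rank, $\mathbb L_1\sim_c\mathbb L_2$ means that some $\mathbb L$ satisfies $\mathbb L\le\mathbb L_1$ and $\mathbb L\le\mathbb L_2$. *Combinatorial equivalence* is the transitive closure of $\sim_c$. The *combinatorial union* $\mathbb L_1\cup_c\mathbb L_2$ is obtained from $L_1\sqcup L_2$ by gluing (over $N_{\mathbb R}$) each pair of cones $\tau'\in\Sigma_{L_1}$, $\tau''\in\Sigma_{L_2}$ with $\pi_1(\tau')=\pi_2(\tau'')$ on which $\varphi_1$ and $\varphi_2$ agree; its cones are the images of the cones of $L_1,L_2$, its weight at a point is the sum of the weights of all preimages, and its projection and piecewise linear function are the induced ones. A connected $\mathbb L$ is *combinatorially indecomposable* if it is not combinatorially equivalent to $\mathbb L_1\cup_c\mathbb L_2$ for any connected $\mathbb L_1,\mathbb L_2$ over $\Sigma$. For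 $\sigma\in\Sigma(n)$ let $\sigma^{(1)},\dots,\sigma^{(r)}\in\Sigma_L$ be the cones mapped onto $\sigma$ by $\pi$, each $\sigma'$ listed $\mu(\sigma')$ times, and let $m(\sigma^{(\alpha)})\in M$ be the slope of $\varphi$ on $\sigma^{(\alpha)}$. *Kaneyama data* of $\mathbb L$ are matrices $g_{\sigma_1\sigma_2}\in GL(r,\mathbb C)$, $\sigma_1,\sigma_2\in\Sigma(n)$, with entries $g_{\sigma_1^{(\alpha)}\sigma_2^{(\beta)}}$ (row $\alpha$, column $\beta$), such that - $g_{\sigma\sigma}=\mathrm{Id}$ for all $\sigma$; - $g_{\sigma_1^{(\alpha)}\sigma_2^{(\beta)}}\ne0$ only if $\sigma_1^{(\alpha)}\cap\sigma_2^{(\beta)}\ne\emptyset$ and $m(\sigma_1^{(\alpha)})-m(\sigma_2^{(\beta)})\in(\sigma_1\cap\sigma_2)^\vee\cap M$; - $g_{\sigma_1\sigma_2}g_{\sigma_2\sigma_3}=g_{\sigma_1\sigma_3}$ for all $\sigma_1,\sigma_2,\sigma_3$. Two Kaneyama data $\mathbf g,\mathbf g'$ are *equivalent* if there are $h_\sigma\in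 GL(r,\mathbb C)$, $\sigma\in\Sigma(n)$, such that $h_{\sigma^{(\alpha)}\sigma^{(\beta)}}\neq0$ only if $m(\sigma^{(\alpha)})-m(\sigma^{(\beta)})\in\sigma^\vee\cap M$, and $g_{\sigma_1\sigma_2}h_{\sigma_2}=h_{\sigma_1}g'_{\sigma_1\sigma_2}$ for all $\sigma_1,\sigma_2\in\Sigma(n)$. The set $\mathcal K(\mathbb L)$ of equivalence classes carries the quotient of the Zariski topology on the set of Kaneyama data (closed sets: common zero sets of polynomials in the matrix entries), and $\dim_{\mathbb C}\mathcal K(\mathbb L)$ is its Krull dimension ($-\infty$ if $\mathcal K(\mathbb L)=\emptyset$). **Statement.** Let $\Sigma$ be a complete fan in $N_{\mathbb R}=\mathbb R^2$, and let $\mathbb L$ be a combinatorially indecomposable tropical Lagrangian multi-section of rank $2$ over $\Sigma$. Then $$\dim_{\mathbb C}\mathcal K(\mathbb L)\le\#\Sigma(1)-1.$$ -/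

import Mathlib

universe u v

open Topology Set

noncomputable section

namespace TropicalMultiSection

/-! ### Fans in `N_ℝ = ℝⁿ`, with lattice `N = ℤⁿ` and dual lattice `M = ℤⁿ` -/

/-- The pairing of `m ∈ M = ℤⁿ` with `x ∈ N_ℝ = ℝⁿ`. -/
def pair {n : ℕ} (m : Fin n → ℤ) (x : Fin n → ℝ) : ℝ := ∑ i, (m i : ℝ) * x i

/-- The faces of a rational cone: the sets `σ ∩ m^⊥`, where `m ∈ σ^∨ ∩ M`. -/
def IsFace {n : ℕ} (τ σ : Set (Fin n → ℝ)) : Prop :=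
  ∃ m : Fin n → ℤ, (∀ x ∈ σ, 0 ≤ pair m x) ∧ τ = {x ∈ σ | pair m x = 0}

/-- A fan in `ℝⁿ`: a finite collection of strictly convex rational polyhedral cones, closed under
taking faces, any two of which meet in a common face. -/
structure Fan (n : ℕ) where
  cones : Set (Set (Fin n → ℝ))
  finite : cones.Finite
  rational : ∀ σ ∈ cones, ∃ s : Set (Fin n → ℤ), s.Finite ∧
    σ = (PointedCone.hull ℝ ((fun v i => (v i : ℝ)) '' s) : Set (Fin n → ℝ))
  strictlyConvex : ∀ σ ∈ cones, ∀ x ∈ σ, -x ∈ σ → x = 0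
  face_mem : ∀ σ ∈ cones, ∀ τ, IsFace τ σ → τ ∈ cones
  inter_isFace : ∀ σ ∈ cones, ∀ τ ∈ cones, IsFace (σ ∩ τ) σ

/-- A fan is complete if its cones cover `N_ℝ`. -/
def Fan.IsComplete {n : ℕ} (F : Fan n) : Prop := ⋃₀ F.cones = univ

/-- The dimension of a cone. -/
def coneDim {n : ℕ} (σ : Set (Fin n → ℝ)) : ℕ := Module.finrank ℝ (Submodule.span ℝ σ)

/-- `Σ(k)`: the set of `k`-dimensional cones of the fan. -/
def Fan.conesOfDim {n : ℕ} (F : Fan n) (k : ℕ) : Set (Set (Fin n → ℝ)) :=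
  {σ ∈ F.cones | coneDim σ = k}

/-! ### Cone complexes -/

/-- A collection `cones` of subsets of a space `X`, together with a group `M σ` of continuous
functions on each of them (only the values of `M` at the members of `cones` are relevant). -/
structure ConeData (X : Type u) [TopologicalSpace X] where
  cones : Set (Set X)
  M : (σ : Set X) → AddSubgroup C(σ, ℝ)

namespace ConeData

variable {X : Type u} [TopologicalSpace X] {Y : Type v} [TopologicalSpace Y]

/-- The natural map `σ → Hom(M σ, ℝ)`, `x ↦ (u ↦ u x)`. -/
def natMap (S : ConeData X) (σ : Set X) (x : σ) : S.M σ → ℝ := fun u => (u : C(σ, ℝ)) x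

/-- The relative interior of a cone: the points that lie on no proper face, where the faces are the
zero sets of the nonnegative elements of `M σ`. -/
def relInt (S : ConeData X) (σ : Set X) : Set X :=
  {x | ∃ hx : x ∈ σ, ∀ u ∈ S.M σ, (∀ y, 0 ≤ u y) → u ⟨x, hx⟩ = 0 → u = 0}

/-- `(X, S)` is a cone complex. -/
structure IsConeComplex (S : ConeData X) : Prop where
  finite : S.cones.Finite
  isClosed : ∀ σ ∈ S.cones, IsClosed σ
  fg : ∀ σ ∈ S.cones, (S.M σ).FG
  /-- The natural map is a homeomorphism onto its image... -/
  isEmbedding : ∀ σ ∈ S.cones, IsEmbedding (S.natMap σ)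
  /-- ... and its image is a convex rational polyhedral cone, i.e. it is spanned by finitely many
  elements of the lattice `Hom(M σ, ℤ)`. -/
  rational : ∀ σ ∈ S.cones, ∃ s : Set (S.M σ →+ ℤ), s.Finite ∧
    range (S.natMap σ) = (PointedCone.hull ℝ ((fun v u => (v u : ℝ)) '' s) : Set (S.M σ → ℝ))
  /-- Faces of cones are cones... -/
  face_mem : ∀ σ ∈ S.cones, ∀ u ∈ S.M σ, (∀ x, 0 ≤ u x) →
    Subtype.val '' {x : σ | u x = 0} ∈ S.cones
  /-- ... and the functions on a face are the restrictions of those on the cone. -/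
  face_M : ∀ σ ∈ S.cones, ∀ τ ∈ S.cones, ∀ h : τ ⊆ σ,
    (∃ u ∈ S.M σ, (∀ x, 0 ≤ u x) ∧ τ = Subtype.val '' {x : σ | u x = 0}) →
    ∀ m : C(τ, ℝ), m ∈ S.M τ ↔ ∃ m' ∈ S.M σ, ∀ x : τ, m x = m' (inclusion h x)
  /-- `X` is the disjoint union of the relative interiors of the cones. -/
  existsUnique_relInt : ∀ x, ∃! σ, σ ∈ S.cones ∧ x ∈ S.relInt σ

/-- Piecewise linear functions. -/
def IsPL (S : ConeData X) (φ : X → ℝ) : Prop :=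
  ∀ σ ∈ S.cones, ∃ m ∈ S.M σ, ∀ x : σ, φ x = m x

/-- Morphisms of cone complexes. -/
structure IsMorphism (S : ConeData X) (T : ConeData Y) (f : X → Y) : Prop where
  continuous : Continuous f
  exists_cone : ∀ σ ∈ S.cones, ∃ τ ∈ T.cones, ∃ h : MapsTo f σ τ,
    ∀ m ∈ T.M τ, ∃ m' ∈ S.M σ, ∀ x : σ, m' x = m (h.restrict f σ τ x)

/-- A weight on a cone complex: a positive integer valued function, constant on the relative
interior of every cone. -/
structure IsWeight (S : ConeData X) (μ : X → ℕ) : Prop where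
  pos : ∀ x, 0 < μ x
  const : ∀ σ ∈ S.cones, ∀ x ∈ S.relInt σ, ∀ y ∈ S.relInt σ, μ x = μ y

/-- The weight `μ(σ)` of a cone: the constant value of `μ` on the relative interior of `σ`. -/
def coneWeight (S : ConeData X) (μ : X → ℕ) (σ : Set X) : ℕ := sInf (μ '' S.relInt σ)

end ConeData

/-- The trace `Tr_f(μ)(y) = ∑_{f x = y} μ x`. -/
def trace {X : Type u} {Y : Type v} (f : X → Y) (μ : X → ℕ) (y : Y) : ℕ :=
  ∑ᶠ x ∈ f ⁻¹' {y}, μ x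

/-- A branched covering map `π : (X, S, μ) → (Y, T)`. -/
structure IsBranchedCover {X : Type u} [TopologicalSpace X] {Y : Type v} [TopologicalSpace Y]
    (S : ConeData X) (μ : X → ℕ) (T : ConeData Y) (π : X → Y) : Prop where
  isMorphism : S.IsMorphism T π
  surjective : Function.Surjective π
  /-- Every cone is mapped onto a cone, ... -/
  image_mem : ∀ σ ∈ S.cones, π '' σ ∈ T.cones
  /-- ... homeomorphically, ... -/
  isEmbedding : ∀ σ ∈ S.cones, IsEmbedding (σ.domRestrict π)
  /-- ... and with `M(σ) = π^* M(π(σ))`. -/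
  mem_M : ∀ σ ∈ S.cones, ∀ m : C(σ, ℝ), m ∈ S.M σ ↔
    ∃ m' ∈ T.M (π '' σ), ∀ x : σ, m x = m' ((mapsTo_image π σ).restrict π σ (π '' σ) x)
  /-- For every connected open `U ⊆ Y` and every connected component `V` of `π⁻¹(U)`, the trace of
  `μ` by `π|_V` is constant on `U`. -/
  trace_const : ∀ U : Set Y, IsOpen U → IsConnected U → ∀ x ∈ π ⁻¹' U, ∀ y ∈ U, ∀ z ∈ U,
    ∑ᶠ p ∈ connectedComponentIn (π ⁻¹' U) x ∩ π ⁻¹' {y}, μ p =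
      ∑ᶠ p ∈ connectedComponentIn (π ⁻¹' U) x ∩ π ⁻¹' {z}, μ p

lemma pair_add {n : ℕ} (m m' : Fin n → ℤ) (x : Fin n → ℝ) :
    pair (m + m') x = pair m x + pair m' x := by
  simp [pair, add_mul, Finset.sum_add_distrib]

lemma pair_neg {n : ℕ} (m : Fin n → ℤ) (x : Fin n → ℝ) : pair (-m) x = -pair m x := by
  simp [pair]

/-- `N_ℝ` as a cone complex: the cones are those of the fan, and the functions on a cone are the
restrictions of the elements of `M`. -/
def Fan.coneData {n : ℕ} (F : Fan n) : ConeData (Fin n → ℝ) where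
  cones := F.cones
  M σ :=
    { carrier := {u | ∃ m : Fin n → ℤ, ∀ x : σ, u x = pair m x}
      zero_mem' := ⟨0, fun x => by simp [pair]⟩
      add_mem' := by
        rintro u v ⟨m, hm⟩ ⟨m', hm'⟩
        exact ⟨m + m', fun x => by simp [hm, hm', pair_add]⟩
      neg_mem' := by
        rintro u ⟨m, hm⟩
        exact ⟨-m, fun x => by simp [hm, pair_neg]⟩ }

/-! ### Tropical Lagrangian multi-sections -/

/-- A tropical Lagrangian multi-section `(L, Σ_L, μ, π, φ)` over a fan. -/
structure MultiSection {n : ℕ} (F : Fan n) where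
  L : Type u
  [top : TopologicalSpace L]
  S : ConeData L
  isConeComplex : S.IsConeComplex
  μ : L → ℕ
  isWeight : S.IsWeight μ
  π : L → (Fin n → ℝ)
  isBranchedCover : IsBranchedCover S μ F.coneData π
  rank : ℕ
  trace_eq : ∀ x, trace π μ x = rank
  φ : L → ℝ
  isPL : S.IsPL φ

attribute [instance] MultiSection.top

namespace MultiSection

variable {n : ℕ} {F : Fan n}

/-- `𝕃` is connected if its domain is. -/
def IsConnected (A : MultiSection.{u} F) : Prop := ConnectedSpace A.L

/-- `A ≤ B`: there is a surjective morphism of cone complexes `B → A` over `N_ℝ` that is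
compatible with the weights and with the piecewise linear functions. -/
def Le (A B : MultiSection.{u} F) : Prop :=
  A.rank = B.rank ∧ ∃ f : B.L → A.L, B.S.IsMorphism A.S f ∧ Function.Surjective f ∧
    A.π ∘ f = B.π ∧ trace f B.μ = A.μ ∧ A.φ ∘ f = B.φ

/-- The relation `∼_c` on connected multi-sections. -/
def SimC (A B : MultiSection.{u} F) : Prop :=
  A.IsConnected ∧ B.IsConnected ∧ A.rank = B.rank ∧ ∃ C : MultiSection.{u} F, C.Le A ∧ C.Le B

/-- Combinatorial equivalence of connected multi-sections: the transitive closure of `∼_c`. -/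
def CombEquiv (A B : MultiSection.{u} F) : Prop := Relation.TransGen SimC A B

/-- The gluing relation of the combinatorial union: for cones `τ'` of `A` and `τ''` of `B` over
the same cone on which the piecewise linear functions agree, the points of `τ'` and `τ''` with the
same image in `N_ℝ` are glued. -/
def Glue (A B : MultiSection.{u} F) (p q : A.L ⊕ B.L) : Prop :=
  ∃ a b, p = Sum.inl a ∧ q = Sum.inr b ∧ A.π a = B.π b ∧
    ∃ τ' ∈ A.S.cones, ∃ τ'' ∈ B.S.cones, a ∈ τ' ∧ b ∈ τ'' ∧ A.π '' τ' = B.π '' τ'' ∧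
      ∀ x ∈ τ', ∀ y ∈ τ'', A.π x = B.π y → A.φ x = B.φ y

/-- `U` is the combinatorial union `A ∪_c B`: its domain is the quotient of `A.L ⊔ B.L` by the
equivalence relation generated by the gluing, its cones are the images of the cones of `A` and `B`,
its weight is the sum of the weights of the preimages, and `π`, `φ` are the induced maps. -/
def IsCombUnion (A B U : MultiSection.{u} F) : Prop :=
  ∃ q : A.L ⊕ B.L → U.L, IsQuotientMap q ∧
    (∀ x y, q x = q y ↔ Relation.EqvGen (Glue A B) x y) ∧
    U.S.cones = (fun σ => (q ∘ Sum.inl) '' σ) '' A.S.cones ∪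
      (fun σ => (q ∘ Sum.inr) '' σ) '' B.S.cones ∧
    (∀ z, U.μ z = trace (q ∘ Sum.inl) A.μ z + trace (q ∘ Sum.inr) B.μ z) ∧
    U.π ∘ q = Sum.elim A.π B.π ∧ U.φ ∘ q = Sum.elim A.φ B.φ

/-- `𝕃` is combinatorially indecomposable: it is connected, and it is not combinatorially equivalent
to the combinatorial union of two connected multi-sections. -/
def CombIndecomposable (A : MultiSection.{u} F) : Prop :=
  A.IsConnected ∧ ¬ ∃ A₁ A₂ U : MultiSection.{u} F, A₁.IsConnected ∧ A₂.IsConnected ∧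
    IsCombUnion A₁ A₂ U ∧ CombEquiv A U

/-! ### Kaneyama data -/

lemma exists_slope (A : MultiSection.{u} F) {σ' : Set A.L} (h : σ' ∈ A.S.cones) :
    ∃ m : Fin n → ℤ, ∀ x ∈ σ', A.φ x = pair m (A.π x) := by
  obtain ⟨u, hu, hφ⟩ := A.isPL σ' h
  obtain ⟨v, ⟨m, hm⟩, hv⟩ := (A.isBranchedCover.mem_M σ' h u).1 hu
  exact ⟨m, fun x hx => by rw [hφ ⟨x, hx⟩, hv, hm]; rfl⟩

/-- The lifts of a cone `σ` of the fan to `L`. -/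
def Lift (A : MultiSection.{u} F) (σ : Set (Fin n → ℝ)) : Type u :=
  {σ' : Set A.L // σ' ∈ A.S.cones ∧ A.π '' σ' = σ}

/-- The index set of the lifts `σ^(α)` of `σ`, counted with multiplicity. -/
def Idx (A : MultiSection.{u} F) (σ : Set (Fin n → ℝ)) : Type u :=
  (σ' : A.Lift σ) × Fin (A.S.coneWeight A.μ σ'.1)

instance (A : MultiSection.{u} F) (σ : Set (Fin n → ℝ)) : Finite (A.Lift σ) :=
  (A.isConeComplex.finite.subset (fun _ h => h.1) :
    {σ' : Set A.L | σ' ∈ A.S.cones ∧ A.π '' σ' = σ}.Finite).to_subtype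

instance (A : MultiSection.{u} F) (σ : Set (Fin n → ℝ)) : Fintype (A.Idx σ) :=
  letI : Fintype (A.Lift σ) := Fintype.ofFinite _
  inferInstanceAs (Fintype ((σ' : A.Lift σ) × Fin (A.S.coneWeight A.μ σ'.1)))

instance (A : MultiSection.{u} F) (σ : Set (Fin n → ℝ)) : DecidableEq (A.Idx σ) :=
  Classical.decEq _

/-- The cone `σ^(α)`. -/
def lift (A : MultiSection.{u} F) {σ : Set (Fin n → ℝ)} (α : A.Idx σ) : Set A.L := α.1.1

/-- The slope `m(σ^(α)) ∈ M` of `φ` on `σ^(α)`. It is uniquely determined when `σ` is a cone of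
dimension `n`, which is the only case in which it is used. -/
def slope (A : MultiSection.{u} F) {σ : Set (Fin n → ℝ)} (α : A.Idx σ) : Fin n → ℤ :=
  (A.exists_slope α.1.2.1).choose

/-- Kaneyama data of `𝕃`: matrices `g_{σ₁σ₂}` for `σ₁, σ₂ ∈ Σ(n)`, whose rows and columns are indexed
by the lifts of `σ₁` and `σ₂`, counted with multiplicity. They are invertible, by `one` and `mul`. -/
@[ext]
structure KaneyamaData (A : MultiSection.{u} F) where
  g : ∀ σ₁ σ₂ : F.conesOfDim n, Matrix (A.Idx σ₁.1) (A.Idx σ₂.1) ℂ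
  one : ∀ σ, g σ σ = 1
  support : ∀ σ₁ σ₂ α β, g σ₁ σ₂ α β ≠ 0 → (A.lift α ∩ A.lift β).Nonempty ∧
    ∀ x ∈ σ₁.1 ∩ σ₂.1, 0 ≤ pair (A.slope α - A.slope β) x
  mul : ∀ σ₁ σ₂ σ₃, g σ₁ σ₂ * g σ₂ σ₃ = g σ₁ σ₃

/-- Equivalence of Kaneyama data: `h_{σ₂} ∘ g_{σ₁σ₂} = g'_{σ₁σ₂} ∘ h_{σ₁}` for some invertible
`h_σ` with the stated support. Rows are indexed by the source and columns by the target (as in the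
cocycle condition `g_{σ₁σ₂} g_{σ₂σ₃} = g_{σ₁σ₃}`), so that the composite of `g_{σ₁σ₂}` followed by
`h_{σ₂}` is the matrix product `g_{σ₁σ₂} h_{σ₂}`. -/
def KaneyamaData.Equiv {A : MultiSection.{u} F} (g g' : A.KaneyamaData) : Prop :=
  ∃ h : ∀ σ : F.conesOfDim n, Matrix (A.Idx σ.1) (A.Idx σ.1) ℂ,
    (∀ σ, IsUnit (h σ)) ∧
    (∀ σ α β, h σ α β ≠ 0 → ∀ x ∈ σ.1, 0 ≤ pair (A.slope α - A.slope β) x) ∧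
    ∀ σ₁ σ₂, g.g σ₁ σ₂ * h σ₂ = h σ₁ * g'.g σ₁ σ₂

end MultiSection

/-- If `R` is transitive and reflexive, the matrices supported on `R` are closed under products. -/
lemma support_mul {ι : Type*} [Fintype ι] {R : ι → ι → Prop}
    (ht : ∀ a b c, R a b → R b c → R a c) {p q : Matrix ι ι ℂ}
    (hp : ∀ a b, p a b ≠ 0 → R a b) (hq : ∀ a b, q a b ≠ 0 → R a b) (a b : ι)
    (h : (p * q) a b ≠ 0) : R a b := by
  rw [Matrix.mul_apply] at h
  obtain ⟨c, -, hc⟩ := Finset.exists_ne_zero_of_sum_ne_zero h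
  exact ht a c b (hp _ _ (left_ne_zero_of_mul hc)) (hq _ _ (right_ne_zero_of_mul hc))

/-- The inverse of an invertible matrix supported on a preorder is supported on it. -/
lemma support_inv {ι : Type*} [Fintype ι] [DecidableEq ι] {R : ι → ι → Prop}
    (hr : ∀ a, R a a) (ht : ∀ a b c, R a b → R b c → R a c) {p q : Matrix ι ι ℂ}
    (hp : ∀ a b, p a b ≠ 0 → R a b) (_hpq : p * q = 1) (hqp : q * p = 1) (a b : ι)
    (h : q a b ≠ 0) : R a b := by
  let W : Submodule ℂ (Matrix ι ι ℂ) :=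
    { carrier := {x | ∀ a b, x a b ≠ 0 → R a b}
      zero_mem' := fun a b h => absurd rfl h
      add_mem' := by
        intro x y hx hy a b h
        by_contra hR
        have h1 : x a b = 0 := by_contra fun h' => hR (hx a b h')
        have h2 : y a b = 0 := by_contra fun h' => hR (hy a b h')
        exact h (by simp [h1, h2])
      smul_mem' := by
        intro c x hx a b h
        exact hx a b fun h' => h (by simp [h']) }
  let T : W →ₗ[ℂ] W := (LinearMap.mulLeft ℂ p).restrict
    (fun x hx => by exact fun a b h => support_mul ht hp hx a b h)
  have hT : Function.Injective T := by
    intro x y hxy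
    have h1 : p * x.1 = p * y.1 := congrArg Subtype.val hxy
    have h2 := congrArg (q * ·) h1
    simp only [← mul_assoc, hqp, one_mul] at h2
    exact Subtype.ext h2
  have h1W : (1 : Matrix ι ι ℂ) ∈ W := by
    intro a b h
    by_cases hab : a = b
    · exact hab ▸ hr a
    · exact absurd (Matrix.one_apply_ne hab) h
  obtain ⟨x, hx⟩ := LinearMap.injective_iff_surjective.1 hT ⟨1, h1W⟩
  have hx' : p * x.1 = 1 := congrArg Subtype.val hx
  have : q = x.1 := by
    calc q = q * (p * x.1) := by rw [hx', mul_one]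
      _ = x.1 := by rw [← mul_assoc, hqp, one_mul]
  exact x.2 a b (this ▸ h)

namespace MultiSection

variable {n : ℕ} {F : Fan n} (A : MultiSection.{u} F)

lemma slope_le_trans {σ : Set (Fin n → ℝ)} (a b c : A.Idx σ)
    (h : ∀ x ∈ σ, 0 ≤ pair (A.slope a - A.slope b) x)
    (h' : ∀ x ∈ σ, 0 ≤ pair (A.slope b - A.slope c) x) :
    ∀ x ∈ σ, 0 ≤ pair (A.slope a - A.slope c) x := by
  intro x hx
  have := add_nonneg (h x hx) (h' x hx)
  rwa [← pair_add, sub_add_sub_cancel] at this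

lemma slope_le_refl {σ : Set (Fin n → ℝ)} (a : A.Idx σ) :
    ∀ x ∈ σ, 0 ≤ pair (A.slope a - A.slope a) x := by
  intro x _
  simp [pair]

/-- Equivalence of Kaneyama data is an equivalence relation. -/
def kaneyamaSetoid : Setoid A.KaneyamaData where
  r := KaneyamaData.Equiv
  iseqv :=
    { refl := fun g => by
        refine ⟨fun σ => 1, fun σ => isUnit_one, fun σ α β h => ?_, fun σ₁ σ₂ => by simp⟩
        by_cases hab : α = β
        · subst hab
          exact A.slope_le_refl α
        · exact absurd (Matrix.one_apply_ne hab) h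
      symm := by
        rintro g g' ⟨h, hu, hs, he⟩
        have h1 : ∀ σ, h σ * (h σ)⁻¹ = 1 := fun σ =>
          Matrix.mul_nonsing_inv _ ((Matrix.isUnit_iff_isUnit_det _).1 (hu σ))
        have h2 : ∀ σ, (h σ)⁻¹ * h σ = 1 := fun σ =>
          Matrix.nonsing_inv_mul _ ((Matrix.isUnit_iff_isUnit_det _).1 (hu σ))
        refine ⟨fun σ => (h σ)⁻¹, fun σ => ⟨⟨_, _, h2 σ, h1 σ⟩, rfl⟩, fun σ α β hab =>
          support_inv (R := fun α β : A.Idx σ.1 => ∀ x ∈ σ.1, 0 ≤ pair (A.slope α - A.slope β) x)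
            A.slope_le_refl A.slope_le_trans (hs σ) (h1 σ) (h2 σ) α β hab, fun σ₁ σ₂ => ?_⟩
        calc g'.g σ₁ σ₂ * (h σ₂)⁻¹
            = (h σ₁)⁻¹ * (h σ₁ * g'.g σ₁ σ₂) * (h σ₂)⁻¹ := by
              rw [← Matrix.mul_assoc, h2, Matrix.one_mul]
          _ = (h σ₁)⁻¹ * g.g σ₁ σ₂ := by
              rw [← he, Matrix.mul_assoc, Matrix.mul_assoc, h1, Matrix.mul_one]
      trans := by
        rintro g g' g'' ⟨h, hu, hs, he⟩ ⟨k, ku, ks, ke⟩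
        refine ⟨fun σ => h σ * k σ, fun σ => (hu σ).mul (ku σ), fun σ =>
          support_mul (R := fun α β : A.Idx σ.1 => ∀ x ∈ σ.1, 0 ≤ pair (A.slope α - A.slope β) x)
            A.slope_le_trans (hs σ) (ks σ), fun σ₁ σ₂ => ?_⟩
        rw [← Matrix.mul_assoc, he, Matrix.mul_assoc, ke, Matrix.mul_assoc] }

/-- `𝒦(𝕃)`: the set of equivalence classes of Kaneyama data. -/
def Moduli : Type u := Quotient A.kaneyamaSetoid

/-- The matrix entries as affine coordinates on the set of Kaneyama data. -/
def KaneyamaData.coord {A : MultiSection.{u} F} (g : A.KaneyamaData) :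
    ((p : F.conesOfDim n × F.conesOfDim n) × A.Idx p.1.1 × A.Idx p.2.1) → ℂ :=
  fun i => g.g i.1.1 i.1.2 i.2.1 i.2.2

/-- The Zariski topology on the variety of Kaneyama data: the closed sets are the common zero sets
of polynomials in the matrix entries. -/
instance : TopologicalSpace A.KaneyamaData :=
  TopologicalSpace.induced
    (fun g => (MvPolynomial.pointToPoint (k := ℂ) g.coord : PrimeSpectrum (MvPolynomial _ ℂ)))
    inferInstance

/-- `𝒦(𝕃)` carries the quotient of the Zariski topology. -/
instance : TopologicalSpace A.Moduli :=
  inferInstanceAs (TopologicalSpace (Quotient A.kaneyamaSetoid))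

/-- `dim_ℂ 𝒦(𝕃)`: the Krull dimension of the moduli space `𝒦(𝕃)` in its Zariski topology
(it is `⊥` if there are no Kaneyama data). -/
def moduliDim : WithBot ℕ∞ := topologicalKrullDim A.Moduli

end MultiSection

end TropicalMultiSection

end

/-!
A two-dimensional cone of a complete fan in the plane is a sector, and passing to the neighbouring
sector is a transitive permutation of the `N` sectors (`Fan.next`, `Fan.sameCycle_next`). Every
sector has two lifts to `𝕃`, counted with weight, and the lifts of neighbouring sectors are matched
along the common ray (`exists_matching`). So the lifts form a double cover of a cycle of length `N`.

Indecomposability enters through `not_exists_section`. A choice of one lift of each sector whose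
slopes agree on all the rays would define a continuous piecewise linear function on the plane, the
complementary lifts would define another one, and the multi-section with two sheets glued from
these two functions, which is a combinatorial union, would be a quotient of `𝕃`. Hence no such
choice exists. It follows that the two values of the slopes on each ray are distinct and that the
double cover has nontrivial monodromy, so that it is a single cycle of length `2 N`
(`Cyc.va_injective`, `Cyc.monodromy_ne`, `Cyc.sameCycle_cover`). Since the values on each ray are
distinct, the matrix between neighbouring sectors has, besides the two nonzero entries given by the
matching, at most one nonzero entry (`isTransition_mat`).

Diagonal gauge transformations, one scalar for each of the `2 N` lifts, normalize the matched
entries to `1` except for one, which the determinants around the cycle force to be a sign. The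
normalized data depend polynomially on the given ones, and are themselves polynomials in the `N`
remaining entries (`isInducing_offDiag`). The product of the `N` transition matrices around the
cycle is the identity. This is a nontrivial equation: if all the remaining entries vanish, the
product is antidiagonal by the monodromy (`Cyc.loop_ne_zero`). So the normalized data have dimension
at most `N - 1`. The map from them to the moduli space is continuous, surjective and open, because
the moduli space is the quotient by a group acting by homeomorphisms, and such maps do not raise the
dimension of Noetherian spaces (`topologicalKrullDim_le_of_isOpenMap`). Finally `N` is at most the
number of rays (`Fan.card_sectors_le`).
-/

noncomputable section

namespace TropicalMultiSection

/-! ### Krull dimension along open maps and in affine space -/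

/-- Every irreducible component of a Noetherian space dominates an irreducible target of a continuous
open map: it contains a nonempty open set, whose image is open and nonempty. -/
lemma dense_image_of_mem_irreducibleComponents {X Y : Type*} [TopologicalSpace X]
    [TopologicalSpace Y] [TopologicalSpace.NoetherianSpace X] [PreirreducibleSpace Y] {f : X → Y}
    (ho : IsOpenMap f) {Z : Set X} (hZ : Z ∈ irreducibleComponents X) : Dense (f '' Z) := by
  obtain ⟨o, h1, h2, h3⟩ :=
    TopologicalSpace.NoetherianSpace.exists_isOpen_nonempty_subset_irreducibleComponent Z hZ
  exact ((ho o h1).dense (h2.image f)).mono (image_mono h3)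

/-- Going up for irreducible closed sets along a continuous open map. -/
lemma exists_irreducible_closed_over {X Y : Type*} [TopologicalSpace X]
    [TopologicalSpace Y] [TopologicalSpace.NoetherianSpace X] {f : X → Y}
    (hc : Continuous f) (ho : IsOpenMap f) {W : Set Y} (hW : IsIrreducible W) (hWc : IsClosed W)
    {Z : Set X} (hZ : IsIrreducible Z) (hZW : f '' Z ⊆ W) :
    ∃ Z', IsIrreducible Z' ∧ IsClosed Z' ∧ Z ⊆ Z' ∧ closure (f '' Z') = W := by
  have hP : IsClosed (f ⁻¹' W) := hWc.preimage hc
  have : PreirreducibleSpace W := Subtype.preirreducibleSpace hW.isPreirreducible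
  have hZP : Z ⊆ f ⁻¹' W := image_subset_iff.1 hZW
  have hirr : IsIrreducible ((↑) ⁻¹' Z : Set (f ⁻¹' W)) := by
    refine ⟨let ⟨z, hz⟩ := hZ.1; ⟨⟨z, hZP hz⟩, hz⟩, ?_⟩
    rintro _ _ ⟨u, hu, rfl⟩ ⟨v, hv, rfl⟩ ⟨x, hx, hxu⟩ ⟨y, hy, hyv⟩
    obtain ⟨z, hz, hz'⟩ := hZ.2 u v hu hv ⟨x, hx, hxu⟩ ⟨y, hy, hyv⟩
    exact ⟨⟨z, hZP hz⟩, hz, hz'⟩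
  obtain ⟨T, hT, hZT⟩ := exists_mem_irreducibleComponents_subset_of_isIrreducible _ hirr
  have hd := dense_image_of_mem_irreducibleComponents (ho.restrictPreimage W) hT
  refine ⟨(↑) '' T, hT.1.image _ continuous_subtype_val.continuousOn,
    hP.isClosedEmbedding_subtypeVal.isClosedMap _ (isClosed_of_mem_irreducibleComponents T hT),
    fun z hz => ⟨⟨z, hZP hz⟩, hZT hz, rfl⟩, ?_⟩
  apply subset_antisymm
  · refine closure_minimal ?_ hWc
    rintro _ ⟨_, ⟨z, _, rfl⟩, rfl⟩
    exact z.2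
  · intro w hw
    have h1 := hd ⟨w, hw⟩
    have h2 := image_closure_subset_closure_image continuous_subtype_val
      (mem_image_of_mem Subtype.val h1)
    refine closure_mono ?_ h2
    rintro _ ⟨_, ⟨z, hz, rfl⟩, rfl⟩
    exact ⟨z, ⟨z, hz, rfl⟩, rfl⟩

/-- A continuous open surjection from a Noetherian space does not raise the Krull dimension.
(For quotient maps that are not open this fails.) -/
theorem topologicalKrullDim_le_of_isOpenMap {X Y : Type*} [TopologicalSpace X]
    [TopologicalSpace Y] [TopologicalSpace.NoetherianSpace X] {f : X → Y}
    (hc : Continuous f) (ho : IsOpenMap f) (hs : Function.Surjective f) :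
    topologicalKrullDim Y ≤ topologicalKrullDim X := by
  have key : ∀ p : LTSeries (TopologicalSpace.IrreducibleCloseds Y),
      ∃ q : LTSeries (TopologicalSpace.IrreducibleCloseds X), q.length = p.length ∧
        closure (f '' q.last.carrier) = p.last.carrier := by
    intro p
    induction p using RelSeries.inductionOn' with
    | singleton W =>
      obtain ⟨y, hy⟩ := W.isIrreducible'.nonempty
      obtain ⟨x, rfl⟩ := hs y
      obtain ⟨Z, h1, h2, -, h4⟩ := exists_irreducible_closed_over hc ho W.isIrreducible'
        W.isClosed' (isIrreducible_singleton (x := x)) (by simpa using hy)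
      exact ⟨RelSeries.singleton _ ⟨Z, h1, h2⟩, rfl, h4⟩
    | snoc p W hW ih =>
      obtain ⟨q, h1, h2⟩ := ih
      obtain ⟨Z, h3, h4, h5, h6⟩ := exists_irreducible_closed_over hc ho W.isIrreducible'
        W.isClosed' q.last.isIrreducible'
        (subset_closure.trans (h2.trans_subset (le_of_lt (show p.last < W from hW))))
      have hlt : q.last < ⟨Z, h3, h4⟩ := by
        refine lt_of_le_of_ne h5 fun h => ?_
        have h7 : q.last.carrier = Z := congrArg TopologicalSpace.IrreducibleCloseds.carrier h
        rw [h7, h6] at h2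
        have h8 : p.last < W := hW
        exact h8.ne (SetLike.coe_injective h2.symm)
      refine ⟨q.snoc ⟨Z, h3, h4⟩ hlt, by simp [h1], ?_⟩
      rw [RelSeries.last_snoc, RelSeries.last_snoc]
      exact h6
  refine iSup_le fun p => ?_
  obtain ⟨q, h1, -⟩ := key p
  rw [← h1]
  exact le_iSup (fun q : LTSeries (TopologicalSpace.IrreducibleCloseds X) =>
    ((q.length : ℕ) : WithBot ℕ∞)) q

/-- Polynomial maps between affine spaces are induced by ring homomorphisms. -/
lemma pointToPoint_aeval {ι κ : Type*} (P : κ → MvPolynomial ι ℂ) (x : ι → ℂ) :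
    (MvPolynomial.pointToPoint (k := ℂ) (fun j => MvPolynomial.eval x (P j)) :
      PrimeSpectrum (MvPolynomial κ ℂ)) =
    PrimeSpectrum.comap (MvPolynomial.aeval P : MvPolynomial κ ℂ →ₐ[ℂ] MvPolynomial ι ℂ).toRingHom
      (MvPolynomial.pointToPoint (k := ℂ) x) := by
  apply PrimeSpectrum.ext
  ext p
  change p ∈ MvPolynomial.vanishingIdeal ℂ _ ↔
    MvPolynomial.aeval P p ∈ MvPolynomial.vanishingIdeal ℂ _
  rw [MvPolynomial.mem_vanishingIdeal_singleton_iff, MvPolynomial.mem_vanishingIdeal_singleton_iff]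
  have : MvPolynomial.aeval x (MvPolynomial.aeval P p) =
      MvPolynomial.aeval (fun j => MvPolynomial.eval x (P j)) p := by
    have := MvPolynomial.comp_aeval_apply (R := ℂ) P (MvPolynomial.aeval (R := ℂ) x) p
    rw [this]
    rfl
  rw [this]

/-- A proper closed subset of affine space has smaller dimension. -/
lemma topologicalKrullDim_add_one_le {ι S : Type*} [Finite ι] [TopologicalSpace S]
    {T : S → PrimeSpectrum (MvPolynomial ι ℂ)} (hT : IsInducing T) {f : MvPolynomial ι ℂ}
    (hf : f ≠ 0) (hTf : ∀ s, T s ∈ PrimeSpectrum.zeroLocus {f}) :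
    topologicalKrullDim S + 1 ≤ (Nat.card ι : WithBot ℕ∞) := by
  have h1 : IsInducing fun s => (⟨T s, hTf s⟩ : PrimeSpectrum.zeroLocus {f}) :=
    IsInducing.of_comp (hT.continuous.subtype_mk _) continuous_subtype_val hT
  have hE : IsClosedEmbedding (PrimeSpectrum.comap (Ideal.Quotient.mk (Ideal.span {f}))) :=
    PrimeSpectrum.isClosedEmbedding_comap_of_surjective _ _ Ideal.Quotient.mk_surjective
  have hr : range (PrimeSpectrum.comap (Ideal.Quotient.mk (Ideal.span {f}))) =
      PrimeSpectrum.zeroLocus {f} := by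
    rw [range_comap_of_surjective _ _ Ideal.Quotient.mk_surjective, Ideal.mk_ker,
      PrimeSpectrum.zeroLocus_span]
  have h2 : topologicalKrullDim (PrimeSpectrum.zeroLocus ({f} : Set (MvPolynomial ι ℂ))) ≤
      ringKrullDim (MvPolynomial ι ℂ ⧸ Ideal.span {f}) := by
    rw [← PrimeSpectrum.topologicalKrullDim_eq_ringKrullDim, ← hr]
    exact (hE.isEmbedding.toHomeomorph.symm.isInducing).topologicalKrullDim_le
  have h3 := ringKrullDim_quotient_succ_le_of_nonZeroDivisor (mem_nonZeroDivisors_of_ne_zero hf)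
  rw [MvPolynomial.ringKrullDim_of_isNoetherianRing, ringKrullDim_eq_zero_of_field, zero_add] at h3
  exact (add_le_add (h1.topologicalKrullDim_le.trans h2) le_rfl).trans h3

/-! ### Carriers of points in a complete fan -/

section Pairing

variable {n : ℕ}

lemma pair_add_right (m : Fin n → ℤ) (x y : Fin n → ℝ) : pair m (x + y) = pair m x + pair m y := by
  simp [pair, mul_add, Finset.sum_add_distrib]

lemma pair_smul_right (m : Fin n → ℤ) (c : ℝ) (x : Fin n → ℝ) : pair m (c • x) = c * pair m x := by
  simp [pair, Finset.mul_sum, mul_left_comm]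

lemma pair_zero_right (m : Fin n → ℤ) : pair m (0 : Fin n → ℝ) = 0 := by simp [pair]

lemma pair_zero_left (x : Fin n → ℝ) : pair (0 : Fin n → ℤ) x = 0 := by simp [pair]

lemma pair_sub (m m' : Fin n → ℤ) (x : Fin n → ℝ) :
    pair (m - m') x = pair m x - pair m' x := by
  rw [sub_eq_add_neg, pair_add, pair_neg, sub_eq_add_neg]

lemma pair_single (i : Fin n) (x : Fin n → ℝ) : pair (Pi.single i 1) x = x i := by
  simp [pair, Pi.single_apply]

lemma pair_intCast (m v : Fin n → ℤ) :
    pair m (fun i => (v i : ℝ)) = ((∑ i, m i * v i : ℤ) : ℝ) := by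
  simp [pair]

lemma continuous_pair (m : Fin n → ℤ) : Continuous (pair m) := by
  unfold pair
  fun_prop

end Pairing

namespace Fan

variable {n : ℕ} (F : Fan n)

/-- The relative interior of a cone in `N_ℝ`: the points on which no nonnegative integral functional
vanishes, unless it vanishes on the whole cone. -/
def InRelInt (σ : Set (Fin n → ℝ)) (x : Fin n → ℝ) : Prop :=
  x ∈ σ ∧ ∀ m : Fin n → ℤ, (∀ y ∈ σ, 0 ≤ pair m y) → pair m x = 0 → ∀ y ∈ σ, pair m y = 0

variable {F}

lemma exists_hull {σ : Set (Fin n → ℝ)} (hσ : σ ∈ F.cones) :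
    ∃ C : PointedCone ℝ (Fin n → ℝ), (C : Set (Fin n → ℝ)) = σ := by
  obtain ⟨s, -, h⟩ := F.rational σ hσ
  exact ⟨_, h.symm⟩

lemma zero_mem {σ : Set (Fin n → ℝ)} (hσ : σ ∈ F.cones) : (0 : Fin n → ℝ) ∈ σ := by
  obtain ⟨C, rfl⟩ := F.exists_hull hσ
  exact C.zero_mem

lemma add_mem {σ : Set (Fin n → ℝ)} (hσ : σ ∈ F.cones) {x y : Fin n → ℝ} (hx : x ∈ σ)
    (hy : y ∈ σ) : x + y ∈ σ := by
  obtain ⟨C, rfl⟩ := F.exists_hull hσ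
  exact C.add_mem hx hy

lemma smul_mem {σ : Set (Fin n → ℝ)} (hσ : σ ∈ F.cones) {x : Fin n → ℝ} {c : ℝ} (hc : 0 ≤ c)
    (hx : x ∈ σ) : c • x ∈ σ := by
  obtain ⟨C, rfl⟩ := F.exists_hull hσ
  exact C.smul_mem hc hx

lemma convex {σ : Set (Fin n → ℝ)} (hσ : σ ∈ F.cones) : Convex ℝ σ :=
  fun _ hx _ hy _ _ ha hb _ => F.add_mem hσ (F.smul_mem hσ ha hx) (F.smul_mem hσ hb hy)

/-- The sum of the generators of a cone lies in its relative interior. -/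
lemma exists_inRelInt {σ : Set (Fin n → ℝ)} (hσ : σ ∈ F.cones) : ∃ x, InRelInt σ x := by
  obtain ⟨s, hs, h⟩ := F.rational σ hσ
  have hmem : ∀ v ∈ s, (fun i => (v i : ℝ)) ∈ σ := fun v hv => by
    rw [h]
    exact PointedCone.subset_hull (mem_image_of_mem _ hv)
  have hsum : ∀ m : Fin n → ℤ, pair m (∑ v ∈ hs.toFinset, fun i => (v i : ℝ)) =
      ∑ v ∈ hs.toFinset, pair m (fun i => (v i : ℝ)) := fun m =>
    map_sum (⟨⟨pair m, pair_zero_right m⟩, pair_add_right m⟩ : (Fin n → ℝ) →+ ℝ) _ _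
  refine ⟨∑ v ∈ hs.toFinset, fun i => (v i : ℝ), ?_, fun m hm h0 y hy => ?_⟩
  · obtain ⟨C, rfl⟩ := F.exists_hull hσ
    exact C.sum_mem fun v hv => hmem v (hs.mem_toFinset.1 hv)
  · rw [hsum, Finset.sum_eq_zero_iff_of_nonneg
      fun v hv => hm _ (hmem v (hs.mem_toFinset.1 hv))] at h0
    rw [h] at hy
    refine Submodule.span_induction (p := fun y _ => pair m y = 0) ?_ (pair_zero_right m) ?_ ?_ hy
    · rintro _ ⟨v, hv, rfl⟩
      exact h0 v (hs.mem_toFinset.2 hv)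
    · intro a b _ _ ha hb
      rw [pair_add_right, ha, hb, add_zero]
    · intro c a _ ha
      have := pair_smul_right m (c : ℝ) a
      rw [ha, mul_zero] at this
      exact this

lemma InRelInt.segment {σ : Set (Fin n → ℝ)} (hσ : σ ∈ F.cones) {s x : Fin n → ℝ}
    (hs : InRelInt σ s) (hx : x ∈ σ) {ε : ℝ} (hε : 0 < ε) : InRelInt σ (x + ε • s) := by
  refine ⟨F.add_mem hσ hx (F.smul_mem hσ hε.le hs.1), fun m hm h0 => hs.2 m hm ?_⟩
  rw [pair_add_right, pair_smul_right] at h0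
  have h1 := hm x hx
  have h2 := mul_nonneg hε.le (hm s hs.1)
  exact (mul_eq_zero.1 (by linarith : ε * pair m s = 0)).resolve_left hε.ne'

variable (F) in
/-- The carrier of a point: the intersection of the cones containing it. In a complete fan this is
the smallest cone containing the point. -/
def carrier (x : Fin n → ℝ) : Set (Fin n → ℝ) := ⋂₀ {σ ∈ F.cones | x ∈ σ}

lemma carrier_subset {σ : Set (Fin n → ℝ)} (hσ : σ ∈ F.cones) {x : Fin n → ℝ} (hx : x ∈ σ) :
    F.carrier x ⊆ σ :=
  sInter_subset_of_mem ⟨hσ, hx⟩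

lemma mem_carrier (x : Fin n → ℝ) : x ∈ F.carrier x := fun _ h => h.2

lemma inter_mem {σ τ : Set (Fin n → ℝ)} (hσ : σ ∈ F.cones) (hτ : τ ∈ F.cones) :
    σ ∩ τ ∈ F.cones :=
  F.face_mem σ hσ _ (F.inter_isFace σ hσ τ hτ)

lemma exists_mem_cones (hF : F.IsComplete) (x : Fin n → ℝ) : ∃ σ ∈ F.cones, x ∈ σ := by
  have : x ∈ ⋃₀ F.cones := hF ▸ mem_univ x
  exact this

lemma carrier_mem (hF : F.IsComplete) (x : Fin n → ℝ) : F.carrier x ∈ F.cones := by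
  have hfin : {σ ∈ F.cones | x ∈ σ}.Finite := F.finite.subset fun _ h => h.1
  obtain ⟨σ, hσ, hxσ⟩ := F.exists_mem_cones hF x
  obtain ⟨τ, hτ⟩ := hfin.exists_minimal ⟨σ, hσ, hxσ⟩
  have : F.carrier x = τ := by
    refine subset_antisymm (carrier_subset hτ.1.1 hτ.1.2) (subset_sInter fun ρ hρ => ?_)
    have h := hτ.2 (⟨F.inter_mem hτ.1.1 hρ.1, hτ.1.2, hρ.2⟩ : τ ∩ ρ ∈ {σ ∈ F.cones | x ∈ σ})
      inter_subset_left
    exact fun y hy => (h hy).2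
  exact this ▸ hτ.1.1

lemma inRelInt_carrier (hF : F.IsComplete) (x : Fin n → ℝ) : InRelInt (F.carrier x) x := by
  refine ⟨mem_carrier x, fun m hm h0 y hy => ?_⟩
  have h1 := F.face_mem _ (F.carrier_mem hF x) {y ∈ F.carrier x | pair m y = 0} ⟨m, hm, rfl⟩
  exact (carrier_subset h1 ⟨mem_carrier x, h0⟩ hy).2

lemma carrier_isFace (hF : F.IsComplete) {σ : Set (Fin n → ℝ)} (hσ : σ ∈ F.cones)
    {x : Fin n → ℝ} (hx : x ∈ σ) : IsFace (F.carrier x) σ := by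
  have := F.inter_isFace σ hσ _ (F.carrier_mem hF x)
  rwa [inter_eq_right.2 (carrier_subset hσ hx)] at this

lemma InRelInt.carrier_eq (hF : F.IsComplete) {σ : Set (Fin n → ℝ)} (hσ : σ ∈ F.cones)
    {x : Fin n → ℝ} (hx : InRelInt σ x) : F.carrier x = σ := by
  obtain ⟨m, hm, h⟩ := F.carrier_isFace hF hσ hx.1
  refine subset_antisymm (carrier_subset hσ hx.1) fun y hy => ?_
  rw [h]
  have h0 : x ∈ {y ∈ σ | pair m y = 0} := h ▸ mem_carrier x
  exact ⟨hy, hx.2 m hm h0.2 y hy⟩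

end Fan

/-! ### Two-dimensional cones of a complete fan in the plane -/

/-- The determinant of two vectors in the plane. -/
def det2 (v w : Fin 2 → ℝ) : ℝ := v 0 * w 1 - v 1 * w 0

lemma det2_comb (r l x : Fin 2 → ℝ) : det2 r l • x = det2 x l • r + det2 r x • l := by
  ext i
  fin_cases i <;> simp [det2] <;> ring

lemma det2_mul_det2 (u z r l : Fin 2 → ℝ) :
    det2 u z * det2 r l = det2 z l * det2 u r + det2 r z * det2 u l := by
  simp only [det2]; ring

lemma det2_add_right (u x y : Fin 2 → ℝ) : det2 u (x + y) = det2 u x + det2 u y := by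
  simp only [det2, Pi.add_apply]; ring

lemma det2_add_left (u x y : Fin 2 → ℝ) : det2 (x + y) u = det2 x u + det2 y u := by
  simp only [det2, Pi.add_apply]; ring

lemma det2_smul_right (c : ℝ) (u x : Fin 2 → ℝ) : det2 u (c • x) = c * det2 u x := by
  simp only [det2, Pi.smul_apply, smul_eq_mul]; ring

lemma det2_smul_left (c : ℝ) (u x : Fin 2 → ℝ) : det2 (c • x) u = c * det2 x u := by
  simp only [det2, Pi.smul_apply, smul_eq_mul]; ring

lemma det2_self (x : Fin 2 → ℝ) : det2 x x = 0 := by simp only [det2]; ring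

lemma det2_swap (x y : Fin 2 → ℝ) : det2 y x = -det2 x y := by simp only [det2]; ring

lemma det2_zero_left (x : Fin 2 → ℝ) : det2 0 x = 0 := by simp [det2]

lemma det2_zero_right (x : Fin 2 → ℝ) : det2 x 0 = 0 := by simp [det2]

lemma continuous_det2_left (r : Fin 2 → ℝ) : Continuous fun x => det2 x r := by
  unfold det2; fun_prop

lemma continuous_det2_right (r : Fin 2 → ℝ) : Continuous fun x => det2 r x := by
  unfold det2; fun_prop

/-- A finitely generated strictly convex cone in the plane is zero, a ray, or spanned by two of its
generators. -/
lemma hull_plane {s : Set (Fin 2 → ℝ)} (hs : s.Finite)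
    (hc : ∀ x ∈ PointedCone.hull ℝ s, -x ∈ PointedCone.hull ℝ s → x = 0) :
    (∃ v, ∀ x ∈ PointedCone.hull ℝ s, ∃ c : ℝ, x = c • v) ∨
    ∃ r ∈ s, ∃ l ∈ s, 0 < det2 r l ∧
      ∀ x ∈ PointedCone.hull ℝ s, 0 ≤ det2 r x ∧ 0 ≤ det2 x l := by
  -- the induction on the generators needs a ray to have a generator of the cone as direction
  suffices h : (∃ v ∈ insert 0 s, ∀ x ∈ PointedCone.hull ℝ s, ∃ c : ℝ, 0 ≤ c ∧ x = c • v) ∨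
      ∃ r ∈ s, ∃ l ∈ s, 0 < det2 r l ∧
        ∀ x ∈ PointedCone.hull ℝ s, 0 ≤ det2 r x ∧ 0 ≤ det2 x l by
    rcases h with ⟨v, -, hv⟩ | h
    · exact Or.inl ⟨v, fun x hx => let ⟨c, _, h⟩ := hv x hx; ⟨c, h⟩⟩
    · exact Or.inr h
  induction s, hs using Set.Finite.induction_on with
  | empty =>
    refine Or.inl ⟨0, by simp, fun x hx => ⟨0, le_rfl, ?_⟩⟩
    simpa using hx
  | @insert u s _ _ ih =>
    set H := PointedCone.hull ℝ (insert u s) with hH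
    have hsub : PointedCone.hull ℝ s ≤ H := Submodule.span_mono (subset_insert _ _)
    have hu : u ∈ H := PointedCone.subset_hull (mem_insert _ _)
    have hdec : ∀ x ∈ H, ∃ a : ℝ, 0 ≤ a ∧ ∃ z ∈ PointedCone.hull ℝ s, x = a • u + z := by
      intro x hx
      obtain ⟨a, z, hz, h⟩ := Submodule.mem_span_insert.1 hx
      exact ⟨a, a.2, z, hz, h⟩
    have hsm : ∀ (c : ℝ) (x : Fin 2 → ℝ), 0 ≤ c → x ∈ H → c • x ∈ H :=
      fun c x hc hx => H.smul_mem hc hx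
    -- strict convexity: no positive multiple of `x` has its negative in the cone unless `x = 0`
    have hneg : ∀ (a : ℝ) (x y : Fin 2 → ℝ), 0 < a → x ∈ H → y ∈ H → a • x + y = 0 → x = 0 := by
      intro a x y ha hx hy h
      refine hc x hx ?_
      have h1 : -x = a⁻¹ • y := by
        rw [eq_neg_of_add_eq_zero_right h, smul_neg, smul_smul, inv_mul_cancel₀ ha.ne', one_smul]
      rw [h1]
      exact hsm _ _ (inv_nonneg.2 ha.le) hy
    rcases ih (fun x hx hx' => hc x (hsub hx) (hsub hx')) with
      ⟨v, hvs, hv⟩ | ⟨r, hr, l, hl, hrl, h⟩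
    · have hvH : v ∈ H := by
        rcases hvs with rfl | hvs
        · exact H.zero_mem
        · exact PointedCone.subset_hull (mem_insert_of_mem _ hvs)
      by_cases hv0 : v = 0
      · subst hv0
        refine Or.inl ⟨u, by simp, fun x hx => ?_⟩
        obtain ⟨a, ha, z, hz, rfl⟩ := hdec x hx
        obtain ⟨c, hc, rfl⟩ := hv z hz
        exact ⟨a, ha, by simp⟩
      have hvs' : v ∈ s := hvs.resolve_left hv0
      rcases lt_trichotomy (det2 v u) 0 with hd | hd | hd
      · refine Or.inr ⟨u, mem_insert _ _, v, mem_insert_of_mem _ hvs', by rw [det2_swap]; linarith,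
          fun x hx => ?_⟩
        obtain ⟨a, ha, z, hz, rfl⟩ := hdec x hx
        obtain ⟨c, hc, rfl⟩ := hv z hz
        simp only [det2_add_left, det2_add_right, det2_smul_left, det2_smul_right, det2_self,
          det2_swap v u]
        constructor <;> nlinarith
      · -- `u` is proportional to `v`, and not a negative multiple by strict convexity
        obtain ⟨k, hk⟩ : ∃ k : ℝ, u = k • v := by
          by_cases h0 : v 0 = 0
          · have h1 : v 1 ≠ 0 := fun h1 => hv0 (by ext i; fin_cases i <;> simp [h0, h1])
            refine ⟨u 1 / v 1, ?_⟩
            have h2 : u 0 = 0 := by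
              have : v 1 * u 0 = 0 := by simp only [det2, h0] at hd; linarith
              exact (mul_eq_zero.1 this).resolve_left h1
            ext i
            fin_cases i <;> simp [h0, h1, h2]
          · refine ⟨u 0 / v 0, ?_⟩
            simp only [det2] at hd
            ext i
            fin_cases i
            all_goals simp
            all_goals field_simp
            all_goals linarith
        have hk0 : 0 ≤ k := by
          by_contra hk0
          refine hv0 (hneg (-k) v u (by linarith) hvH hu ?_)
          rw [hk, neg_smul, neg_add_cancel]
        refine Or.inl ⟨v, mem_insert_of_mem _ (mem_insert_of_mem _ hvs'), fun x hx => ?_⟩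
        obtain ⟨a, ha, z, hz, rfl⟩ := hdec x hx
        obtain ⟨c, hc, rfl⟩ := hv z hz
        exact ⟨a * k + c, by positivity, by rw [hk, smul_smul, add_smul]⟩
      · refine Or.inr ⟨v, mem_insert_of_mem _ hvs', u, mem_insert _ _, hd, fun x hx => ?_⟩
        obtain ⟨a, ha, z, hz, rfl⟩ := hdec x hx
        obtain ⟨c, hc, rfl⟩ := hv z hz
        simp only [det2_add_left, det2_add_right, det2_smul_left, det2_smul_right, det2_self]
        constructor <;> nlinarith
    · -- `u` lies to the right of `r`, to the left of `l`, between them, or, against strict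
      -- convexity, opposite to them
      have hrH : r ∈ H := PointedCone.subset_hull (mem_insert_of_mem _ hr)
      have hlH : l ∈ H := PointedCone.subset_hull (mem_insert_of_mem _ hl)
      have hr0 : r ≠ 0 := by rintro rfl; simp [det2_zero_left] at hrl
      have hl0 : l ≠ 0 := by rintro rfl; simp [det2_zero_right] at hrl
      have hcomb := det2_comb r l u
      rcases lt_or_ge (det2 r u) 0 with h1 | h1
      · rcases lt_or_ge 0 (det2 u l) with h2 | h2
        · refine Or.inr ⟨u, mem_insert _ _, l, mem_insert_of_mem _ hl, h2, fun x hx => ?_⟩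
          obtain ⟨a, ha, z, hz, rfl⟩ := hdec x hx
          obtain ⟨h3, h4⟩ := h z hz
          have h5 := det2_mul_det2 u z r l
          rw [det2_swap r u] at h5
          have h6 : 0 ≤ det2 u z := by
            by_contra h6
            nlinarith [mul_nonneg h4 (neg_nonneg.2 h1.le), mul_nonneg h3 h2.le,
              mul_neg_of_neg_of_pos (not_le.1 h6) hrl]
          simp only [det2_add_left, det2_add_right, det2_smul_left, det2_smul_right, det2_self]
          constructor
          · linarith
          · nlinarith
        · exfalso
          refine hl0 (hneg (-det2 r u) l (det2 r l • u + (-det2 u l) • r) (by linarith) hlH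
            (H.add_mem (hsm _ _ hrl.le hu) (hsm _ _ (by linarith) hrH)) ?_)
          rw [hcomb]
          module
      · rcases lt_or_ge (det2 u l) 0 with h2 | h2
        · rcases h1.lt_or_eq with h1 | h1
          · refine Or.inr ⟨r, mem_insert_of_mem _ hr, u, mem_insert _ _, h1, fun x hx => ?_⟩
            obtain ⟨a, ha, z, hz, rfl⟩ := hdec x hx
            obtain ⟨h3, h4⟩ := h z hz
            have h5 := det2_mul_det2 u z r l
            rw [det2_swap r u, det2_swap z u] at h5
            have h6 : 0 ≤ det2 z u := by
              by_contra h6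
              nlinarith [mul_nonneg h4 h1.le, mul_nonneg h3 (neg_nonneg.2 h2.le),
                mul_neg_of_neg_of_pos (not_le.1 h6) hrl]
            simp only [det2_add_left, det2_add_right, det2_smul_left, det2_smul_right, det2_self]
            constructor
            · nlinarith
            · linarith
          · exfalso
            refine hr0 (hneg (-det2 u l) r (det2 r l • u) (by linarith) hrH (hsm _ _ hrl.le hu) ?_)
            rw [hcomb, ← h1]
            module
        · refine Or.inr ⟨r, mem_insert_of_mem _ hr, l, mem_insert_of_mem _ hl, hrl, fun x hx => ?_⟩
          obtain ⟨a, ha, z, hz, rfl⟩ := hdec x hx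
          obtain ⟨h3, h4⟩ := h z hz
          simp only [det2_add_left, det2_add_right, det2_smul_left, det2_smul_right]
          constructor <;> nlinarith

/-- A cone with two independent vectors is two-dimensional. -/
lemma coneDim_eq_two {σ : Set (Fin 2 → ℝ)} {x y : Fin 2 → ℝ} (hx : x ∈ σ) (hy : y ∈ σ)
    (h : det2 x y ≠ 0) : coneDim σ = 2 := by
  have htop : Submodule.span ℝ σ = ⊤ := by
    rw [eq_top_iff]
    intro z _
    have h1 := det2_comb x y z
    have h2 : z = (det2 x y)⁻¹ • (det2 z y • x + det2 x z • y) := by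
      rw [← h1, smul_smul, inv_mul_cancel₀ h, one_smul]
    rw [h2]
    exact Submodule.smul_mem _ _ (Submodule.add_mem _
      (Submodule.smul_mem _ _ (Submodule.subset_span hx))
      (Submodule.smul_mem _ _ (Submodule.subset_span hy)))
  rw [coneDim, htop, finrank_top]
  simp

namespace Fan

variable {F : Fan 2}

lemma exists_sector (σ : F.conesOfDim 2) : ∃ r l : Fin 2 → ℤ,
    0 < det2 (fun i => (r i : ℝ)) (fun i => (l i : ℝ)) ∧
    ∀ x, x ∈ σ.1 ↔ 0 ≤ det2 (fun i => (r i : ℝ)) x ∧ 0 ≤ det2 x (fun i => (l i : ℝ)) := by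
  obtain ⟨s, hs, h⟩ := F.rational σ.1 σ.2.1
  have hmem : ∀ v ∈ s, (fun i => (v i : ℝ)) ∈ σ.1 := fun v hv => by
    rw [h]
    exact PointedCone.subset_hull (mem_image_of_mem _ hv)
  rcases hull_plane (hs.image (fun v i => (v i : ℝ))) (fun x hx hx' =>
    F.strictlyConvex σ.1 σ.2.1 x (h ▸ hx) (h ▸ hx')) with
    ⟨v, hv⟩ | ⟨_, ⟨r, hr, rfl⟩, _, ⟨l, hl, rfl⟩, hrl, h'⟩
  · exfalso
    have h1 : Submodule.span ℝ σ.1 ≤ Submodule.span ℝ {v} := by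
      rw [Submodule.span_le]
      intro x hx
      rw [h] at hx
      obtain ⟨c, rfl⟩ := hv x hx
      exact Submodule.smul_mem _ _ (Submodule.mem_span_singleton_self v)
    have h2 := Submodule.finrank_mono h1
    have h3 := finrank_span_le_card (R := ℝ) ({v} : Set (Fin 2 → ℝ))
    have h4 : Module.finrank ℝ (Submodule.span ℝ σ.1) = 2 := σ.2.2
    simp at h3
    omega
  · refine ⟨r, l, hrl, fun x => ⟨fun hx => h' x (by rw [h] at hx; exact hx), fun hx => ?_⟩⟩
    have h1 := det2_comb (fun i => (r i : ℝ)) (fun i => (l i : ℝ)) x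
    have h2 : x = (det2 (fun i => (r i : ℝ)) (fun i => (l i : ℝ)))⁻¹ •
        (det2 x (fun i => (l i : ℝ)) • (fun i => (r i : ℝ)) +
          det2 (fun i => (r i : ℝ)) x • (fun i => (l i : ℝ))) := by
      rw [← h1, smul_smul, inv_mul_cancel₀ hrl.ne', one_smul]
    rw [h2]
    exact F.smul_mem σ.2.1 (inv_nonneg.2 hrl.le) (F.add_mem σ.2.1
      (F.smul_mem σ.2.1 hx.2 (hmem r hr)) (F.smul_mem σ.2.1 hx.1 (hmem l hl)))

/-- The integral generator of the right (clockwise) boundary ray of a two-dimensional cone. -/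
def rightZ (σ : F.conesOfDim 2) : Fin 2 → ℤ := (exists_sector σ).choose

/-- The integral generator of the left (counterclockwise) boundary ray. -/
def leftZ (σ : F.conesOfDim 2) : Fin 2 → ℤ := (exists_sector σ).choose_spec.choose

/-- The generator of the right boundary ray as a real vector. -/
def right (σ : F.conesOfDim 2) : Fin 2 → ℝ := fun i => (rightZ σ i : ℝ)

/-- The generator of the left boundary ray as a real vector. -/
def left (σ : F.conesOfDim 2) : Fin 2 → ℝ := fun i => (leftZ σ i : ℝ)

lemma det2_right_left (σ : F.conesOfDim 2) : 0 < det2 (right σ) (left σ) :=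
  (exists_sector σ).choose_spec.choose_spec.1

lemma mem_sector_iff (σ : F.conesOfDim 2) {x : Fin 2 → ℝ} :
    x ∈ σ.1 ↔ 0 ≤ det2 (right σ) x ∧ 0 ≤ det2 x (left σ) :=
  (exists_sector σ).choose_spec.choose_spec.2 x

lemma right_mem (σ : F.conesOfDim 2) : right σ ∈ σ.1 :=
  (mem_sector_iff σ).2 ⟨(det2_self _).ge, (det2_right_left σ).le⟩

lemma left_mem (σ : F.conesOfDim 2) : left σ ∈ σ.1 :=
  (mem_sector_iff σ).2 ⟨(det2_right_left σ).le, (det2_self _).ge⟩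

lemma isClosed_sector (σ : F.conesOfDim 2) : IsClosed σ.1 := by
  have : σ.1 = {x | 0 ≤ det2 (right σ) x} ∩ {x | 0 ≤ det2 x (left σ)} := by
    ext x
    exact mem_sector_iff σ
  rw [this]
  exact (isClosed_le continuous_const (continuous_det2_right _)).inter
    (isClosed_le continuous_const (continuous_det2_left _))

lemma left_ne_zero (σ : F.conesOfDim 2) : left σ ≠ 0 := fun h => by
  have := det2_right_left σ
  simp [h, det2_zero_right] at this

lemma sector_comb (σ : F.conesOfDim 2) (x : Fin 2 → ℝ) :
    x = (det2 x (left σ) / det2 (right σ) (left σ)) • right σ +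
      (det2 (right σ) x / det2 (right σ) (left σ)) • left σ := by
  have h := (det2_right_left σ).ne'
  have h1 := det2_comb (right σ) (left σ) x
  calc x = (det2 (right σ) (left σ))⁻¹ • (det2 (right σ) (left σ) • x) := by
        rw [smul_smul, inv_mul_cancel₀ h, one_smul]
    _ = _ := by rw [h1, smul_add, smul_smul, smul_smul, div_eq_inv_mul, div_eq_inv_mul]

lemma pair_eq_zero_of_sector (σ : F.conesOfDim 2) {m : Fin 2 → ℤ} (hr : pair m (right σ) = 0)
    (hl : pair m (left σ) = 0) (x : Fin 2 → ℝ) : pair m x = 0 := by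
  rw [sector_comb σ x, pair_add_right, pair_smul_right, pair_smul_right, hr, hl]
  simp

lemma inRelInt_sector (σ : F.conesOfDim 2) {x : Fin 2 → ℝ} (h1 : 0 < det2 (right σ) x)
    (h2 : 0 < det2 x (left σ)) : InRelInt σ.1 x := by
  refine ⟨(mem_sector_iff σ).2 ⟨h1.le, h2.le⟩, fun m hm h0 y _ => ?_⟩
  have hd := det2_right_left σ
  have h3 := hm _ (right_mem σ)
  have h4 := hm _ (left_mem σ)
  have h5 := sector_comb σ x
  have h6 : pair m x = (det2 x (left σ) / det2 (right σ) (left σ)) * pair m (right σ) +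
      (det2 (right σ) x / det2 (right σ) (left σ)) * pair m (left σ) := by
    conv_lhs => rw [h5]
    rw [pair_add_right, pair_smul_right, pair_smul_right]
  have h7 : 0 < det2 x (left σ) / det2 (right σ) (left σ) := div_pos h2 hd
  have h8 : 0 < det2 (right σ) x / det2 (right σ) (left σ) := div_pos h1 hd
  rw [h0] at h6
  have h9 := mul_nonneg h7.le h3
  have h10 := mul_nonneg h8.le h4
  exact pair_eq_zero_of_sector σ
    ((mul_eq_zero.1 (by linarith : _ * pair m (right σ) = 0)).resolve_left h7.ne')
    ((mul_eq_zero.1 (by linarith : _ * pair m (left σ) = 0)).resolve_left h8.ne') y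

/-- A two-dimensional cone containing an interior point of another one equals it. -/
lemma eq_of_inRelInt (hF : F.IsComplete) {σ τ : F.conesOfDim 2} {x : Fin 2 → ℝ}
    (hx : InRelInt σ.1 x) (hxτ : x ∈ τ.1) : σ = τ := by
  obtain ⟨m, hm, h⟩ := F.carrier_isFace hF τ.2.1 hxτ
  rw [hx.carrier_eq hF σ.2.1] at h
  have h1 : ∀ y ∈ σ.1, pair m y = 0 := fun y hy => by rw [h] at hy; exact hy.2
  have h2 := pair_eq_zero_of_sector σ (h1 _ (right_mem σ)) (h1 _ (left_mem σ))
  apply Subtype.ext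
  rw [h]
  ext y
  exact ⟨fun hy => hy.1, fun hy => ⟨hy, h2 y⟩⟩

lemma eq_smul_left (σ : F.conesOfDim 2) {x : Fin 2 → ℝ} (hx : x ∈ σ.1) (hx0 : x ≠ 0)
    (h : det2 x (left σ) = 0) : ∃ c : ℝ, 0 < c ∧ x = c • left σ := by
  have h1 := sector_comb σ x
  rw [h, zero_div, zero_smul, zero_add] at h1
  refine ⟨_, lt_of_le_of_ne (div_nonneg ((mem_sector_iff σ).1 hx).1 (det2_right_left σ).le) ?_, h1⟩
  intro h2
  rw [← h2, zero_smul] at h1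
  exact hx0 h1

lemma eq_smul_right (σ : F.conesOfDim 2) {x : Fin 2 → ℝ} (hx : x ∈ σ.1) (hx0 : x ≠ 0)
    (h : det2 (right σ) x = 0) : ∃ c : ℝ, 0 < c ∧ x = c • right σ := by
  have h1 := sector_comb σ x
  rw [h, zero_div, zero_smul, add_zero] at h1
  refine ⟨_, lt_of_le_of_ne (div_nonneg ((mem_sector_iff σ).1 hx).2 (det2_right_left σ).le) ?_, h1⟩
  intro h2
  rw [← h2, zero_smul] at h1
  exact hx0 h1

/-- A positive quantity stays positive under a small perturbation. -/
lemma exists_small {a b : ℝ} (ha : 0 < a) : ∃ ε : ℝ, 0 < ε ∧ 0 < a + ε * b := by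
  refine ⟨a / (|b| + 1), by positivity, ?_⟩
  have h1 : 0 < |b| + 1 := by positivity
  have h2 := neg_abs_le b
  have h3 : a + a / (|b| + 1) * b = a * (|b| + 1 + b) / (|b| + 1) := by field_simp
  rw [h3]
  exact div_pos (mul_pos ha (by linarith)) h1

/-- A two-dimensional cone is determined by its left boundary ray. -/
lemma eq_of_left (hF : F.IsComplete) {σ τ : F.conesOfDim 2} {x : Fin 2 → ℝ} (hx0 : x ≠ 0)
    (hxσ : x ∈ σ.1) (hσ : det2 x (left σ) = 0) (hxτ : x ∈ τ.1) (hτ : det2 x (left τ) = 0) :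
    σ = τ := by
  obtain ⟨c, hc, rfl⟩ := eq_smul_left σ hxσ hx0 hσ
  obtain ⟨d, hd, h⟩ := eq_smul_left τ hxτ hx0 hτ
  have h1 : 0 < det2 (right τ) (c • left σ) := by
    rw [h, det2_smul_right]
    exact mul_pos hd (det2_right_left τ)
  obtain ⟨ε, hε, h2⟩ := exists_small (b := det2 (right τ) (right σ)) h1
  have h3 : 0 < det2 (right σ) (left τ) := by
    have h4 : 0 < det2 (right σ) (d • left τ) := by
      rw [← h, det2_smul_right]
      exact mul_pos hc (det2_right_left σ)
    rw [det2_smul_right] at h4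
    exact (pos_iff_pos_of_mul_pos h4).1 hd
  -- a point of the interior of `σ` close to the common ray also lies in `τ`
  refine eq_of_inRelInt hF (x := c • left σ + ε • right σ) (inRelInt_sector σ ?_ ?_)
    ((mem_sector_iff τ).2 ⟨?_, ?_⟩)
  · simp only [det2_add_right, det2_smul_right, det2_self, mul_zero, add_zero]
    exact mul_pos hc (det2_right_left σ)
  · simp only [det2_add_left, det2_smul_left, det2_self, mul_zero, zero_add]
    exact mul_pos hε (det2_right_left σ)
  · rw [det2_add_right, det2_smul_right ε]
    exact h2.le
  · rw [det2_add_left, hτ, det2_smul_left, zero_add]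
    exact (mul_pos hε h3).le

/-- A two-dimensional cone is determined by its right boundary ray. -/
lemma eq_of_right (hF : F.IsComplete) {σ τ : F.conesOfDim 2} {x : Fin 2 → ℝ} (hx0 : x ≠ 0)
    (hxσ : x ∈ σ.1) (hσ : det2 (right σ) x = 0) (hxτ : x ∈ τ.1) (hτ : det2 (right τ) x = 0) :
    σ = τ := by
  obtain ⟨c, hc, rfl⟩ := eq_smul_right σ hxσ hx0 hσ
  obtain ⟨d, hd, h⟩ := eq_smul_right τ hxτ hx0 hτ
  have h1 : 0 < det2 (c • right σ) (left τ) := by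
    rw [h, det2_smul_left]
    exact mul_pos hd (det2_right_left τ)
  obtain ⟨ε, hε, h2⟩ := exists_small (b := det2 (left σ) (left τ)) h1
  have h3 : 0 < det2 (right τ) (left σ) := by
    have h4 : 0 < det2 (d • right τ) (left σ) := by
      rw [← h, det2_smul_left]
      exact mul_pos hc (det2_right_left σ)
    rw [det2_smul_left] at h4
    exact (pos_iff_pos_of_mul_pos h4).1 hd
  -- a point of the interior of `σ` close to the common ray also lies in `τ`
  refine eq_of_inRelInt hF (x := c • right σ + ε • left σ) (inRelInt_sector σ ?_ ?_)
    ((mem_sector_iff τ).2 ⟨?_, ?_⟩)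
  · simp only [det2_add_right, det2_smul_right, det2_self, mul_zero, zero_add]
    exact mul_pos hε (det2_right_left σ)
  · simp only [det2_add_left, det2_smul_left, det2_self, mul_zero, add_zero]
    exact mul_pos hc (det2_right_left σ)
  · rw [det2_add_right, hτ, det2_smul_right, zero_add]
    exact (mul_pos hε h3).le
  · rw [det2_add_left, det2_smul_left ε]
    exact h2.le

/-- An inequality between affine functions of `1 / (k + 1)` that holds for infinitely many `k`
holds in the limit. -/
lemma nonneg_of_infinite {K : Set ℕ} (hK : K.Infinite) {a b : ℝ}
    (h : ∀ k ∈ K, 0 ≤ a + (1 / ((k : ℝ) + 1)) * b) : 0 ≤ a := by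
  by_contra ha
  obtain ⟨ε, hε, h1⟩ := exists_small (b := -b) (neg_pos.2 (not_le.1 ha))
  obtain ⟨N, hN⟩ := exists_nat_one_div_lt hε
  obtain ⟨k, hk, hNk⟩ := hK.exists_gt N
  have h2 := h k hk
  have h3 : (1 / ((k : ℝ) + 1)) ≤ ε := by
    refine le_trans ?_ hN.le
    apply one_div_le_one_div_of_le (by positivity)
    have : (N : ℝ) ≤ k := by exact_mod_cast hNk.le
    linarith
  have h4 : 0 < 1 / ((k : ℝ) + 1) := by positivity
  rcases le_or_gt b 0 with hb | hb
  · nlinarith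
  · nlinarith

/-- On the counterclockwise side of every nonzero vector there is a two-dimensional cone. -/
lemma exists_sector_leftward (hF : F.IsComplete) {x : Fin 2 → ℝ} (hx : x ≠ 0) :
    ∃ τ : F.conesOfDim 2, x ∈ τ.1 ∧ 0 < det2 x (left τ) := by
  obtain ⟨w, hw⟩ : ∃ w : Fin 2 → ℝ, 0 < det2 x w := by
    refine ⟨![-x 1, x 0], ?_⟩
    have : det2 x ![-x 1, x 0] = x 0 ^ 2 + x 1 ^ 2 := by simp [det2]; ring
    rw [this]
    by_contra h
    refine hx ?_
    have h0 : x 0 = 0 := by nlinarith [sq_nonneg (x 0), sq_nonneg (x 1)]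
    have h1 : x 1 = 0 := by nlinarith [sq_nonneg (x 0), sq_nonneg (x 1)]
    ext i
    fin_cases i <;> simp [h0, h1]
  -- some cone contains infinitely many of the points `x + w / (k + 1)`, which tend to `x` from the
  -- counterclockwise side; by closedness it contains `x`
  choose f hf hf' using fun k : ℕ => F.exists_mem_cones hF (x + (1 / ((k : ℝ) + 1)) • w)
  have := F.finite.to_subtype
  obtain ⟨τ, hτ⟩ := Finite.exists_infinite_fiber (fun k => (⟨f k, hf k⟩ : F.cones))
  rw [Set.infinite_coe_iff] at hτ
  have hmem : ∀ k ∈ (fun k => (⟨f k, hf k⟩ : F.cones)) ⁻¹' {τ},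
      x + (1 / ((k : ℝ) + 1)) • w ∈ τ.1 := by
    rintro k rfl
    exact hf' k
  obtain ⟨k, hk⟩ := hτ.nonempty
  obtain ⟨k', hk', hkk⟩ := hτ.exists_gt k
  have hdim : coneDim τ.1 = 2 := by
    refine coneDim_eq_two (hmem k hk) (hmem k' hk') ?_
    have h1 : (1 / ((k' : ℝ) + 1)) < 1 / ((k : ℝ) + 1) := by
      apply one_div_lt_one_div_of_lt (by positivity)
      have : (k : ℝ) < k' := by exact_mod_cast hkk
      linarith
    simp only [det2_add_left, det2_add_right, det2_smul_left, det2_smul_right, det2_self,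
      det2_swap x w]
    nlinarith
  have hm2 : ∀ k ∈ (fun k => (⟨f k, hf k⟩ : F.cones)) ⁻¹' {τ}, _ := fun k hk =>
    (mem_sector_iff ⟨τ.1, τ.2, hdim⟩).1 (hmem k hk)
  set σ : F.conesOfDim 2 := ⟨τ.1, τ.2, hdim⟩
  have hxσ : x ∈ σ.1 := by
    rw [mem_sector_iff]
    constructor
    · refine nonneg_of_infinite hτ (b := det2 (right σ) w) fun k hk => ?_
      have := (hm2 k hk).1
      rwa [det2_add_right, det2_smul_right] at this
    · refine nonneg_of_infinite hτ (b := det2 w (left σ)) fun k hk => ?_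
      have := (hm2 k hk).2
      rwa [det2_add_left, det2_smul_left] at this
  -- if `x` were on the left boundary ray, the points `x + w / (k + 1)` would be outside `σ`
  refine ⟨σ, hxσ, lt_of_le_of_ne ((mem_sector_iff σ).1 hxσ).2 fun h0 => ?_⟩
  obtain ⟨c, hc, h⟩ := eq_smul_left σ hxσ hx h0.symm
  have h1 := (hm2 k hk).2
  rw [det2_add_left, ← h0, zero_add, det2_smul_left] at h1
  have h2 : det2 w x = c * det2 w (left σ) := by rw [h, det2_smul_right]
  have h3 : 0 < 1 / ((k : ℝ) + 1) := by positivity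
  have h4 : 0 ≤ det2 w (left σ) := by
    by_contra h4
    nlinarith
  rw [det2_swap x w] at h2
  nlinarith

lemma exists_sector_mem (hF : F.IsComplete) (x : Fin 2 → ℝ) : ∃ σ : F.conesOfDim 2, x ∈ σ.1 := by
  by_cases hx : x = 0
  · obtain ⟨σ, -⟩ := exists_sector_leftward hF (x := fun _ => 1)
      (fun h => one_ne_zero (congrFun h 0))
    exact ⟨σ, hx ▸ zero_mem σ.2.1⟩
  · obtain ⟨σ, h, -⟩ := exists_sector_leftward hF hx
    exact ⟨σ, h⟩

/-- Every cone of a complete fan in the plane lies in a two-dimensional one. -/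
lemma exists_sector_superset (hF : F.IsComplete) {σ : Set (Fin 2 → ℝ)} (hσ : σ ∈ F.cones) :
    ∃ τ : F.conesOfDim 2, σ ⊆ τ.1 := by
  obtain ⟨x, hx⟩ := exists_inRelInt hσ
  obtain ⟨τ, hτ⟩ := exists_sector_mem hF x
  exact ⟨τ, (hx.carrier_eq hF hσ) ▸ carrier_subset τ.2.1 hτ⟩

lemma isClosed_of_mem_cones (hF : F.IsComplete) {σ : Set (Fin 2 → ℝ)} (hσ : σ ∈ F.cones) :
    IsClosed σ := by
  obtain ⟨τ, hτ⟩ := exists_sector_superset hF hσ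
  obtain ⟨m, -, h⟩ := F.inter_isFace τ.1 τ.2.1 σ hσ
  rw [inter_eq_right.2 hτ] at h
  rw [h]
  exact (isClosed_sector τ).inter (isClosed_eq (continuous_pair m) continuous_const)

end Fan

/-! ### The cyclic order of the two-dimensional cones -/

namespace Fan

variable {F : Fan 2}

lemma exists_next (hF : F.IsComplete) (σ : F.conesOfDim 2) :
    ∃ τ : F.conesOfDim 2, left σ ∈ τ.1 ∧ det2 (right τ) (left σ) = 0 := by
  obtain ⟨τ, h1, h2⟩ := exists_sector_leftward hF (left_ne_zero σ)
  refine ⟨τ, h1, ?_⟩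
  by_contra h3
  have h4 : 0 < det2 (right τ) (left σ) := lt_of_le_of_ne ((mem_sector_iff τ).1 h1).1 (Ne.symm h3)
  have h5 := eq_of_inRelInt hF (inRelInt_sector τ h4 h2) (left_mem σ)
  rw [h5, det2_self] at h2
  exact lt_irrefl _ h2

instance : Finite (F.conesOfDim 2) := (F.finite.subset fun _ h => h.1).to_subtype

instance : Fintype (F.conesOfDim 2) := Fintype.ofFinite _

/-- The successor map on two-dimensional cones in counterclockwise order: the right boundary ray of
`next σ` is the left boundary ray of `σ`. -/
def next (hF : F.IsComplete) : Equiv.Perm (F.conesOfDim 2) :=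
  Equiv.ofBijective (fun σ => (exists_next hF σ).choose) <| by
    rw [← Finite.injective_iff_bijective]
    intro σ σ' h
    have h1 := (exists_next hF σ).choose_spec
    have h2 := (exists_next hF σ').choose_spec
    simp only at h
    rw [h] at h1
    obtain ⟨c, hc, h3⟩ := eq_smul_right _ h1.1 (left_ne_zero σ) h1.2
    obtain ⟨d, hd, h4⟩ := eq_smul_right _ h2.1 (left_ne_zero σ') h2.2
    have h5 : left σ = (c / d) • left σ' := by
      rw [h4, smul_smul, div_mul_cancel₀ _ hd.ne', ← h3]
    refine eq_of_left hF (left_ne_zero σ) (left_mem σ) (det2_self _) ?_ ?_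
    · rw [h5]
      exact F.smul_mem σ'.2.1 (by positivity) (left_mem σ')
    · rw [h5, det2_smul_left, det2_self, mul_zero]

lemma left_mem_next (hF : F.IsComplete) (σ : F.conesOfDim 2) : left σ ∈ (next hF σ).1 :=
  (exists_next hF σ).choose_spec.1

lemma det2_right_next (hF : F.IsComplete) (σ : F.conesOfDim 2) :
    det2 (right (next hF σ)) (left σ) = 0 :=
  (exists_next hF σ).choose_spec.2

lemma exists_left_eq_smul (hF : F.IsComplete) (σ : F.conesOfDim 2) :
    ∃ c : ℝ, 0 < c ∧ left σ = c • right (next hF σ) :=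
  eq_smul_right _ (left_mem_next hF σ) (left_ne_zero σ) (det2_right_next hF σ)

/-- Two different two-dimensional cones sharing a nonzero point are consecutive. -/
lemma eq_or_next (hF : F.IsComplete) {σ τ : F.conesOfDim 2} {x : Fin 2 → ℝ} (hx0 : x ≠ 0)
    (hσ : x ∈ σ.1) (hτ : x ∈ τ.1) :
    σ = τ ∨ (τ = next hF σ ∧ ∃ c : ℝ, x = c • left σ) ∨
      (σ = next hF τ ∧ ∃ c : ℝ, x = c • left τ) := by
  by_cases hst : σ = τ
  · exact Or.inl hst
  right
  have key : ∀ {σ τ : F.conesOfDim 2}, σ ≠ τ → x ∈ σ.1 → x ∈ τ.1 →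
      det2 (right σ) x = 0 ∨ det2 x (left σ) = 0 := by
    intro σ τ hst hσ hτ
    by_contra! h
    have h1 := (mem_sector_iff σ).1 hσ
    exact hst (eq_of_inRelInt hF (inRelInt_sector σ (lt_of_le_of_ne h1.1 h.1.symm)
      (lt_of_le_of_ne h1.2 h.2.symm)) hτ)
  have key2 : ∀ {σ τ : F.conesOfDim 2}, x ∈ σ.1 → x ∈ τ.1 → det2 x (left σ) = 0 →
      det2 (right τ) x = 0 → τ = next hF σ ∧ ∃ c : ℝ, x = c • left σ := by
    intro σ τ hσ hτ h h'
    obtain ⟨c, hc, rfl⟩ := eq_smul_left σ hσ hx0 h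
    refine ⟨eq_of_right hF hx0 hτ h' (F.smul_mem (next hF σ).2.1 hc.le (left_mem_next hF σ)) ?_,
      c, rfl⟩
    rw [det2_smul_right, det2_right_next, mul_zero]
  rcases key hst hσ hτ with h | h <;> rcases key (Ne.symm hst) hτ hσ with h' | h'
  · exact absurd (eq_of_right hF hx0 hσ h hτ h') hst
  · exact Or.inr (key2 hτ hσ h' h)
  · exact Or.inl (key2 hσ hτ h h')
  · exact absurd (eq_of_left hF hx0 hσ h hτ h') hst

lemma mem_or_next (hF : F.IsComplete) (σ : F.conesOfDim 2) {y : Fin 2 → ℝ}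
    (h1 : 0 < det2 (right σ) y) (h2 : 0 < det2 y (left (next hF σ))) :
    y ∈ σ.1 ∨ y ∈ (next hF σ).1 := by
  obtain ⟨c, hc, h⟩ := exists_left_eq_smul hF σ
  rcases le_or_gt 0 (det2 y (left σ)) with h3 | h3
  · exact Or.inl ((mem_sector_iff σ).2 ⟨h1.le, h3⟩)
  · refine Or.inr ((mem_sector_iff _).2 ⟨?_, h2.le⟩)
    rw [h, det2_smul_right, det2_swap] at h3
    nlinarith

/-- The two-dimensional cones form a single cycle: the union of a cycle is closed and, away from the
origin, open, while the punctured plane is connected. -/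
theorem sameCycle_next (hF : F.IsComplete) (σ τ : F.conesOfDim 2) : (next hF).SameCycle σ τ := by
  set C : Set (Fin 2 → ℝ) := ⋃ ρ ∈ {ρ | (next hF).SameCycle σ ρ}, ρ.1 with hC
  have hmemC : ∀ {ρ : F.conesOfDim 2} {y : Fin 2 → ℝ}, (next hF).SameCycle σ ρ → y ∈ ρ.1 → y ∈ C :=
    fun {ρ y} h hy => mem_biUnion (x := ρ) h hy
  have hclosed : IsClosed C := (Set.toFinite _).isClosed_biUnion fun ρ _ => isClosed_sector ρ
  -- near a common boundary ray the two adjacent cones cover a neighbourhood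
  have hray : ∀ ρ : F.conesOfDim 2, (next hF).SameCycle σ ρ → ∀ c : ℝ, 0 < c →
      c • left ρ ∈ interior C := by
    intro ρ hρ c hc
    rw [mem_interior]
    refine ⟨{y | 0 < det2 (right ρ) y} ∩ {y | 0 < det2 y (left (next hF ρ))}, ?_,
      (isOpen_lt continuous_const (continuous_det2_right _)).inter
      (isOpen_lt continuous_const (continuous_det2_left _)), ?_, ?_⟩
    · rintro y ⟨h1, h2⟩
      rcases mem_or_next hF ρ h1 h2 with h | h
      · exact hmemC hρ h
      · exact hmemC (Equiv.Perm.sameCycle_apply_right.2 hρ) h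
    · simp only [mem_ofPred_eq, det2_smul_right]
      exact mul_pos hc (det2_right_left ρ)
    · obtain ⟨d, hd, h⟩ := exists_left_eq_smul hF ρ
      simp only [mem_ofPred_eq, det2_smul_left, h]
      exact mul_pos hc (mul_pos hd (det2_right_left _))
  -- a point of the cycle is on the right ray of a cone, on its left ray, or in its interior
  have hopen : ∀ x ∈ C, x ≠ 0 → x ∈ interior C := by
    intro x hx hx0
    obtain ⟨ρ, hρ, hxρ⟩ := mem_iUnion₂.1 hx
    have h1 := (mem_sector_iff ρ).1 hxρ
    rcases h1.1.eq_or_lt with h2 | h2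
    · obtain ⟨c, hc, rfl⟩ := eq_smul_right ρ hxρ hx0 h2.symm
      obtain ⟨ρ', rfl⟩ := (next hF).surjective ρ
      obtain ⟨d, hd, h⟩ := exists_left_eq_smul hF ρ'
      have := hray ρ' (Equiv.Perm.sameCycle_apply_right.1 hρ) (c / d) (by positivity)
      rwa [h, smul_smul, div_mul_cancel₀ _ hd.ne'] at this
    · rcases h1.2.eq_or_lt with h3 | h3
      · obtain ⟨c, hc, rfl⟩ := eq_smul_left ρ hxρ hx0 h3.symm
        exact hray ρ hρ c hc
      · rw [mem_interior]
        exact ⟨{y | 0 < det2 (right ρ) y} ∩ {y | 0 < det2 y (left ρ)},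
          fun y hy => hmemC hρ ((mem_sector_iff ρ).2 ⟨hy.1.le, hy.2.le⟩),
          (isOpen_lt continuous_const (continuous_det2_right _)).inter
          (isOpen_lt continuous_const (continuous_det2_left _)), h2, h3⟩
  have hconn : IsPreconnected ({0}ᶜ : Set (Fin 2 → ℝ)) :=
    (isConnected_compl_singleton_of_one_lt_rank (by simp) 0).isPreconnected
  have hall : ({0}ᶜ : Set (Fin 2 → ℝ)) ⊆ interior C := by
    refine hconn.subset_of_closure_inter_subset isOpen_interior
      ⟨left σ, left_ne_zero σ, hopen _ (hmemC (Equiv.Perm.SameCycle.refl _ _) (left_mem σ))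
        (left_ne_zero σ)⟩ ?_
    rintro x ⟨h1, h2⟩
    exact hopen x (closure_minimal interior_subset hclosed h1) h2
  -- an interior point of `τ` lies in a cone of the cycle, which must be `τ`
  have hint : InRelInt τ.1 (right τ + left τ) := by
    refine inRelInt_sector τ ?_ ?_
    · rw [det2_add_right, det2_self, zero_add]; exact det2_right_left τ
    · rw [det2_add_left, det2_self, add_zero]; exact det2_right_left τ
  have hne : right τ + left τ ≠ 0 := fun h => by
    have h1 : 0 < det2 (right τ) (right τ + left τ) := by
      rw [det2_add_right, det2_self, zero_add]; exact det2_right_left τ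
    rw [h, det2_zero_right] at h1
    exact lt_irrefl _ h1
  obtain ⟨ρ, hρ, h⟩ := mem_iUnion₂.1 (interior_subset (hall hne))
  rw [eq_of_inRelInt hF hint h]
  exact hρ

/-- There are at most as many two-dimensional cones as rays: each is determined by its left one. -/
lemma card_sectors_le (hF : F.IsComplete) :
    Nat.card (F.conesOfDim 2) ≤ (F.conesOfDim 1).ncard := by
  have hfin : (F.conesOfDim 1).Finite := F.finite.subset fun _ h => h.1
  have hface : ∀ σ : F.conesOfDim 2, {x ∈ σ.1 | det2 x (left σ) = 0} ∈ F.conesOfDim 1 := by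
    intro σ
    have hp : ∀ x, pair ![leftZ σ 1, -leftZ σ 0] x = det2 x (left σ) := by
      intro x
      simp [pair, det2, left]
      ring
    refine ⟨F.face_mem σ.1 σ.2.1 _ ⟨![leftZ σ 1, -leftZ σ 0], fun x hx => ?_, ?_⟩, ?_⟩
    · rw [hp]
      exact ((mem_sector_iff σ).1 hx).2
    · simp only [hp]
    · have h1 : Submodule.span ℝ {x ∈ σ.1 | det2 x (left σ) = 0} =
          Submodule.span ℝ {left σ} := by
        apply le_antisymm
        · rw [Submodule.span_le]
          rintro x ⟨hx, h⟩
          by_cases hx0 : x = 0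
          · rw [hx0]; exact Submodule.zero_mem _
          · obtain ⟨c, -, rfl⟩ := eq_smul_left σ hx hx0 h
            exact Submodule.smul_mem _ _ (Submodule.mem_span_singleton_self _)
        · exact Submodule.span_mono (singleton_subset_iff.2 ⟨left_mem σ, det2_self _⟩)
      rw [coneDim, h1]
      exact finrank_span_singleton (left_ne_zero σ)
  have := hfin.to_subtype
  rw [← Nat.card_coe_set_eq]
  refine Nat.card_le_card_of_injective
    (fun σ => (⟨_, hface σ⟩ : F.conesOfDim 1)) fun σ τ h => ?_
  have h1 : {x ∈ σ.1 | det2 x (left σ) = 0} = {x ∈ τ.1 | det2 x (left τ) = 0} :=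
    congrArg Subtype.val h
  have h2 : left σ ∈ {x ∈ τ.1 | det2 x (left τ) = 0} := h1 ▸ ⟨left_mem σ, det2_self _⟩
  exact eq_of_left hF (left_ne_zero σ) (left_mem σ) (det2_self _) h2.1 h2.2

end Fan

/-! ### Local structure of a multi-section -/

namespace MultiSection

variable {n : ℕ} {F : Fan n} (A : MultiSection.{u} F)

lemma injOn_cone {σ' : Set A.L} (h : σ' ∈ A.S.cones) : InjOn A.π σ' := by
  intro p hp q hq hpq
  have := (A.isBranchedCover.isEmbedding σ' h).injective (a₁ := ⟨p, hp⟩) (a₂ := ⟨q, hq⟩) hpq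
  exact congrArg Subtype.val this

lemma mem_M_iff {σ' : Set A.L} (h : σ' ∈ A.S.cones) (u : C(σ', ℝ)) :
    u ∈ A.S.M σ' ↔ ∃ m : Fin n → ℤ, ∀ x : σ', u x = pair m (A.π x) := by
  rw [A.isBranchedCover.mem_M σ' h]
  constructor
  · rintro ⟨v, ⟨m, hm⟩, hv⟩
    exact ⟨m, fun x => by rw [hv, hm]; rfl⟩
  · rintro ⟨m, hm⟩
    exact ⟨⟨fun y => pair m y, (continuous_pair m).comp continuous_subtype_val⟩,
      ⟨m, fun _ => rfl⟩, hm⟩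

/-- The pullback to a cone of `L` of an element of `M`. -/
def pullback (σ' : Set A.L) (m : Fin n → ℤ) : C(σ', ℝ) :=
  ⟨fun x => pair m (A.π x),
    (continuous_pair m).comp (A.isBranchedCover.isMorphism.continuous.comp continuous_subtype_val)⟩

lemma pullback_mem {σ' : Set A.L} (h : σ' ∈ A.S.cones) (m : Fin n → ℤ) :
    A.pullback σ' m ∈ A.S.M σ' :=
  (A.mem_M_iff h _).2 ⟨m, fun _ => rfl⟩

lemma mem_relInt_iff {σ' : Set A.L} (h : σ' ∈ A.S.cones) {p : A.L} :
    p ∈ A.S.relInt σ' ↔ p ∈ σ' ∧ Fan.InRelInt (A.π '' σ') (A.π p) := by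
  constructor
  · rintro ⟨hp, hu⟩
    refine ⟨hp, mem_image_of_mem _ hp, fun m hm h0 => ?_⟩
    have h1 := hu (A.pullback σ' m) (A.pullback_mem h m)
      (fun y => hm _ (mem_image_of_mem _ y.2)) h0
    rintro _ ⟨y, hy, rfl⟩
    exact congrArg (fun u : C(σ', ℝ) => u ⟨y, hy⟩) h1
  · rintro ⟨hp, -, hu⟩
    refine ⟨hp, fun u hM h0 h1 => ?_⟩
    obtain ⟨m, hm⟩ := (A.mem_M_iff h u).1 hM
    ext y
    rw [hm] at h1 ⊢
    refine hu m ?_ h1 _ (mem_image_of_mem _ y.2)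
    rintro _ ⟨z, hz, rfl⟩
    have := h0 ⟨z, hz⟩
    rwa [hm] at this

/-- The carrier of a point of `L`: the cone whose relative interior contains it. -/
def carrier (p : A.L) : Set A.L := (A.isConeComplex.existsUnique_relInt p).choose

lemma carrier_mem (p : A.L) : A.carrier p ∈ A.S.cones :=
  (A.isConeComplex.existsUnique_relInt p).choose_spec.1.1

lemma mem_relInt_carrier (p : A.L) : p ∈ A.S.relInt (A.carrier p) :=
  (A.isConeComplex.existsUnique_relInt p).choose_spec.1.2

lemma carrier_eq {σ' : Set A.L} (h : σ' ∈ A.S.cones) {p : A.L} (hp : p ∈ A.S.relInt σ') :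
    A.carrier p = σ' :=
  ((A.isConeComplex.existsUnique_relInt p).choose_spec.2 σ' ⟨h, hp⟩).symm

lemma mem_carrier (p : A.L) : p ∈ A.carrier p := (A.mem_relInt_carrier p).1

/-- In any cone containing `p`, the carrier of `p` is the face over the carrier of `π p`. -/
lemma carrier_eq_inter (hF : F.IsComplete) {σ' : Set A.L} (h : σ' ∈ A.S.cones) {p : A.L}
    (hp : p ∈ σ') : A.carrier p = σ' ∩ A.π ⁻¹' F.carrier (A.π p) := by
  have hσ : A.π '' σ' ∈ F.cones := A.isBranchedCover.image_mem σ' h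
  obtain ⟨m, hm, hm'⟩ := F.carrier_isFace hF hσ (mem_image_of_mem _ hp)
  have h1 := A.isConeComplex.face_mem σ' h _ (A.pullback_mem h m)
    (fun x => hm _ (mem_image_of_mem _ x.2))
  have h2 : Subtype.val '' {x : σ' | A.pullback σ' m x = 0} =
      σ' ∩ A.π ⁻¹' F.carrier (A.π p) := by
    rw [hm']
    ext q
    constructor
    · rintro ⟨x, hx, rfl⟩
      exact ⟨x.2, mem_image_of_mem _ x.2, hx⟩
    · rintro ⟨hq, -, h0⟩
      exact ⟨⟨q, hq⟩, h0, rfl⟩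
  rw [h2] at h1
  have h3 : A.π '' (σ' ∩ A.π ⁻¹' F.carrier (A.π p)) = F.carrier (A.π p) := by
    rw [image_inter_preimage]
    exact inter_eq_right.2 (F.carrier_subset hσ (mem_image_of_mem _ hp))
  refine A.carrier_eq h1 ((A.mem_relInt_iff h1).2 ⟨⟨hp, F.mem_carrier _⟩, ?_⟩)
  rw [h3]
  exact F.inRelInt_carrier hF _

lemma carrier_subset (hF : F.IsComplete) {σ' : Set A.L} (h : σ' ∈ A.S.cones) {p : A.L}
    (hp : p ∈ σ') : A.carrier p ⊆ σ' := by
  rw [A.carrier_eq_inter hF h hp]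
  exact inter_subset_left

lemma image_carrier (hF : F.IsComplete) (p : A.L) : A.π '' A.carrier p = F.carrier (A.π p) := by
  rw [A.carrier_eq_inter hF (A.carrier_mem p) (A.mem_carrier p), image_inter_preimage]
  exact inter_eq_right.2 (F.carrier_subset (A.isBranchedCover.image_mem _ (A.carrier_mem p))
    (mem_image_of_mem _ (A.mem_carrier p)))

lemma isPreconnected_inter {σ' : Set A.L} (h : σ' ∈ A.S.cones) {U : Set (Fin n → ℝ)}
    (hU : Convex ℝ U) : IsPreconnected (σ' ∩ A.π ⁻¹' U) := by
  have h1 := A.isBranchedCover.isEmbedding σ' h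
  have hσ : A.π '' σ' ∈ F.cones := A.isBranchedCover.image_mem σ' h
  have h2 : IsPreconnected ((fun x : σ' => A.π x) ⁻¹' U) := by
    rw [← h1.isInducing.isPreconnected_image]
    have : (σ'.domRestrict A.π) '' ((fun x : σ' => A.π x) ⁻¹' U) = A.π '' σ' ∩ U := by
      ext y
      constructor
      · rintro ⟨x, hx, rfl⟩
        exact ⟨mem_image_of_mem _ x.2, hx⟩
      · rintro ⟨⟨x, hx, rfl⟩, hxU⟩
        exact ⟨⟨x, hx⟩, hxU, rfl⟩
    rw [this]
    exact ((F.convex hσ).inter hU).isPreconnected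
  have h3 := h2.image Subtype.val continuous_subtype_val.continuousOn
  convert h3 using 1
  ext q
  constructor
  · rintro ⟨h, h'⟩
    exact ⟨⟨q, h⟩, h', rfl⟩
  · rintro ⟨x, hx, rfl⟩
    exact ⟨x.2, hx⟩

/-- Over a convex open set `U` that only meets the cones through `π p`, the component of `p` is the
star of `p`. -/
theorem connectedComponentIn_eq (hF : F.IsComplete) {U : Set (Fin n → ℝ)} (hU : Convex ℝ U)
    {p : A.L} (hpU : A.π p ∈ U) (hstar : ∀ σ ∈ F.cones, (σ ∩ U).Nonempty → A.π p ∈ σ) :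
    connectedComponentIn (A.π ⁻¹' U) p = {q | A.π q ∈ U ∧ ∃ σ' ∈ A.S.cones, p ∈ σ' ∧ q ∈ σ'} := by
  apply subset_antisymm
  · -- over `U`, the cones through `p` and those not through `p` are two finite families of closed
    -- sets that do not meet, so the component of `p` stays in the first
    have hsub := connectedComponentIn_subset (A.π ⁻¹' U) p
    have hclosed : ∀ P : Set A.L → Prop, IsClosed (⋃ σ' ∈ {σ' ∈ A.S.cones | P σ'}, σ') := fun P =>
      (A.isConeComplex.finite.subset fun _ h => h.1).isClosed_biUnion
        fun σ' h => A.isConeComplex.isClosed σ' h.1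
    have hpre := isPreconnected_closed_iff.1 (isPreconnected_connectedComponentIn
      (x := p) (F := A.π ⁻¹' U)) _ _ (hclosed fun σ' => p ∈ σ') (hclosed fun σ' => p ∉ σ')
    intro q hq
    refine ⟨hsub hq, ?_⟩
    by_contra hno
    have hcov : connectedComponentIn (A.π ⁻¹' U) p ⊆
        (⋃ σ' ∈ {σ' ∈ A.S.cones | p ∈ σ'}, σ') ∪ ⋃ σ' ∈ {σ' ∈ A.S.cones | p ∉ σ'}, σ' := by
      intro z _
      by_cases hz : p ∈ A.carrier z
      · exact Or.inl (mem_biUnion (x := A.carrier z) ⟨A.carrier_mem z, hz⟩ (A.mem_carrier z))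
      · exact Or.inr (mem_biUnion (x := A.carrier z) ⟨A.carrier_mem z, hz⟩ (A.mem_carrier z))
    have hq2 : q ∈ ⋃ σ' ∈ {σ' ∈ A.S.cones | p ∉ σ'}, σ' :=
      mem_biUnion (x := A.carrier q) ⟨A.carrier_mem q, fun h =>
        hno ⟨_, A.carrier_mem q, h, A.mem_carrier q⟩⟩ (A.mem_carrier q)
    obtain ⟨z, hzV, hz1, hz2⟩ := hpre hcov ⟨p, mem_connectedComponentIn hpU,
      mem_biUnion (x := A.carrier p) ⟨A.carrier_mem p, A.mem_carrier p⟩ (A.mem_carrier p)⟩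
      ⟨q, hq, hq2⟩
    obtain ⟨σ₁, ⟨h1, hp1⟩, hz1⟩ := mem_iUnion₂.1 hz1
    obtain ⟨σ₂, ⟨h2, hp2⟩, hz2⟩ := mem_iUnion₂.1 hz2
    have hx : A.π p ∈ A.π '' A.carrier z := by
      rw [A.image_carrier hF]
      exact hstar _ (F.carrier_mem hF _) ⟨_, F.mem_carrier _, hsub hzV⟩
    obtain ⟨p', hp', hpp⟩ := hx
    have := A.injOn_cone h1 (A.carrier_subset hF h1 hz1 hp') hp1 hpp
    exact hp2 (this ▸ A.carrier_subset hF h2 hz2 hp')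
  · rintro q ⟨hqU, σ', hσ', hp, hq⟩
    exact (A.isPreconnected_inter hσ' hU).subset_connectedComponentIn ⟨hp, hpU⟩
      inter_subset_right ⟨hq, hqU⟩

/-- The cones of a connected multi-section have a common point over the origin. -/
theorem exists_vertex (hF : F.IsComplete) (hA : A.IsConnected) :
    ∃ p, ∀ σ' ∈ A.S.cones, p ∈ σ' := by
  obtain ⟨p, hp⟩ := A.isBranchedCover.surjective 0
  refine ⟨p, fun σ' hσ' => ?_⟩
  have h1 := A.connectedComponentIn_eq hF convex_univ (p := p) (mem_univ _)
    (fun σ hσ _ => hp ▸ F.zero_mem hσ)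
  have : ConnectedSpace A.L := hA
  rw [preimage_univ, connectedComponentIn_univ, PreconnectedSpace.connectedComponent_eq_univ] at h1
  obtain ⟨x, hx⟩ := F.exists_inRelInt (A.isBranchedCover.image_mem σ' hσ')
  obtain ⟨q, hq, rfl⟩ := hx.1
  obtain ⟨-, σ'', hσ'', hp'', hq''⟩ := h1 ▸ mem_univ q
  have h2 : A.carrier q = σ' := A.carrier_eq hσ' ((A.mem_relInt_iff hσ').2 ⟨hq, hx⟩)
  obtain ⟨p', hp', h0⟩ := F.zero_mem (A.isBranchedCover.image_mem σ' hσ')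
  have h3 := A.injOn_cone hσ'' (A.carrier_subset hF hσ'' hq'' (h2 ▸ hp')) hp'' (h0.trans hp.symm)
  exact h3 ▸ hp'

/-- The point of the lift `σ^(α)` over a point of `σ`. -/
def pt {σ : Set (Fin n → ℝ)} (α : A.Idx σ) {x : Fin n → ℝ} (hx : x ∈ σ) : A.L :=
  (show x ∈ A.π '' A.lift α by rw [show A.π '' A.lift α = σ from α.1.2.2]; exact hx).choose

lemma lift_mem {σ : Set (Fin n → ℝ)} (α : A.Idx σ) : A.lift α ∈ A.S.cones := α.1.2.1

lemma image_lift {σ : Set (Fin n → ℝ)} (α : A.Idx σ) : A.π '' A.lift α = σ := α.1.2.2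

lemma pt_mem {σ : Set (Fin n → ℝ)} (α : A.Idx σ) {x : Fin n → ℝ} (hx : x ∈ σ) :
    A.pt α hx ∈ A.lift α :=
  (show x ∈ A.π '' A.lift α by rw [A.image_lift]; exact hx).choose_spec.1

lemma π_pt {σ : Set (Fin n → ℝ)} (α : A.Idx σ) {x : Fin n → ℝ} (hx : x ∈ σ) :
    A.π (A.pt α hx) = x :=
  (show x ∈ A.π '' A.lift α by rw [A.image_lift]; exact hx).choose_spec.2

lemma pt_eq_iff {σ : Set (Fin n → ℝ)} (α : A.Idx σ) {x : Fin n → ℝ} (hx : x ∈ σ) {p : A.L}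
    (hp : A.π p = x) : A.pt α hx = p ↔ p ∈ A.lift α := by
  constructor
  · rintro rfl
    exact A.pt_mem α hx
  · intro h
    exact A.injOn_cone (A.lift_mem α) (A.pt_mem α hx) h ((A.π_pt α hx).trans hp.symm)

lemma φ_eq {σ : Set (Fin n → ℝ)} (α : A.Idx σ) {p : A.L} (hp : p ∈ A.lift α) :
    A.φ p = pair (A.slope α) (A.π p) :=
  (A.exists_slope α.1.2.1).choose_spec p hp

lemma φ_pt {σ : Set (Fin n → ℝ)} (α : A.Idx σ) {x : Fin n → ℝ} (hx : x ∈ σ) :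
    A.φ (A.pt α hx) = pair (A.slope α) x := by
  rw [A.φ_eq α (A.pt_mem α hx), A.π_pt]

lemma coneWeight_eq {σ' : Set A.L} (h : σ' ∈ A.S.cones) {q : A.L} (hq : q ∈ A.S.relInt σ') :
    A.S.coneWeight A.μ σ' = A.μ q := by
  have : A.μ '' A.S.relInt σ' = {A.μ q} := by
    ext k
    constructor
    · rintro ⟨p, hp, rfl⟩
      exact A.isWeight.const σ' h p hp q hq
    · rintro rfl
      exact ⟨q, hq, rfl⟩
  rw [ConeData.coneWeight, this, csInf_singleton]

lemma finite_fiber (x : Fin n → ℝ) : (A.π ⁻¹' {x}).Finite := by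
  have h : A.π ⁻¹' {x} ⊆ ⋃ σ' ∈ A.S.cones, σ' ∩ A.π ⁻¹' {x} := fun p hp =>
    mem_biUnion (A.carrier_mem p) ⟨A.mem_carrier p, hp⟩
  refine (A.isConeComplex.finite.biUnion fun σ' hσ' => ?_).subset h
  refine Set.Subsingleton.finite ?_
  rintro p ⟨hp, hpx⟩ q ⟨hq, hqx⟩
  exact A.injOn_cone hσ' hp hq (hpx.trans hqx.symm)

end MultiSection

namespace MultiSection

variable {F : Fan 2} (A : MultiSection.{u} F)

/-- In a complete fan every point has a convex open neighbourhood that only meets the cones through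
the point. -/
lemma exists_star_nhd (hF : F.IsComplete) (x : Fin 2 → ℝ) : ∃ U : Set (Fin 2 → ℝ), IsOpen U ∧
    Convex ℝ U ∧ x ∈ U ∧ ∀ σ ∈ F.cones, (σ ∩ U).Nonempty → x ∈ σ := by
  have hclosed : IsClosed (⋃ σ ∈ {σ ∈ F.cones | x ∉ σ}, σ) :=
    (F.finite.subset fun _ h => h.1).isClosed_biUnion fun σ h => F.isClosed_of_mem_cones hF h.1
  obtain ⟨ε, hε, hb⟩ := Metric.isOpen_iff.1 hclosed.isOpen_compl x (by simp)
  refine ⟨Metric.ball x ε, Metric.isOpen_ball, convex_ball x ε, Metric.mem_ball_self hε, ?_⟩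
  rintro σ hσ ⟨y, hy, hyb⟩
  by_contra hx
  exact hb hyb (mem_biUnion (x := σ) ⟨hσ, hx⟩ hy)

/-- The weight of a point `p` over `x ∈ σ` is the number, with multiplicity, of the lifts of `σ`
through `p`. This is where the trace condition of branched coverings enters: it compares the fibre
over `x` with that over a nearby point of the relative interior of `σ`. -/
theorem μ_eq_card (hF : F.IsComplete) {σ : Set (Fin 2 → ℝ)} (hσ : σ ∈ F.cones) {p : A.L}
    (hx : A.π p ∈ σ) : A.μ p = Nat.card {α : A.Idx σ // p ∈ A.lift α} := by
  classical
  obtain ⟨U, hUo, hUc, hxU, hstar⟩ := exists_star_nhd hF (A.π p)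
  obtain ⟨s, hs⟩ := F.exists_inRelInt hσ
  -- a point of `U` in the relative interior of `σ`
  obtain ⟨ε, hε, hyU⟩ : ∃ ε : ℝ, 0 < ε ∧ A.π p + ε • s ∈ U := by
    have hc : Continuous fun ε : ℝ => A.π p + ε • s := by fun_prop
    have h1 := (hUo.preimage hc).mem_nhds (x := 0) (by simpa using hxU)
    obtain ⟨δ, hδ, h2⟩ := Metric.mem_nhds_iff.1 h1
    refine ⟨δ / 2, by positivity, h2 ?_⟩
    rw [Metric.mem_ball, dist_zero_right, Real.norm_of_nonneg (by positivity)]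
    linarith
  set y := A.π p + ε • s with hy
  have hyσ : Fan.InRelInt σ y := hs.segment hσ hx hε
  have hconn : _root_.IsConnected U := ⟨⟨_, hxU⟩, hUc.isPreconnected⟩
  have htr := A.isBranchedCover.trace_const U hUo hconn p hxU (A.π p) hxU y hyU
  rw [A.connectedComponentIn_eq hF hUc hxU hstar] at htr
  have h1 : {q | A.π q ∈ U ∧ ∃ σ' ∈ A.S.cones, p ∈ σ' ∧ q ∈ σ'} ∩ A.π ⁻¹' {A.π p} = {p} := by
    ext q
    constructor
    · rintro ⟨⟨-, σ', h, hp, hq⟩, hqp⟩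
      exact A.injOn_cone h hq hp hqp
    · rintro rfl
      exact ⟨⟨hxU, _, A.carrier_mem q, A.mem_carrier q, A.mem_carrier q⟩, rfl⟩
  rw [h1, finsum_mem_singleton] at htr
  -- the points of the star over `y` correspond to the lifts of `σ` through `p`
  have hpt : ∀ σ' : A.Lift σ, ∃ q ∈ σ'.1, A.π q = y := fun σ' => by
    have : y ∈ A.π '' σ'.1 := by rw [σ'.2.2]; exact hyσ.1
    exact this
  choose e he heπ using hpt
  have hrel : ∀ σ' : A.Lift σ, e σ' ∈ A.S.relInt σ'.1 := fun σ' =>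
    (A.mem_relInt_iff σ'.2.1).2 ⟨he σ', by rw [σ'.2.2, heπ]; exact hyσ⟩
  have hbij : BijOn e {σ' | p ∈ σ'.1}
      ({q | A.π q ∈ U ∧ ∃ σ' ∈ A.S.cones, p ∈ σ' ∧ q ∈ σ'} ∩ A.π ⁻¹' {y}) := by
    refine ⟨fun σ' hp => ⟨⟨?_, σ'.1, σ'.2.1, hp, he σ'⟩, heπ σ'⟩, ?_, ?_⟩
    · rw [heπ]; exact hyU
    · intro σ₁ _ σ₂ _ h
      apply Subtype.ext
      rw [← A.carrier_eq σ₁.2.1 (hrel σ₁), h, A.carrier_eq σ₂.2.1 (hrel σ₂)]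
    · rintro q ⟨⟨-, σ', h, hp, hq⟩, hqy⟩
      have hqy' : A.π q = y := hqy
      have hcar : A.π '' A.carrier q = σ := by
        rw [A.image_carrier hF, hqy', hyσ.carrier_eq hF hσ]
      have hpc : p ∈ A.carrier q := by
        rw [A.carrier_eq_inter hF h hq, hqy', hyσ.carrier_eq hF hσ]
        exact ⟨hp, hx⟩
      refine ⟨⟨A.carrier q, A.carrier_mem q, hcar⟩, hpc, ?_⟩
      exact A.injOn_cone (A.carrier_mem q) (he ⟨A.carrier q, A.carrier_mem q, hcar⟩)
        (A.mem_carrier q) ((heπ _).trans hqy'.symm)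
  rw [htr, ← finsum_mem_eq_of_bijOn (f := fun σ' : A.Lift σ => A.S.coneWeight A.μ σ'.1) e hbij
    fun σ' _ => A.coneWeight_eq σ'.2.1 (hrel σ')]
  let E : {α : A.Idx σ // p ∈ A.lift α} ≃
      (σ' : {σ' : A.Lift σ // p ∈ σ'.1}) × Fin (A.S.coneWeight A.μ σ'.1.1) :=
    { toFun := fun α => ⟨⟨α.1.1, α.2⟩, α.1.2⟩
      invFun := fun β => ⟨⟨β.1.1, β.2⟩, β.1.2⟩
      left_inv := fun _ => rfl
      right_inv := fun _ => rfl }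
  have : Fintype {σ' : A.Lift σ // p ∈ σ'.1} := Fintype.ofFinite _
  rw [Nat.card_congr E, Nat.card_sigma]
  simp only [Nat.card_eq_fintype_card, Fintype.card_fin]
  rw [← finsum_eq_sum_of_fintype]
  exact (finsum_set_coe_eq_finsum_mem {σ' : A.Lift σ | p ∈ σ'.1}).symm

/-- Weighted counts in a fibre over `σ` are counts of lifts of `σ`. -/
theorem finsum_fiber (hF : F.IsComplete) {σ : Set (Fin 2 → ℝ)} (hσ : σ ∈ F.cones)
    {x : Fin 2 → ℝ} (hx : x ∈ σ) (W : Set A.L) :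
    ∑ᶠ p ∈ W ∩ A.π ⁻¹' {x}, A.μ p = Nat.card {α : A.Idx σ // A.pt α hx ∈ W} := by
  classical
  have hfin : (W ∩ A.π ⁻¹' {x}).Finite := (A.finite_fiber x).inter_of_right W
  rw [finsum_mem_eq_finite_toFinset_sum _ hfin]
  have h1 : ∀ p ∈ hfin.toFinset, A.μ p =
      ((Finset.univ.filter fun α : A.Idx σ => A.pt α hx ∈ W).filter fun α => A.pt α hx = p).card := by
    intro p hp
    obtain ⟨hpW, hpx⟩ := hfin.mem_toFinset.1 hp
    have hpx' : A.π p = x := hpx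
    subst hpx'
    rw [A.μ_eq_card hF hσ hx, Finset.filter_filter, Nat.card_eq_fintype_card, Fintype.card_subtype]
    congr 1
    ext α
    simp only [Finset.mem_filter, Finset.mem_univ, true_and]
    rw [A.pt_eq_iff α hx rfl]
    constructor
    · intro h
      refine ⟨?_, h⟩
      rwa [(A.pt_eq_iff α hx rfl).2 h]
    · exact fun h => h.2
  rw [Finset.sum_congr rfl h1, Nat.card_eq_fintype_card, Fintype.card_subtype]
  refine (Finset.card_eq_sum_card_fiberwise (f := fun α => A.pt α hx) fun α hα => ?_).symm
  rw [Finset.mem_coe, Finset.mem_filter] at hα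
  rw [Finset.mem_coe, hfin.mem_toFinset]
  exact ⟨hα.2, A.π_pt α hx⟩

/-- The lifts of a cone, listed with multiplicity, are as many as the rank: the fibre over the
origin has total weight equal to the rank. -/
lemma card_idx (hF : F.IsComplete) {σ : Set (Fin 2 → ℝ)} (hσ : σ ∈ F.cones) :
    Nat.card (A.Idx σ) = A.rank := by
  have h := A.finsum_fiber hF hσ (F.zero_mem hσ) univ
  rw [← A.trace_eq 0, trace]
  rw [univ_inter] at h
  rw [h]
  exact Nat.card_congr (Equiv.subtypeUnivEquiv fun _ => mem_univ _).symm

lemma exists_idx_mem (hF : F.IsComplete) {σ : Set (Fin 2 → ℝ)} (hσ : σ ∈ F.cones) {p : A.L}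
    (hx : A.π p ∈ σ) : ∃ α : A.Idx σ, p ∈ A.lift α := by
  have h := A.μ_eq_card hF hσ hx
  have h1 := A.isWeight.pos p
  rw [h, Nat.card_pos_iff] at h1
  obtain ⟨α, hα⟩ := h1.1
  exact ⟨α, hα⟩

end MultiSection

/-! ### Multi-sections glued from piecewise linear functions -/

namespace Sheet

variable {F : Fan 2} {I : Type u} (φ : I → (Fin 2 → ℝ) → ℝ)

variable (F) in
/-- The gluing of copies of the plane, one for each function of a family: two copies are identified
at `x` if their functions agree on the carrier of `x`. -/
def setoid : Setoid (Σ _ : I, Fin 2 → ℝ) where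
  r p q := p.2 = q.2 ∧ ∀ z ∈ F.carrier p.2, φ p.1 z = φ q.1 z
  iseqv :=
    { refl := fun _ => ⟨rfl, fun _ _ => rfl⟩
      symm := fun h => ⟨h.1.symm, fun z hz => (h.2 z (h.1 ▸ hz)).symm⟩
      trans := fun h h' => ⟨h.1.trans h'.1, fun z hz => (h.2 z hz).trans (h'.2 z (h.1 ▸ hz))⟩ }

variable (F) in
/-- The space glued from copies of the plane. -/
def Space : Type u := Quotient (setoid F φ)

instance : TopologicalSpace (Space F φ) := inferInstanceAs (TopologicalSpace (Quotient _))

variable (F) in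
/-- The `i`-th copy of the plane in the glued space. -/
def sheet (i : I) (x : Fin 2 → ℝ) : Space F φ := Quotient.mk (setoid F φ) ⟨i, x⟩

variable {φ}

lemma isQuotientMap_sheet :
    IsQuotientMap fun p : (Σ _ : I, Fin 2 → ℝ) => sheet F φ p.1 p.2 :=
  isQuotientMap_quot_mk

lemma continuous_sheet (i : I) : Continuous (sheet F φ i) :=
  isQuotientMap_sheet.continuous.comp (continuous_sigmaMk (σ := fun _ : I => Fin 2 → ℝ) (i := i))

lemma sheet_eq_iff {i k : I} {x y : Fin 2 → ℝ} :
    sheet F φ i x = sheet F φ k y ↔ x = y ∧ ∀ z ∈ F.carrier x, φ i z = φ k z :=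
  Quotient.eq (r := setoid F φ)

lemma exists_sheet (p : Space F φ) : ∃ i x, sheet F φ i x = p := by
  induction p using Quotient.inductionOn with
  | h p => exact ⟨p.1, p.2, rfl⟩

variable (F φ) in
/-- The projection of the glued space to the plane. -/
def proj : Space F φ → (Fin 2 → ℝ) := Quotient.lift (fun p => p.2) fun _ _ h => h.1

variable (F φ) in
/-- The function induced by the family on the glued space. -/
def value : Space F φ → ℝ := Quotient.lift (fun p => φ p.1 p.2) fun p q h => by
  have := h.2 _ (F.mem_carrier _)
  rw [this, h.1]

@[simp] lemma proj_sheet (i : I) (x : Fin 2 → ℝ) : proj F φ (sheet F φ i x) = x := rfl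

@[simp] lemma value_sheet (i : I) (x : Fin 2 → ℝ) : value F φ (sheet F φ i x) = φ i x := rfl

lemma continuous_proj : Continuous (proj F φ) :=
  Continuous.quotient_lift (continuous_sigma fun _ => continuous_id) _

lemma carrier_anti (hF : F.IsComplete) {x z : Fin 2 → ℝ} (hz : z ∈ F.carrier x) :
    F.carrier z ⊆ F.carrier x :=
  F.carrier_subset (F.carrier_mem hF x) hz

/-- Sheets meeting at a point meet over its carrier. -/
lemma sheet_eq_on_carrier (hF : F.IsComplete) {i k : I} {x z : Fin 2 → ℝ}
    (h : sheet F φ i x = sheet F φ k x) (hz : z ∈ F.carrier x) :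
    sheet F φ i z = sheet F φ k z :=
  sheet_eq_iff.2 ⟨rfl, fun w hw => (sheet_eq_iff.1 h).2 w (carrier_anti hF hz hw)⟩

/-- The pullback to a subset of the glued space of an element of `M`. -/
def pull (C : Set (Space F φ)) : (Fin 2 → ℤ) →+ C(C, ℝ) where
  toFun m := ⟨fun x => pair m (proj F φ x),
    (continuous_pair m).comp (continuous_proj.comp continuous_subtype_val)⟩
  map_zero' := by ext x; exact pair_zero_left _
  map_add' m m' := by ext x; exact pair_add _ _ _

variable (F φ) in
/-- The cones of the glued space are the cones of the fan in each of the sheets. -/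
def coneData : ConeData (Space F φ) where
  cones := {C | ∃ i, ∃ σ ∈ F.cones, C = sheet F φ i '' σ}
  M C := (pull C).range

lemma mem_M {C : Set (Space F φ)} {u : C(C, ℝ)} :
    u ∈ (coneData F φ).M C ↔ ∃ m : Fin 2 → ℤ, ∀ x : C, u x = pair m (proj F φ x) := by
  constructor
  · rintro ⟨m, rfl⟩
    exact ⟨m, fun _ => rfl⟩
  · rintro ⟨m, hm⟩
    exact ⟨m, by ext x; exact (hm x).symm⟩

lemma isClosed_cone [Finite I] (hF : F.IsComplete) (i : I) {σ : Set (Fin 2 → ℝ)}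
    (hσ : σ ∈ F.cones) : IsClosed (sheet F φ i '' σ) := by
  refine isQuotientMap_sheet.isClosed_preimage.1 (isClosed_sigma_iff.2 fun k => ?_)
  have : sheet F φ k ⁻¹' (sheet F φ i '' σ) =
      ⋃ τ ∈ {τ ∈ F.cones | τ ⊆ σ ∧ ∀ z ∈ τ, φ i z = φ k z}, τ := by
    ext x
    rw [mem_preimage, mem_iUnion₂]
    constructor
    · rintro ⟨y, hy, h⟩
      obtain ⟨rfl, h'⟩ := sheet_eq_iff.1 h
      exact ⟨_, ⟨F.carrier_mem hF y, F.carrier_subset hσ hy, h'⟩, F.mem_carrier y⟩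
    · rintro ⟨τ, ⟨hτ, hτσ, h⟩, hx⟩
      exact ⟨x, hτσ hx, sheet_eq_iff.2 ⟨rfl, fun z hz => h z (F.carrier_subset hτ hx hz)⟩⟩
  change IsClosed (sheet F φ k ⁻¹' (sheet F φ i '' σ))
  rw [this]
  exact (F.finite.subset fun _ h => h.1).isClosed_biUnion
    fun τ h => F.isClosed_of_mem_cones hF h.1

lemma isEmbedding_proj (i : I) (σ : Set (Fin 2 → ℝ)) :
    IsEmbedding ((sheet F φ i '' σ).domRestrict (proj F φ)) := by
  refine IsEmbedding.of_comp (continuous_proj.comp continuous_subtype_val)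
    (continuous_sheet (F := F) (φ := φ) i) ?_
  convert IsEmbedding.subtypeVal (p := (· ∈ sheet F φ i '' σ)) using 1
  funext p
  obtain ⟨_, x, _, rfl⟩ := p
  rfl

lemma mem_relInt_iff {i : I} {σ : Set (Fin 2 → ℝ)} {p : Space F φ} :
    p ∈ (coneData F φ).relInt (sheet F φ i '' σ) ↔
      ∃ x, Fan.InRelInt σ x ∧ sheet F φ i x = p := by
  constructor
  · rintro ⟨⟨x, hx, rfl⟩, hu⟩
    refine ⟨x, ⟨hx, fun m hm h0 y hy => ?_⟩, rfl⟩
    have h1 := hu (pull _ m) ⟨m, rfl⟩ (by rintro ⟨_, y, hy, rfl⟩; exact hm y hy) h0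
    exact congrArg (fun u : C(sheet F φ i '' σ, ℝ) => u ⟨_, mem_image_of_mem _ hy⟩) h1
  · rintro ⟨x, ⟨hx, h⟩, rfl⟩
    refine ⟨mem_image_of_mem _ hx, ?_⟩
    rintro u ⟨m, rfl⟩ h0 h1
    ext ⟨_, y, hy, rfl⟩
    exact h m (fun z hz => h0 ⟨_, mem_image_of_mem _ hz⟩) h1 y hy

/-- Integral points of a cone define homomorphisms `M(σ) → ℤ`. -/
lemma exists_evalHom (i : I) {σ : Set (Fin 2 → ℝ)} {v : Fin 2 → ℤ}
    (hv : (fun j => (v j : ℝ)) ∈ σ) :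
    ∃ e : (coneData F φ).M (sheet F φ i '' σ) →+ ℤ, ∀ u, (e u : ℝ) =
      (u : C(sheet F φ i '' σ, ℝ)) ⟨_, mem_image_of_mem _ hv⟩ := by
  have h : ∀ u : (coneData F φ).M (sheet F φ i '' σ), ∃ k : ℤ, (k : ℝ) =
      (u : C(sheet F φ i '' σ, ℝ)) ⟨_, mem_image_of_mem _ hv⟩ := by
    rintro ⟨_, m, rfl⟩
    exact ⟨_, (pair_intCast m v).symm⟩
  choose e he using h
  refine ⟨⟨⟨e, ?_⟩, fun u u' => ?_⟩, he⟩
  · have h0 : (e 0 : ℝ) = (0 : ℝ) := he 0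
    exact_mod_cast h0
  · have h1 : (e (u + u') : ℝ) = e u + e u' := by
      rw [he, he, he]
      rfl
    exact_mod_cast h1

lemma image_hull {V W : Type*} [AddCommGroup V] [Module ℝ V] [AddCommGroup W] [Module ℝ W]
    (T : V →ₗ[ℝ] W) (s : Set V) :
    T '' (PointedCone.hull ℝ s : Set V) = (PointedCone.hull ℝ (T '' s) : Set W) := by
  rw [← PointedCone.coe_map]
  exact congrArg (fun P : PointedCone ℝ W => (P : Set W))
    (Submodule.map_span (T.restrictScalars {c : ℝ // 0 ≤ c}) s)

lemma exists_generators (i : I) {σ : Set (Fin 2 → ℝ)} (hσ : σ ∈ F.cones) :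
    ∃ s : Set ((coneData F φ).M (sheet F φ i '' σ) →+ ℤ), s.Finite ∧
      range ((coneData F φ).natMap (sheet F φ i '' σ)) =
        (PointedCone.hull ℝ ((fun v u => (v u : ℝ)) '' s) :
          Set ((coneData F φ).M (sheet F φ i '' σ) → ℝ)) := by
  obtain ⟨s, hs, h⟩ := F.rational σ hσ
  have hmem : ∀ v : s, (fun j => (v.1 j : ℝ)) ∈ σ := fun v => by
    rw [h]
    exact PointedCone.subset_hull (mem_image_of_mem _ v.2)
  choose e he using fun v : s => exists_evalHom (F := F) (φ := φ) i (hmem v)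
  have hM : ∀ u : (coneData F φ).M (sheet F φ i '' σ), ∃ m : Fin 2 → ℤ,
      ∀ x : sheet F φ i '' σ, (u : C(sheet F φ i '' σ, ℝ)) x = pair m (proj F φ x) :=
    fun u => mem_M.1 u.2
  choose m hm using hM
  let T : (Fin 2 → ℝ) →ₗ[ℝ] ((coneData F φ).M (sheet F φ i '' σ) → ℝ) :=
    { toFun := fun x u => pair (m u) x
      map_add' := fun x y => by funext u; exact pair_add_right _ _ _
      map_smul' := fun c x => by funext u; exact pair_smul_right _ _ _ }
  refine ⟨range e, @finite_range _ _ _ hs.to_subtype, ?_⟩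
  have h1 : range ((coneData F φ).natMap (sheet F φ i '' σ)) = T '' σ := by
    ext w
    constructor
    · rintro ⟨⟨_, x, hx, rfl⟩, rfl⟩
      exact ⟨x, hx, by funext u; exact (hm u ⟨_, mem_image_of_mem _ hx⟩).symm⟩
    · rintro ⟨x, hx, rfl⟩
      exact ⟨⟨_, mem_image_of_mem _ hx⟩, by funext u; exact hm u ⟨_, mem_image_of_mem _ hx⟩⟩
  have h2 : T '' ((fun v j => (v j : ℝ)) '' s) =
      (fun (v : (coneData F φ).M (sheet F φ i '' σ) →+ ℤ) u => (v u : ℝ)) '' range e := by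
    ext w
    constructor
    · rintro ⟨_, ⟨v, hv, rfl⟩, rfl⟩
      refine ⟨_, ⟨⟨v, hv⟩, rfl⟩, ?_⟩
      funext u
      exact (he ⟨v, hv⟩ u).trans (hm u _)
    · rintro ⟨_, ⟨v, rfl⟩, rfl⟩
      refine ⟨_, ⟨v, v.2, rfl⟩, ?_⟩
      funext u
      exact ((he v u).trans (hm u _)).symm
  rw [h1, ← h2]
  exact (congrArg (fun P => T '' P) h).trans (image_hull T _)

lemma isConeComplex [Finite I] (hF : F.IsComplete) : (coneData F φ).IsConeComplex where
  finite := by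
    refine (finite_iUnion fun i : I => F.finite.image fun σ => sheet F φ i '' σ).subset ?_
    rintro _ ⟨i, σ, hσ, rfl⟩
    exact mem_iUnion.2 ⟨i, σ, hσ, rfl⟩
  isClosed := by
    rintro _ ⟨i, σ, hσ, rfl⟩
    exact isClosed_cone hF i hσ
  fg := fun C _ => by
    have h : AddGroup.FG (Fin 2 → ℤ) := inferInstance
    have h1 := AddGroup.fg_range (f := pull C)
    exact (AddGroup.fg_iff_addSubgroup_fg _).1 h1
  isEmbedding := by
    rintro _ ⟨i, σ, hσ, rfl⟩
    -- the coordinates of the plane are among the functions of `M(σ)`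
    have hg : Continuous fun (v : (coneData F φ).M (sheet F φ i '' σ) → ℝ) (j : Fin 2) =>
        v ⟨pull _ (Pi.single j 1), _, rfl⟩ :=
      continuous_pi fun j => continuous_apply _
    refine IsEmbedding.of_comp (continuous_pi fun u => u.1.continuous) hg ?_
    convert isEmbedding_proj i σ using 1
    funext p j
    exact pair_single j _
  rational := by
    rintro _ ⟨i, σ, hσ, rfl⟩
    exact exists_generators i hσ
  face_mem := by
    rintro _ ⟨i, σ, hσ, rfl⟩ _ ⟨m, rfl⟩ h0
    refine ⟨i, {x ∈ σ | pair m x = 0}, F.face_mem σ hσ _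
      ⟨m, fun x hx => h0 ⟨_, mem_image_of_mem _ hx⟩, rfl⟩, ?_⟩
    ext p
    constructor
    · rintro ⟨⟨_, x, hx, rfl⟩, h, rfl⟩
      exact ⟨x, ⟨hx, h⟩, rfl⟩
    · rintro ⟨x, ⟨hx, h⟩, rfl⟩
      exact ⟨⟨_, mem_image_of_mem _ hx⟩, h, rfl⟩
  face_M := by
    intro σ _ τ _ h _ u
    rw [mem_M]
    constructor
    · rintro ⟨m, hm⟩
      exact ⟨pull σ m, ⟨m, rfl⟩, hm⟩
    · rintro ⟨_, ⟨m, rfl⟩, hm⟩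
      exact ⟨m, hm⟩
  existsUnique_relInt := by
    intro p
    obtain ⟨i, x, rfl⟩ := exists_sheet p
    refine ⟨sheet F φ i '' F.carrier x, ⟨⟨i, _, F.carrier_mem hF x, rfl⟩,
      mem_relInt_iff.2 ⟨x, F.inRelInt_carrier hF x, rfl⟩⟩, ?_⟩
    rintro _ ⟨⟨k, σ, hσ, rfl⟩, hx⟩
    obtain ⟨y, hy, hyx⟩ := mem_relInt_iff.1 hx
    obtain rfl : y = x := (sheet_eq_iff.1 hyx).1
    rw [← hy.carrier_eq hF hσ]
    exact image_congr fun z hz => sheet_eq_on_carrier hF hyx hz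

variable (F φ) in
/-- The weight of a point of the glued space: the number of sheets through it. -/
def weight (p : Space F φ) : ℕ := Nat.card {i // sheet F φ i (proj F φ p) = p}

lemma isWeight [Finite I] (hF : F.IsComplete) : (coneData F φ).IsWeight (weight F φ) where
  pos p := by
    obtain ⟨i, x, rfl⟩ := exists_sheet p
    exact Nat.card_pos_iff.2 ⟨⟨i, rfl⟩, inferInstance⟩
  const := by
    rintro _ ⟨i, σ, hσ, rfl⟩ p hp q hq
    obtain ⟨x, hx, rfl⟩ := mem_relInt_iff.1 hp
    obtain ⟨y, hy, rfl⟩ := mem_relInt_iff.1 hq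
    refine Nat.card_congr (Equiv.subtypeEquivRight fun k => ?_)
    simp only [proj_sheet, sheet_eq_iff, true_and, hx.carrier_eq hF hσ, hy.carrier_eq hF hσ]

/-- Weighted counts in a fibre are counts of sheets. -/
lemma finsum_weight [Finite I] (W : Set (Space F φ)) (y : Fin 2 → ℝ) :
    ∑ᶠ p ∈ W ∩ proj F φ ⁻¹' {y}, weight F φ p = Nat.card {i // sheet F φ i y ∈ W} := by
  classical
  have := Fintype.ofFinite I
  have hfin : (W ∩ proj F φ ⁻¹' {y}).Finite := by
    refine (finite_range fun i => sheet F φ i y).subset ?_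
    rintro p ⟨-, hp⟩
    obtain ⟨i, x, rfl⟩ := exists_sheet p
    have hp' : x = y := hp
    exact ⟨i, by rw [hp']⟩
  rw [finsum_mem_eq_finite_toFinset_sum _ hfin]
  have h1 : ∀ p ∈ hfin.toFinset, weight F φ p =
      ((Finset.univ.filter fun i => sheet F φ i y ∈ W).filter fun i => sheet F φ i y = p).card := by
    intro p hp
    obtain ⟨hpW, hpy⟩ := hfin.mem_toFinset.1 hp
    have hpy' : proj F φ p = y := hpy
    rw [weight, Finset.filter_filter, Nat.card_eq_fintype_card, Fintype.card_subtype, hpy']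
    congr 1
    ext i
    simp only [Finset.mem_filter, Finset.mem_univ, true_and]
    exact ⟨fun h => ⟨h ▸ hpW, h⟩, fun h => h.2⟩
  rw [Finset.sum_congr rfl h1, Nat.card_eq_fintype_card, Fintype.card_subtype]
  refine (Finset.card_eq_sum_card_fiberwise (f := fun i => sheet F φ i y) fun i hi => ?_).symm
  rw [Finset.mem_coe, Finset.mem_filter] at hi
  rw [Finset.mem_coe, hfin.mem_toFinset]
  exact ⟨hi.2, rfl⟩

lemma isBranchedCover [Finite I] [Nonempty I] :
    IsBranchedCover (coneData F φ) (weight F φ) F.coneData (proj F φ) where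
  isMorphism :=
    { continuous := continuous_proj
      exists_cone := by
        rintro _ ⟨i, σ, hσ, rfl⟩
        refine ⟨σ, hσ, ?_, ?_⟩
        · rintro _ ⟨x, hx, rfl⟩
          exact hx
        · rintro u ⟨m, hm⟩
          exact ⟨pull _ m, ⟨m, rfl⟩, fun x => by rw [hm]; rfl⟩ }
  surjective x := ⟨sheet F φ (Classical.arbitrary I) x, rfl⟩
  image_mem := by
    rintro _ ⟨i, σ, hσ, rfl⟩
    have h : proj F φ '' (sheet F φ i '' σ) = σ := by
      rw [image_image]
      exact image_id' σ
    rw [h]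
    exact hσ
  isEmbedding := by
    rintro _ ⟨i, σ, hσ, rfl⟩
    exact isEmbedding_proj i σ
  mem_M := by
    intro C _ u
    rw [mem_M]
    constructor
    · rintro ⟨m, hm⟩
      exact ⟨⟨fun y => pair m y, (continuous_pair m).comp continuous_subtype_val⟩,
        ⟨m, fun _ => rfl⟩, hm⟩
    · rintro ⟨v, ⟨m, hm⟩, hv⟩
      exact ⟨m, fun x => by rw [hv, hm]; rfl⟩
  trace_const := by
    intro U _ hUc p _ y hy z hz
    rw [finsum_weight, finsum_weight]
    -- each sheet over `U` is connected, so it lies in the component or is disjoint from it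
    have key : ∀ i, ∀ y ∈ U, ∀ z ∈ U,
        sheet F φ i y ∈ connectedComponentIn (proj F φ ⁻¹' U) p →
        sheet F φ i z ∈ connectedComponentIn (proj F φ ⁻¹' U) p := by
      intro i y hy z hz h
      rw [connectedComponentIn_eq h]
      refine (hUc.isPreconnected.image _ (continuous_sheet i).continuousOn).subset_connectedComponentIn
        (mem_image_of_mem _ hy) ?_ (mem_image_of_mem _ hz)
      rintro _ ⟨w, hw, rfl⟩
      exact hw
    exact Nat.card_congr (Equiv.subtypeEquivRight fun i => ⟨key i y hy z hz, key i z hz y hy⟩)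

end Sheet

/-- The functions that are integral linear on each cone of a fan. -/
def IsPLOn (F : Fan 2) (f : (Fin 2 → ℝ) → ℝ) : Prop :=
  ∀ σ ∈ F.cones, ∃ m : Fin 2 → ℤ, ∀ x ∈ σ, f x = pair m x

open Sheet in
/-- The multi-section glued from a finite family of piecewise linear functions on the plane. -/
def sheeted {F : Fan 2} (hF : F.IsComplete) {I : Type u} [Finite I] [Nonempty I]
    (φ : I → (Fin 2 → ℝ) → ℝ) (hφ : ∀ i, IsPLOn F (φ i)) : MultiSection.{u} F where
  L := Space F φ
  S := coneData F φ
  isConeComplex := isConeComplex hF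
  μ := weight F φ
  isWeight := isWeight hF
  π := proj F φ
  isBranchedCover := isBranchedCover
  rank := Nat.card I
  trace_eq x := by
    have := finsum_weight (F := F) (φ := φ) univ x
    rw [univ_inter] at this
    rw [trace, this]
    exact Nat.card_congr (Equiv.subtypeUnivEquiv fun _ => mem_univ _)
  φ := value F φ
  isPL := by
    rintro _ ⟨i, σ, hσ, rfl⟩
    obtain ⟨m, hm⟩ := hφ i σ hσ
    refine ⟨pull _ m, ⟨m, rfl⟩, ?_⟩
    rintro ⟨_, x, hx, rfl⟩
    exact hm x hx

/-! ### Decomposing a multi-section along a consistent choice of lifts -/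

namespace Sheet

variable {F : Fan 2} {I K : Type u} {φ : I → (Fin 2 → ℝ) → ℝ} {χ : K → (Fin 2 → ℝ) → ℝ}

lemma image_proj_sheet (i : I) (σ : Set (Fin 2 → ℝ)) : proj F φ '' (sheet F φ i '' σ) = σ :=
  (image_image _ _ _).trans (image_id' σ)

/-- The map of glued spaces induced by the inclusion of a subfamily. -/
def reindex (ι : I → K) (h : ∀ i, χ (ι i) = φ i) : Space F φ → Space F χ :=
  Quotient.lift (fun p => sheet F χ (ι p.1) p.2) fun p q hpq =>
    sheet_eq_iff.2 ⟨hpq.1, fun z hz => by rw [h, h]; exact hpq.2 z hz⟩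

@[simp] lemma reindex_sheet (ι : I → K) (h : ∀ i, χ (ι i) = φ i) (i : I) (x : Fin 2 → ℝ) :
    reindex (F := F) ι h (sheet F φ i x) = sheet F χ (ι i) x := rfl

lemma reindex_injective (ι : I → K) (h : ∀ i, χ (ι i) = φ i) :
    Function.Injective (reindex (F := F) ι h) := by
  intro p q hpq
  obtain ⟨i, x, rfl⟩ := exists_sheet p
  obtain ⟨k, y, rfl⟩ := exists_sheet q
  have h1 := sheet_eq_iff.1 hpq
  rw [h, h] at h1
  exact sheet_eq_iff.2 h1

lemma continuous_reindex (ι : I → K) (h : ∀ i, χ (ι i) = φ i) :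
    Continuous (reindex (F := F) ι h) :=
  Continuous.quotient_lift (continuous_sigma fun i => continuous_sheet (ι i)) _

@[simp] lemma proj_reindex (ι : I → K) (h : ∀ i, χ (ι i) = φ i) (p : Space F φ) :
    proj F χ (reindex ι h p) = proj F φ p := by
  obtain ⟨i, x, rfl⟩ := exists_sheet p
  rfl

lemma value_reindex (ι : I → K) (h : ∀ i, χ (ι i) = φ i) (p : Space F φ) :
    value F χ (reindex ι h p) = value F φ p := by
  obtain ⟨i, x, rfl⟩ := exists_sheet p
  exact congrFun (h i) x

lemma trace_reindex [Finite I] (ι : I → K) (h : ∀ i, χ (ι i) = φ i) (z : Space F χ) :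
    trace (reindex (F := F) ι h) (weight F φ) z =
      Nat.card {i // sheet F χ (ι i) (proj F χ z) = z} := by
  have h1 : reindex (F := F) ι h ⁻¹' {z} =
      (reindex (F := F) ι h ⁻¹' {z}) ∩ proj F φ ⁻¹' {proj F χ z} := by
    refine (inter_eq_left.2 ?_).symm
    rintro p (hp : reindex ι h p = z)
    rw [mem_preimage, ← hp, proj_reindex]
    rfl
  rw [trace, h1, finsum_weight]
  rfl

end Sheet

namespace MultiSection

lemma Le.refl {n : ℕ} {F : Fan n} (A : MultiSection.{u} F) : A.Le A := by
  refine ⟨rfl, id, ⟨continuous_id, fun σ hσ => ⟨σ, hσ, mapsTo_id σ, fun m hm =>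
    ⟨m, hm, fun _ => rfl⟩⟩⟩, Function.surjective_id, rfl, ?_, rfl⟩
  funext y
  exact finsum_mem_singleton

end MultiSection

open Sheet MultiSection in
/-- The multi-section glued from two families is the combinatorial union of those glued from each of
the families. -/
theorem isCombUnion_sheeted {F : Fan 2} (hF : F.IsComplete) {I J : Type u} [Finite I] [Nonempty I]
    [Finite J] [Nonempty J] {φ : I → (Fin 2 → ℝ) → ℝ} {ψ : J → (Fin 2 → ℝ) → ℝ}
    (hφ : ∀ i, IsPLOn F (φ i)) (hψ : ∀ j, IsPLOn F (ψ j))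
    (hχ : ∀ k, IsPLOn F (Sum.elim φ ψ k)) :
    IsCombUnion (sheeted hF φ hφ) (sheeted hF ψ hψ) (sheeted hF (Sum.elim φ ψ) hχ) := by
  set f : Space F φ → Space F (Sum.elim φ ψ) := reindex Sum.inl fun _ => rfl with hf
  set g : Space F ψ → Space F (Sum.elim φ ψ) := reindex Sum.inr fun _ => rfl with hg
  have hfinj : Function.Injective f := reindex_injective _ _
  have hginj : Function.Injective g := reindex_injective _ _
  have hgl : ∀ (a : Space F φ) (b : Space F ψ), f a = g b →
      Glue (sheeted hF φ hφ) (sheeted hF ψ hψ) (Sum.inl a) (Sum.inr b) := by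
    intro a b hab
    obtain ⟨i, x, rfl⟩ := exists_sheet a
    obtain ⟨j, y, rfl⟩ := exists_sheet b
    obtain ⟨rfl, h⟩ := sheet_eq_iff.1 hab
    refine ⟨_, _, rfl, rfl, rfl, _, ⟨i, _, F.carrier_mem hF x, rfl⟩, _,
      ⟨j, _, F.carrier_mem hF x, rfl⟩, mem_image_of_mem _ (F.mem_carrier x),
      mem_image_of_mem _ (F.mem_carrier x), ?_, ?_⟩
    · exact (image_proj_sheet i _).trans (image_proj_sheet j _).symm
    · rintro _ ⟨z, hz, rfl⟩ _ ⟨w, hw, rfl⟩ (rfl : z = w)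
      exact h z hz
  have hgl' : ∀ p q, Glue (sheeted hF φ hφ) (sheeted hF ψ hψ) p q →
      Sum.elim f g p = Sum.elim f g q := by
    rintro _ _ ⟨a, b, rfl, rfl, hab, τ', ⟨i, σ, hσ, rfl⟩, τ'', ⟨j, σ', hσ', rfl⟩, ha, hb, hst, h⟩
    obtain ⟨x, hx, rfl⟩ := ha
    obtain ⟨y, hy, rfl⟩ := hb
    obtain rfl : x = y := hab
    obtain rfl : σ = σ' := by
      exact (image_proj_sheet i σ).symm.trans (hst.trans (image_proj_sheet j σ'))
    refine sheet_eq_iff.2 ⟨rfl, fun z hz => ?_⟩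
    have hz' := F.carrier_subset hσ hx hz
    exact h _ (mem_image_of_mem _ hz') _ (mem_image_of_mem _ hz') rfl
  refine ⟨Sum.elim f g, ?_, fun p q => ⟨?_, ?_⟩, ?_, fun z => ?_, ?_, ?_⟩
  · refine (isQuotientMap_iff _).2 ⟨isCoinducing_iff.2 fun V => ⟨fun hV => ?_, fun hV => ?_⟩,
      fun z => ?_⟩
    rotate_left 2
    · obtain ⟨i | j, x, rfl⟩ := exists_sheet z
      · exact ⟨Sum.inl (sheet F φ i x), rfl⟩
      · exact ⟨Sum.inr (sheet F ψ j x), rfl⟩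
    · have h1 := isOpen_sum_iff.1 hV
      refine isQuotientMap_sheet.isOpen_preimage.1 (isOpen_sigma_iff.2 ?_)
      rintro (i | j)
      · exact h1.1.preimage (continuous_sheet (F := F) (φ := φ) i)
      · exact h1.2.preimage (continuous_sheet (F := F) (φ := ψ) j)
    · exact hV.preimage ((continuous_reindex _ _).sumElim (continuous_reindex _ _))
  · intro hpq
    rcases p with a | b <;> rcases q with a' | b'
    · rw [hfinj hpq]
      exact Relation.EqvGen.refl _
    · exact Relation.EqvGen.rel _ _ (hgl a b' hpq)
    · exact Relation.EqvGen.symm _ _ (Relation.EqvGen.rel _ _ (hgl a' b hpq.symm))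
    · rw [hginj hpq]
      exact Relation.EqvGen.refl _
  · intro h
    induction h with
    | rel p q h => exact hgl' p q h
    | refl p => rfl
    | symm p q _ ih => exact ih.symm
    | trans p q r _ _ ih ih' => exact ih.trans ih'
  · apply subset_antisymm
    · rintro _ ⟨i | j, σ, hσ, rfl⟩
      · exact Or.inl ⟨_, ⟨i, σ, hσ, rfl⟩, image_image _ _ _⟩
      · exact Or.inr ⟨_, ⟨j, σ, hσ, rfl⟩, image_image _ _ _⟩
    · rintro _ (⟨_, ⟨i, σ, hσ, rfl⟩, rfl⟩ | ⟨_, ⟨j, σ, hσ, rfl⟩, rfl⟩)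
      · exact ⟨Sum.inl i, σ, hσ, image_image _ _ _⟩
      · exact ⟨Sum.inr j, σ, hσ, image_image _ _ _⟩
  · have h1 := trace_reindex (F := F) (φ := φ) (χ := Sum.elim φ ψ) Sum.inl (fun _ => rfl) z
    have h2 := trace_reindex (F := F) (φ := ψ) (χ := Sum.elim φ ψ) Sum.inr (fun _ => rfl) z
    refine Eq.trans ?_ (congrArg₂ (· + ·) h1 h2).symm
    rw [← Nat.card_sum]
    exact Nat.card_congr Equiv.subtypeSum
  · funext p
    rcases p with a | b
    · exact proj_reindex (χ := Sum.elim φ ψ) Sum.inl (fun _ => rfl) a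
    · exact proj_reindex (χ := Sum.elim φ ψ) Sum.inr (fun _ => rfl) b
  · funext p
    rcases p with a | b
    · exact value_reindex (χ := Sum.elim φ ψ) Sum.inl (fun _ => rfl) a
    · exact value_reindex (χ := Sum.elim φ ψ) Sum.inr (fun _ => rfl) b

namespace MultiSection

variable {F : Fan 2} (A : MultiSection.{u} F)

open Sheet in
/-- A multi-section whose slopes on each two-dimensional cone are those of a family of piecewise
linear functions on the plane maps onto the multi-section glued from the family. -/
theorem sheeted_le (hF : F.IsComplete) {I : Type u} [Finite I] [Nonempty I]
    {φ : I → (Fin 2 → ℝ) → ℝ} (hφ : ∀ i, IsPLOn F (φ i)) (ι : ∀ σ : F.conesOfDim 2, A.Idx σ.1 ≃ I)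
    (hι : ∀ (σ : F.conesOfDim 2) (α : A.Idx σ.1), ∀ x ∈ σ.1,
      pair (A.slope α) x = φ (ι σ α) x) :
    (sheeted hF φ hφ).Le A := by
  have hex : ∀ p : A.L, ∃ (σ : F.conesOfDim 2) (α : A.Idx σ.1), p ∈ A.lift α := fun p => by
    obtain ⟨σ, hσ⟩ := F.exists_sector_mem hF (A.π p)
    obtain ⟨α, hα⟩ := A.exists_idx_mem hF σ.2.1 hσ
    exact ⟨σ, α, hα⟩
  -- each point is sent to the sheet of one of the lifts containing it; the choice is irrelevant
  choose s a ha using hex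
  set f : A.L → Space F φ := fun p => sheet F φ (ι (s p) (a p)) (A.π p) with hf
  have hval : ∀ (σ : F.conesOfDim 2) (α : A.Idx σ.1) (q : A.L), q ∈ A.lift α →
      A.φ q = φ (ι σ α) (A.π q) := fun σ α q hq => by
    rw [A.φ_eq α hq]
    exact hι σ α _ ((A.image_lift α).subset (mem_image_of_mem _ hq))
  have key : ∀ (σ : F.conesOfDim 2) (α : A.Idx σ.1) (p : A.L), p ∈ A.lift α →
      f p = sheet F φ (ι σ α) (A.π p) := by
    intro σ α p hp
    refine sheet_eq_iff.2 ⟨rfl, fun z hz => ?_⟩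
    rw [← A.image_carrier hF] at hz
    obtain ⟨q, hq, rfl⟩ := hz
    rw [← hval σ α q (A.carrier_subset hF (A.lift_mem α) hp hq),
      ← hval _ (a p) q (A.carrier_subset hF (A.lift_mem (a p)) (ha p) hq)]
  have hproj : ∀ p, proj F φ (f p) = A.π p := fun _ => rfl
  have hcont : Continuous f := by
    refine (locallyFinite_of_finite fun i : (Σ σ : F.conesOfDim 2, A.Idx σ.1) =>
      A.lift i.2).continuous ?_ (fun i => A.isConeComplex.isClosed _ (A.lift_mem i.2)) fun i => ?_
    · exact eq_univ_of_forall fun p => mem_iUnion.2 ⟨⟨s p, a p⟩, ha p⟩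
    · refine ContinuousOn.congr (f := fun p => sheet F φ (ι i.1 i.2) (A.π p)) ?_
        fun p hp => key i.1 i.2 p hp
      exact ((continuous_sheet _).comp A.isBranchedCover.isMorphism.continuous).continuousOn
  obtain ⟨σ₀, -⟩ := F.exists_sector_mem hF 0
  refine ⟨?_, f, ⟨hcont, fun σ' hσ' => ?_⟩, fun z => ?_, rfl, ?_, ?_⟩
  · rw [← A.card_idx hF σ₀.2.1]
    exact (Nat.card_congr (ι σ₀)).symm
  · obtain ⟨x, hx⟩ := F.exists_inRelInt (A.isBranchedCover.image_mem σ' hσ')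
    obtain ⟨p, hp, rfl⟩ := hx.1
    have hsub : σ' ⊆ A.lift (a p) := by
      rw [← A.carrier_eq hσ' ((A.mem_relInt_iff hσ').2 ⟨hp, hx⟩)]
      exact A.carrier_subset hF (A.lift_mem _) (ha p)
    refine ⟨sheet F φ (ι (s p) (a p)) '' (A.π '' σ'),
      ⟨_, _, A.isBranchedCover.image_mem σ' hσ', rfl⟩, fun q hq => ?_, ?_⟩
    · exact ⟨A.π q, mem_image_of_mem _ hq, (key _ _ q (hsub hq)).symm⟩
    · rintro _ ⟨m, rfl⟩
      exact ⟨A.pullback σ' m, A.pullback_mem hσ' m, fun _ => rfl⟩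
  · obtain ⟨i, x, rfl⟩ := exists_sheet z
    obtain ⟨σ, hσ⟩ := F.exists_sector_mem hF x
    refine ⟨A.pt ((ι σ).symm i) hσ, ?_⟩
    rw [key σ _ _ (A.pt_mem _ hσ), A.π_pt, Equiv.apply_symm_apply]
  · funext z
    obtain ⟨σ, hσ⟩ := F.exists_sector_mem hF (proj F φ z)
    have h1 : f ⁻¹' {z} = f ⁻¹' {z} ∩ A.π ⁻¹' {proj F φ z} := by
      refine (inter_eq_left.2 ?_).symm
      rintro p (hp : f p = z)
      rw [mem_preimage, ← hp, hproj]
      rfl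
    change ∑ᶠ p ∈ f ⁻¹' {z}, A.μ p = weight F φ z
    rw [h1, A.finsum_fiber hF σ.2.1 hσ]
    refine Nat.card_congr ((ι σ).subtypeEquiv fun α => ?_)
    have h2 := key σ α _ (A.pt_mem α hσ)
    rw [A.π_pt] at h2
    rw [mem_preimage, h2]
    rfl
  · funext p
    exact (hval _ _ p (ha p)).symm

/-- Over a common point of two cones, the lifts of one can be matched with the lifts of the other so
that matched lifts share the point over it. -/
lemma exists_matching (hF : F.IsComplete) {σ τ : Set (Fin 2 → ℝ)} (hσ : σ ∈ F.cones)
    (hτ : τ ∈ F.cones) {x : Fin 2 → ℝ} (hxσ : x ∈ σ) (hxτ : x ∈ τ) :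
    ∃ e : A.Idx σ ≃ A.Idx τ, ∀ α, A.pt (e α) hxτ = A.pt α hxσ := by
  have h : ∀ p : A.L, Nonempty ({α : A.Idx σ // A.pt α hxσ = p} ≃
      {β : A.Idx τ // A.pt β hxτ = p}) := by
    intro p
    by_cases hp : A.π p = x
    · subst hp
      rw [← Finite.card_eq]
      simp only [A.pt_eq_iff _ _ rfl]
      rw [← A.μ_eq_card hF hσ hxσ, ← A.μ_eq_card hF hτ hxτ]
    · exact ⟨⟨fun α => absurd (α.2 ▸ A.π_pt α.1 hxσ) hp, fun β => absurd (β.2 ▸ A.π_pt β.1 hxτ) hp,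
        fun α => absurd (α.2 ▸ A.π_pt α.1 hxσ) hp, fun β => absurd (β.2 ▸ A.π_pt β.1 hxτ) hp⟩⟩
  let e := fun p => Classical.choice (h p)
  refine ⟨(Equiv.sigmaFiberEquiv fun α => A.pt α hxσ).symm.trans
    ((Equiv.sigmaCongrRight e).trans (Equiv.sigmaFiberEquiv fun β => A.pt β hxτ)), fun α => ?_⟩
  exact (e (A.pt α hxσ) ⟨α, rfl⟩).2

/-- Lifts of the two-dimensional cones whose slopes agree on overlaps define a piecewise linear
function on the plane. -/
lemma exists_PL (hF : F.IsComplete) (s : ∀ σ : F.conesOfDim 2, A.Idx σ.1)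
    (hs : ∀ σ τ : F.conesOfDim 2, ∀ x ∈ σ.1, x ∈ τ.1 →
      pair (A.slope (s σ)) x = pair (A.slope (s τ)) x) :
    ∃ f, IsPLOn F f ∧ ∀ σ : F.conesOfDim 2, ∀ x ∈ σ.1, f x = pair (A.slope (s σ)) x := by
  choose c hc using F.exists_sector_mem hF
  have h : ∀ σ : F.conesOfDim 2, ∀ x ∈ σ.1,
      pair (A.slope (s (c x))) x = pair (A.slope (s σ)) x := fun σ x hx => hs _ _ x (hc x) hx
  refine ⟨fun x => pair (A.slope (s (c x))) x, fun σ hσ => ?_, h⟩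
  obtain ⟨τ, hτ⟩ := F.exists_sector_superset hF hσ
  exact ⟨_, fun x hx => h τ x (hτ hx)⟩

/-- The sum of the slopes over all the lifts agrees on the overlaps of cones. -/
lemma sum_slope_eq (hF : F.IsComplete) {σ τ : Set (Fin 2 → ℝ)} (hσ : σ ∈ F.cones)
    (hτ : τ ∈ F.cones) {x : Fin 2 → ℝ} (hxσ : x ∈ σ) (hxτ : x ∈ τ) :
    ∑ α : A.Idx σ, pair (A.slope α) x = ∑ β : A.Idx τ, pair (A.slope β) x := by
  obtain ⟨e, he⟩ := A.exists_matching hF hσ hτ hxσ hxτ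
  refine Fintype.sum_equiv e _ _ fun α => ?_
  rw [← A.φ_pt α hxσ, ← A.φ_pt (e α) hxτ, he]

open Sheet in
/-- If `𝕃` is indecomposable of rank two, there is no choice of one lift of each two-dimensional
cone whose slopes agree on all the rays: such lifts, and the complementary ones, would define two
piecewise linear functions, the union of which is a quotient of `𝕃`. -/
theorem not_exists_section (hF : F.IsComplete) (hrank : A.rank = 2) (hind : A.CombIndecomposable)
    (s : ∀ σ : F.conesOfDim 2, A.Idx σ.1) : ¬ ∀ σ : F.conesOfDim 2,
      pair (A.slope (s σ)) (F.left σ) = pair (A.slope (s (F.next hF σ))) (F.left σ) := by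
  intro hs
  have hov : ∀ σ τ : F.conesOfDim 2, ∀ x ∈ σ.1, x ∈ τ.1 →
      pair (A.slope (s σ)) x = pair (A.slope (s τ)) x := by
    intro σ τ x hσ hτ
    by_cases hx : x = 0
    · rw [hx, pair_zero_right, pair_zero_right]
    · rcases F.eq_or_next hF hx hσ hτ with rfl | ⟨rfl, c, rfl⟩ | ⟨rfl, c, rfl⟩
      · rfl
      · rw [pair_smul_right, pair_smul_right, hs σ]
      · rw [pair_smul_right, pair_smul_right, hs τ]
  have hcard : ∀ σ : F.conesOfDim 2, Nat.card (A.Idx σ.1) = 2 := fun σ =>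
    (A.card_idx hF σ.2.1).trans hrank
  have hcompl : ∀ σ : F.conesOfDim 2, ∃ b : A.Idx σ.1, b ≠ s σ ∧ ∀ α, α = s σ ∨ α = b := by
    intro σ
    obtain ⟨b, hb, huniq⟩ := (Nat.card_eq_two_iff' (s σ)).1 (hcard σ)
    exact ⟨b, hb, fun α => or_iff_not_imp_left.2 fun h => huniq α h⟩
  choose t hts ht using hcompl
  have hsum : ∀ (σ : F.conesOfDim 2) (f : A.Idx σ.1 → ℝ), ∑ α, f α = f (s σ) + f (t σ) := by
    intro σ f
    have : (Finset.univ : Finset (A.Idx σ.1)) = {s σ, t σ} := by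
      ext α
      simpa using ht σ α
    rw [this, Finset.sum_pair (hts σ).symm]
  -- the complementary slopes agree because the sum of both slopes is well defined
  have hov' : ∀ σ τ : F.conesOfDim 2, ∀ x ∈ σ.1, x ∈ τ.1 →
      pair (A.slope (t σ)) x = pair (A.slope (t τ)) x := by
    intro σ τ x hσ hτ
    have h1 := A.sum_slope_eq hF σ.2.1 τ.2.1 hσ hτ
    rw [hsum, hsum, hov σ τ x hσ hτ] at h1
    exact add_left_cancel h1
  obtain ⟨f, hf, hfs⟩ := A.exists_PL hF s hov
  obtain ⟨g, hg, hgt⟩ := A.exists_PL hF t hov'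
  have hfg : ∀ k : PUnit.{u + 1} ⊕ PUnit.{u + 1},
      IsPLOn F (Sum.elim (fun _ : PUnit.{u + 1} => f) (fun _ : PUnit.{u + 1} => g) k) := by
    rintro (_ | _)
    · exact hf
    · exact hg
  classical
  let ι : ∀ σ : F.conesOfDim 2, A.Idx σ.1 ≃ PUnit.{u + 1} ⊕ PUnit.{u + 1} := fun σ =>
    { toFun := fun α => if α = s σ then Sum.inl PUnit.unit else Sum.inr PUnit.unit
      invFun := Sum.elim (fun _ => s σ) (fun _ => t σ)
      left_inv := fun α => by
        rcases ht σ α with rfl | rfl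
        · simp
        · simp [hts σ]
      right_inv := by
        rintro (_ | _)
        · simp
        · simp [hts σ] }
  have hle := A.sheeted_le hF hfg ι fun σ α x hx => by
    rcases ht σ α with h | h
    · subst h
      simp [ι, hfs σ x hx]
    · subst h
      simp [ι, hts σ, hgt σ x hx]
  have hconn : ∀ (f : (Fin 2 → ℝ) → ℝ) (hf : IsPLOn F f),
      (sheeted hF (fun _ : PUnit.{u + 1} => f) fun _ => hf).IsConnected := by
    intro f hf
    have hsurj : Function.Surjective (sheet F (fun _ : PUnit.{u + 1} => f) PUnit.unit) := by
      intro p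
      obtain ⟨i, x, rfl⟩ := exists_sheet p
      exact ⟨x, rfl⟩
    exact hsurj.connectedSpace (continuous_sheet _)
  have hconnU : (sheeted hF (Sum.elim (fun _ : PUnit.{u + 1} => f)
      (fun _ : PUnit.{u + 1} => g)) hfg).IsConnected := by
    obtain ⟨-, q, hq, hqs, -⟩ := hle
    have : ConnectedSpace A.L := hind.1
    exact hqs.connectedSpace hq.continuous
  exact hind.2 ⟨_, _, _, hconn f hf, hconn g hg,
    isCombUnion_sheeted hF (fun _ => hf) (fun _ => hg) hfg,
    Relation.TransGen.single ⟨hind.1, hconnU, hle.1.symm, _, hle, Le.refl _⟩⟩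

end MultiSection

/-! ### Transitive permutations and their double covers -/

namespace Cyc

section Index

variable {X : Type*} [Finite X] {f : Equiv.Perm X} {x₀ : X}

lemma exists_iterate (h : ∀ y, f.SameCycle x₀ y) (y : X) : ∃ k : ℕ, f^[k] x₀ = y := by
  obtain ⟨k, hk⟩ := (h y).exists_nat_pow_eq
  exact ⟨k, by rw [← hk, Equiv.Perm.coe_pow]⟩

open Classical in
/-- The number of steps from the base point `x₀` to `y` along a transitive permutation. -/
def index (h : ∀ y, f.SameCycle x₀ y) (y : X) : ℕ := Nat.find (exists_iterate h y)

lemma iterate_index (h : ∀ y, f.SameCycle x₀ y) (y : X) : f^[index h y] x₀ = y := by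
  classical
  exact Nat.find_spec (exists_iterate h y)

lemma index_le (h : ∀ y, f.SameCycle x₀ y) {y : X} {k : ℕ} (hk : f^[k] x₀ = y) :
    index h y ≤ k := by
  classical
  exact Nat.find_min' (exists_iterate h y) hk

lemma index_base (h : ∀ y, f.SameCycle x₀ y) : index h x₀ = 0 :=
  Nat.le_zero.1 (index_le h rfl)

lemma index_apply (h : ∀ y, f.SameCycle x₀ y) {y : X} (hy : f y ≠ x₀) :
    index h (f y) = index h y + 1 := by
  apply le_antisymm
  · refine index_le h ?_
    rw [Function.iterate_succ_apply', iterate_index]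
  · have h1 := iterate_index h (f y)
    rcases hk : index h (f y) with _ | k
    · rw [hk] at h1
      exact absurd h1.symm hy
    · rw [hk, Function.iterate_succ_apply'] at h1
      have := index_le h (f.injective h1)
      omega

lemma minimalPeriod_pos : 0 < Function.minimalPeriod f x₀ :=
  Function.minimalPeriod_pos_of_mem_periodicPts
    (f.injective.mem_periodicPts x₀)

lemma index_lt (h : ∀ y, f.SameCycle x₀ y) (y : X) :
    index h y < Function.minimalPeriod f x₀ := by
  have h1 := index_le h ((Function.iterate_mod_minimalPeriod_eq (f := f) (x := x₀)
    (n := index h y)).trans (iterate_index h y))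
  exact h1.trans_lt (Nat.mod_lt _ minimalPeriod_pos)

lemma index_iterate (h : ∀ y, f.SameCycle x₀ y) {k : ℕ} (hk : k < Function.minimalPeriod f x₀) :
    index h (f^[k] x₀) = k :=
  Function.iterate_injOn_Iio_minimalPeriod (index_lt h _) hk (iterate_index h _)

lemma index_last (h : ∀ y, f.SameCycle x₀ y) {y : X} (hy : f y = x₀) :
    index h y + 1 = Function.minimalPeriod f x₀ := by
  apply le_antisymm (index_lt h y)
  refine Nat.le_of_dvd (Nat.succ_pos _) (Function.IsPeriodicPt.minimalPeriod_dvd ?_)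
  rw [Function.IsPeriodicPt, Function.IsFixedPt, Function.iterate_succ_apply', iterate_index, hy]

lemma prod_iterate {M : Type*} [CommMonoid M] [Fintype X] (h : ∀ y, f.SameCycle x₀ y)
    (g : X → M) :
    ∏ j ∈ Finset.range (Function.minimalPeriod f x₀), g (f^[j] x₀) = ∏ y, g y := by
  refine Finset.prod_bij' (fun j _ => f^[j] x₀) (fun y _ => index h y)
    (fun _ _ => Finset.mem_univ _) (fun y _ => Finset.mem_range.2 (index_lt h y))
    (fun j hj => index_iterate h (Finset.mem_range.1 hj)) (fun y _ => iterate_index h y)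
    fun _ _ => rfl

end Index

section DoubleCover

variable {V : Type*} (ν : Equiv.Perm V) (p : V → Equiv.Perm (Fin 2))

/-- The permutation of the double cover `V × Fin 2` that lies over `ν` and matches the sheets over
`σ` with those over `ν σ` by `p σ`. -/
def cover : Equiv.Perm (V × Fin 2) where
  toFun ε := (ν ε.1, p ε.1 ε.2)
  invFun ε := (ν.symm ε.1, (p (ν.symm ε.1)).symm ε.2)
  left_inv ε := by simp
  right_inv ε := by simp

lemma cover_apply (ε : V × Fin 2) : cover ν p ε = (ν ε.1, p ε.1 ε.2) := rfl

lemma iterate_cover_fst (k : ℕ) (ε : V × Fin 2) : ((cover ν p)^[k] ε).1 = ν^[k] ε.1 := by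
  induction k with
  | zero => rfl
  | succ k ih => rw [Function.iterate_succ_apply', Function.iterate_succ_apply', cover_apply, ih]

variable {ν p} [Finite V] {Y : Type*} {va vb : V → Fin 2 → Y}

/-- Transporting a sheet once around the cycle ends at a mismatch, if there is no choice of sheets
without mismatch. -/
lemma transport_ne (hν : ∀ σ τ, ν.SameCycle σ τ)
    (hno : ∀ s : V → Fin 2, ¬ ∀ σ, va σ (s σ) = vb σ (s (ν σ)))
    (hp : ∀ σ a, va σ a = vb σ (p σ a)) (σ : V) (a : Fin 2) :
    va (ν.symm σ) ((cover ν p)^[index (hν σ) (ν.symm σ)] (σ, a)).2 ≠ vb (ν.symm σ) a := by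
  intro heq
  refine hno (fun τ => ((cover ν p)^[index (hν σ) τ] (σ, a)).2) fun τ => ?_
  by_cases hτ : ν τ = σ
  · obtain rfl : τ = ν.symm σ := by rw [← hτ, Equiv.symm_apply_apply]
    simp only [hτ, index_base]
    exact heq
  · simp only [index_apply (hν σ) hτ, Function.iterate_succ_apply', cover_apply]
    rw [iterate_cover_fst, iterate_index]
    exact hp _ _

/-- The two values on each ray are distinct: otherwise the mismatch after one turn would vanish. -/
lemma va_injective (hν : ∀ σ τ, ν.SameCycle σ τ)
    (hno : ∀ s : V → Fin 2, ¬ ∀ σ, va σ (s σ) = vb σ (s (ν σ)))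
    (hp : ∀ σ a, va σ a = vb σ (p σ a)) (σ : V) : va σ 0 ≠ va σ 1 := by
  intro h
  have hconst : ∀ a b, va σ a = va σ b := by
    intro a b
    fin_cases a <;> fin_cases b <;> simp [h]
  have h1 := transport_ne hν hno hp (ν σ) 0
  rw [Equiv.symm_apply_apply] at h1
  refine h1 ((hconst _ ((p σ).symm 0)).trans ?_)
  rw [hp, Equiv.apply_symm_apply]

/-- The double cover has nontrivial monodromy. -/
lemma monodromy_ne (hν : ∀ σ τ, ν.SameCycle σ τ)
    (hno : ∀ s : V → Fin 2, ¬ ∀ σ, va σ (s σ) = vb σ (s (ν σ)))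
    (hp : ∀ σ a, va σ a = vb σ (p σ a)) (σ : V) (a : Fin 2) :
    (cover ν p)^[Function.minimalPeriod ν σ] (σ, a) ≠ (σ, a) := by
  intro h
  rw [← index_last (hν σ) (Equiv.apply_symm_apply ν σ), Function.iterate_succ_apply',
    cover_apply] at h
  have h1 := congrArg Prod.snd h
  simp only [iterate_cover_fst, iterate_index] at h1
  refine transport_ne hν hno hp σ a ?_
  rw [hp, h1]

/-- The double cover is connected. -/
lemma sameCycle_cover (hν : ∀ σ τ, ν.SameCycle σ τ)
    (hno : ∀ s : V → Fin 2, ¬ ∀ σ, va σ (s σ) = vb σ (s (ν σ)))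
    (hp : ∀ σ a, va σ a = vb σ (p σ a)) (ε ε' : V × Fin 2) : (cover ν p).SameCycle ε ε' := by
  have hsame : ∀ (k : ℕ) (ε : V × Fin 2), (cover ν p).SameCycle ε ((cover ν p)^[k] ε) :=
    fun k ε => ⟨k, by rw [zpow_natCast, Equiv.Perm.coe_pow]⟩
  have hfib : ∀ (σ : V) (a b : Fin 2), (cover ν p).SameCycle (σ, a) (σ, b) := by
    intro σ a b
    by_cases hab : a = b
    · rw [hab]
    · have h1 := hsame (Function.minimalPeriod ν σ) (σ, a)
      have h2 := monodromy_ne hν hno hp σ a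
      have h3 : (cover ν p)^[Function.minimalPeriod ν σ] (σ, a) = (σ, b) := by
        have h4 := iterate_cover_fst ν p (Function.minimalPeriod ν σ) (σ, a)
        rw [Function.iterate_minimalPeriod] at h4
        refine Prod.ext h4 ?_
        have h5 : ((cover ν p)^[Function.minimalPeriod ν σ] (σ, a)).2 ≠ a := fun h =>
          h2 (Prod.ext h4 h)
        change _ = b
        omega
      rwa [h3] at h1
  obtain ⟨k, hk⟩ := exists_iterate (hν ε.1) ε'.1
  have h1 := hsame k ε
  have h2 : (cover ν p)^[k] ε = (ε'.1, ((cover ν p)^[k] ε).2) :=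
    Prod.ext ((iterate_cover_fst ν p k ε).trans hk) rfl
  rw [h2] at h1
  exact h1.trans (hfib _ _ _)

end DoubleCover

end Cyc

/-! ### Triangular transition matrices around a cycle -/

namespace Cyc

variable {V : Type*} (ν : Equiv.Perm V) (p : V → Equiv.Perm (Fin 2)) (top : V → Fin 2)

/-- A cocycle of `2 × 2` matrices indexed by pairs of elements of `V` such that the matrix from `σ`
to `ν σ` and its inverse are triangular: apart from the entries matched by `p σ`, only those in the
row of the sheet `top σ` may be nonzero. -/
structure IsTransition (m : V → V → Matrix (Fin 2) (Fin 2) ℂ) : Prop where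
  one : ∀ σ, m σ σ = 1
  mul : ∀ σ τ ρ, m σ τ * m τ ρ = m σ ρ
  zero : ∀ σ a b, b ≠ p σ a → a ≠ top σ → m σ (ν σ) a b = 0
  zero' : ∀ σ a b, a ≠ b → a ≠ top σ → m (ν σ) σ (p σ a) b = 0

/-- The sign of a permutation of the two sheets. -/
def sgn (e : Equiv.Perm (Fin 2)) : ℂ := if e 0 = 0 then 1 else -1

lemma sgn_mul_self (e : Equiv.Perm (Fin 2)) : sgn e * sgn e = 1 := by
  unfold sgn
  split_ifs <;> norm_num

lemma perm_cases (e : Equiv.Perm (Fin 2)) : (e 0 = 0 ∧ e 1 = 1) ∨ (e 0 = 1 ∧ e 1 = 0) := by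
  have h : e 0 ≠ e 1 := fun h => by simpa using e.injective h
  omega

variable {ν p top} {m : V → V → Matrix (Fin 2) (Fin 2) ℂ}

/-- The matched entry of `m σ (ν σ)` in the row `ε = (σ, a)`. -/
def diag (ν : Equiv.Perm V) (p : V → Equiv.Perm (Fin 2)) (m : V → V → Matrix (Fin 2) (Fin 2) ℂ)
    (ε : V × Fin 2) : ℂ := m ε.1 (ν ε.1) ε.2 (p ε.1 ε.2)

/-- The matched entry of `m (ν σ) σ` in the column `ε = (σ, a)`. -/
def diagInv (ν : Equiv.Perm V) (p : V → Equiv.Perm (Fin 2)) (m : V → V → Matrix (Fin 2) (Fin 2) ℂ)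
    (ε : V × Fin 2) : ℂ := m (ν ε.1) ε.1 (p ε.1 ε.2) ε.2

namespace IsTransition

lemma diag_mul_diagInv (hm : IsTransition ν p top m) (ε : V × Fin 2) :
    diag ν p m ε * diagInv ν p m ε = 1 := by
  obtain ⟨σ, a⟩ := ε
  have h := congrFun (congrFun (hm.mul σ (ν σ) σ) a) a
  rw [hm.one, Matrix.one_apply_eq, Matrix.mul_apply, ← Equiv.sum_comp (p σ),
    Fintype.sum_eq_single a] at h
  · exact h
  · intro b hb
    by_cases ha : a = top σ
    · rw [hm.zero' σ b a hb (fun h => hb (h.trans ha.symm)), mul_zero]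
    · rw [hm.zero σ a (p σ b) (fun h => hb ((p σ).injective h)) ha, zero_mul]

lemma det_eq (hm : IsTransition ν p top m) (σ : V) :
    (m σ (ν σ)).det = sgn (p σ) * (diag ν p m (σ, 0) * diag ν p m (σ, 1)) := by
  rw [Matrix.det_fin_two]
  simp only [diag, sgn]
  have h := hm.zero σ
  rcases perm_cases (p σ) with ⟨h0, h1⟩ | ⟨h0, h1⟩
  · rw [h0, h1]
    have h01 : m σ (ν σ) 0 1 * m σ (ν σ) 1 0 = 0 := by
      by_cases ht : (0 : Fin 2) = top σ
      · rw [h 1 0 (by rw [h1]; decide) (by rw [← ht]; decide), mul_zero]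
      · rw [h 0 1 (by rw [h0]; decide) ht, zero_mul]
    rw [h01]
    simp
  · rw [h0, h1]
    have h01 : m σ (ν σ) 0 0 * m σ (ν σ) 1 1 = 0 := by
      by_cases ht : (0 : Fin 2) = top σ
      · rw [h 1 1 (by rw [h1]; decide) (by rw [← ht]; decide), mul_zero]
      · rw [h 0 0 (by rw [h0]; decide) ht, zero_mul]
    rw [h01]
    simp

lemma iterate (hm : IsTransition ν p top m) (σ : V) (k : ℕ) :
    m σ (ν^[k + 1] σ) = m σ (ν^[k] σ) * m (ν^[k] σ) (ν (ν^[k] σ)) := by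
  rw [hm.mul, Function.iterate_succ_apply']

/-- The product of the matched entries around the cycle is a sign: all determinants around the cycle
multiply to one. -/
lemma prod_diag [Fintype V] (hν : ∀ σ τ, ν.SameCycle σ τ) [Nonempty V]
    (hm : IsTransition ν p top m) : ∏ ε, diag ν p m ε = ∏ σ, sgn (p σ) := by
  have σ₀ : V := Classical.arbitrary V
  have h1 : ∀ k, ∏ j ∈ Finset.range k, (m (ν^[j] σ₀) (ν (ν^[j] σ₀))).det =
      (m σ₀ (ν^[k] σ₀)).det := by
    intro k
    induction k with
    | zero => simp [hm.one]
    | succ k ih => rw [Finset.prod_range_succ, ih, hm.iterate, Matrix.det_mul]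
  have h2 := h1 (Function.minimalPeriod ν σ₀)
  rw [Function.iterate_minimalPeriod, hm.one, Matrix.det_one,
    prod_iterate (hν σ₀) fun σ => (m σ (ν σ)).det] at h2
  simp only [hm.det_eq] at h2
  rw [Finset.prod_mul_distrib] at h2
  have h3 : ∏ ε, diag ν p m ε = ∏ σ, diag ν p m (σ, 0) * diag ν p m (σ, 1) := by
    rw [Fintype.prod_prod_type]
    simp
  have h4 : (∏ σ, sgn (p σ)) * ∏ σ, sgn (p σ) = 1 := by
    rw [← Finset.prod_mul_distrib]
    exact Finset.prod_eq_one fun σ _ => sgn_mul_self _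
  rw [h3]
  calc _ = ((∏ σ, sgn (p σ)) * ∏ σ, sgn (p σ)) * ∏ σ, diag ν p m (σ, 0) * diag ν p m (σ, 1) := by
        rw [h4, one_mul]
    _ = _ := by rw [mul_assoc, h2, mul_one]

end IsTransition

section Normalized

variable [Fintype V] [DecidableEq V] (ν p top) (ε₀ : V × Fin 2)

/-- The value of the matched entry in the row `ε` after normalization by a diagonal gauge
transformation: `1`, except in the row that the double cover maps to the base point. -/
def normDiag (ε : V × Fin 2) : ℂ := if cover ν p ε = ε₀ then ∏ σ, sgn (p σ) else 1

/-- The normalized transition matrix from `σ` to `ν σ`, with the unmatched entry as a variable. -/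
def stepMatrix (σ : V) : Matrix (Fin 2) (Fin 2) (MvPolynomial V ℂ) := fun a b =>
  if b = p σ a then MvPolynomial.C (normDiag ν p ε₀ (σ, a)) else
    if a = top σ then MvPolynomial.X σ else 0

/-- The product of the first `k` normalized transition matrices starting from `σ`. -/
def pathMatrix (σ : V) : ℕ → Matrix (Fin 2) (Fin 2) (MvPolynomial V ℂ)
  | 0 => 1
  | k + 1 => pathMatrix σ k * stepMatrix ν p top ε₀ (ν^[k] σ)

/-- The off-diagonal entry of `m σ (ν σ)`. -/
def offDiag (m : V → V → Matrix (Fin 2) (Fin 2) ℂ) (σ : V) : ℂ :=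
  m σ (ν σ) (top σ) (p σ (top σ + 1))

variable {ν p top ε₀}

lemma map_stepMatrix (hm : IsTransition ν p top m) (hd : ∀ ε, diag ν p m ε = normDiag ν p ε₀ ε)
    (σ : V) : (stepMatrix ν p top ε₀ σ).map (MvPolynomial.eval (offDiag ν p top m)) = m σ (ν σ) := by
  ext a b
  rw [Matrix.map_apply, stepMatrix]
  split_ifs with h1 h2
  · rw [MvPolynomial.eval_C, ← hd, h1]
    rfl
  · subst h2
    have h3 : (p σ).symm b ≠ top σ := fun h => h1 (by rw [← h, Equiv.apply_symm_apply])
    have h4 : ∀ x y : Fin 2, x ≠ y → x = y + 1 := by decide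
    rw [MvPolynomial.eval_X, offDiag, ← h4 _ _ h3, Equiv.apply_symm_apply]
  · rw [map_zero, hm.zero σ a b h1 h2]

lemma map_pathMatrix (hm : IsTransition ν p top m) (hd : ∀ ε, diag ν p m ε = normDiag ν p ε₀ ε)
    (σ : V) (k : ℕ) :
    (pathMatrix ν p top ε₀ σ k).map (MvPolynomial.eval (offDiag ν p top m)) = m σ (ν^[k] σ) := by
  induction k with
  | zero => rw [pathMatrix, Matrix.map_one _ (map_zero _) (map_one _)]; exact (hm.one σ).symm
  | succ k ih => rw [pathMatrix, Matrix.map_mul, ih, map_stepMatrix hm hd, hm.iterate]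

/-- When the off-diagonal entries vanish, the path matrices are supported on the graph of the
transport in the double cover. -/
lemma eval_zero_pathMatrix (σ : V) (k : ℕ) (a b : Fin 2)
    (h : MvPolynomial.eval 0 (pathMatrix ν p top ε₀ σ k a b) ≠ 0) :
    ((cover ν p)^[k] (σ, a)).2 = b := by
  induction k generalizing b with
  | zero =>
    by_contra hab
    have hab' : a ≠ b := hab
    refine h ?_
    rw [pathMatrix, Matrix.one_apply_ne hab', map_zero]
  | succ k ih =>
    rw [pathMatrix, Matrix.mul_apply, map_sum] at h
    obtain ⟨c, -, hc⟩ := Finset.exists_ne_zero_of_sum_ne_zero h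
    rw [map_mul] at hc
    have h1 := ih c (left_ne_zero_of_mul hc)
    have h2 := right_ne_zero_of_mul hc
    rw [Function.iterate_succ_apply', cover_apply, iterate_cover_fst, h1]
    rw [stepMatrix] at h2
    split_ifs at h2 with h3 h4
    · exact h3.symm
    · simp at h2
    · simp at h2

/-- The equation expressing that the product of the normalized transition matrices around the cycle
is the identity is nontrivial, if the monodromy of the double cover is. -/
lemma loop_ne_zero {σ : V} {a : Fin 2}
    (hmon : (cover ν p)^[Function.minimalPeriod ν σ] (σ, a) ≠ (σ, a)) :
    pathMatrix ν p top ε₀ σ (Function.minimalPeriod ν σ) a a - 1 ≠ 0 := by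
  intro h
  refine hmon (Prod.ext ?_ (eval_zero_pathMatrix (top := top) (ε₀ := ε₀) σ _ a a ?_))
  · rw [iterate_cover_fst, Function.iterate_minimalPeriod]
  · rw [sub_eq_zero.1 h, map_one]
    exact one_ne_zero

lemma eval_loop (hm : IsTransition ν p top m) (hd : ∀ ε, diag ν p m ε = normDiag ν p ε₀ ε)
    (σ : V) (a : Fin 2) : MvPolynomial.eval (offDiag ν p top m)
      (pathMatrix ν p top ε₀ σ (Function.minimalPeriod ν σ) a a - 1) = 0 := by
  have h := congrFun (congrFun (map_pathMatrix hm hd σ (Function.minimalPeriod ν σ)) a) a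
  rw [Function.iterate_minimalPeriod, hm.one, Matrix.one_apply_eq, Matrix.map_apply] at h
  rw [map_sub, h, map_one, sub_self]

end Normalized

section Gauge

variable [Finite V] {ε₀ : V × Fin 2}

/-- The diagonal gauge transformation that normalizes the matched entries, starting from `1` at the
base point. -/
def gauge (hc : ∀ ε, (cover ν p).SameCycle ε₀ ε) (m : V → V → Matrix (Fin 2) (Fin 2) ℂ)
    (ε : V × Fin 2) : ℂ :=
  ∏ j ∈ Finset.range (index hc ε), diagInv ν p m ((cover ν p)^[j] ε₀)

/-- The inverse of `gauge`. -/
def gaugeInv (hc : ∀ ε, (cover ν p).SameCycle ε₀ ε) (m : V → V → Matrix (Fin 2) (Fin 2) ℂ)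
    (ε : V × Fin 2) : ℂ :=
  ∏ j ∈ Finset.range (index hc ε), diag ν p m ((cover ν p)^[j] ε₀)

lemma gaugeInv_mul_gauge (hc : ∀ ε, (cover ν p).SameCycle ε₀ ε) (hm : IsTransition ν p top m)
    (ε : V × Fin 2) : gaugeInv hc m ε * gauge hc m ε = 1 := by
  rw [gauge, gaugeInv, ← Finset.prod_mul_distrib]
  exact Finset.prod_eq_one fun j _ => hm.diag_mul_diagInv _

end Gauge

/-- The gauge transformation makes all the matched entries `1` up to the last one on the cycle,
which becomes the product of all of them. -/
lemma gauge_normalizes [Fintype V] [DecidableEq V] [Nonempty V] {ε₀ : V × Fin 2}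
    (hν : ∀ σ τ, ν.SameCycle σ τ)
    (hc : ∀ ε, (cover ν p).SameCycle ε₀ ε) (hm : IsTransition ν p top m) (ε : V × Fin 2) :
    gaugeInv hc m ε * diag ν p m ε * gauge hc m (cover ν p ε) = normDiag ν p ε₀ ε := by
  rw [normDiag]
  split_ifs with h
  · rw [h, gauge, index_base, Finset.prod_range_zero, mul_one, gaugeInv]
    have h1 : diag ν p m ε = diag ν p m ((cover ν p)^[index hc ε] ε₀) := by rw [iterate_index]
    rw [h1, ← Finset.prod_range_succ fun j => diag ν p m ((cover ν p)^[j] ε₀), index_last hc h,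
      prod_iterate hc, hm.prod_diag hν]
  · rw [gauge, index_apply hc h, Finset.prod_range_succ, iterate_index]
    have h1 := gaugeInv_mul_gauge hc hm ε
    rw [gauge] at h1
    calc _ = (gaugeInv hc m ε * ∏ j ∈ Finset.range (index hc ε),
          diagInv ν p m ((cover ν p)^[j] ε₀)) * (diag ν p m ε * diagInv ν p m ε) := by ring
      _ = 1 := by rw [h1, hm.diag_mul_diagInv, one_mul]

end Cyc

/-! ### Gauge transformations of Kaneyama data -/

namespace MultiSection

variable {n : ℕ} {F : Fan n} {A : MultiSection.{u} F}

/-- The index set of the matrix entries of Kaneyama data. -/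
abbrev Entry (A : MultiSection.{u} F) : Type u :=
  (p : F.conesOfDim n × F.conesOfDim n) × A.Idx p.1.1 × A.Idx p.2.1

/-- The point of the prime spectrum that defines the Zariski topology on Kaneyama data. -/
def KaneyamaData.toSpec (g : A.KaneyamaData) : PrimeSpectrum (MvPolynomial A.Entry ℂ) :=
  MvPolynomial.pointToPoint (k := ℂ) g.coord

lemma isInducing_toSpec : IsInducing (KaneyamaData.toSpec (A := A)) := ⟨rfl⟩

/-- Maps given by polynomials in the matrix entries are continuous. -/
lemma continuous_of_polynomial (Φ : A.KaneyamaData → A.KaneyamaData)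
    (P : A.Entry → MvPolynomial A.Entry ℂ)
    (h : ∀ g i, (Φ g).coord i = MvPolynomial.eval g.coord (P i)) : Continuous Φ := by
  rw [isInducing_toSpec.continuous_iff]
  have : KaneyamaData.toSpec ∘ Φ = PrimeSpectrum.comap
      (MvPolynomial.aeval P : MvPolynomial A.Entry ℂ →ₐ[ℂ] _).toRingHom ∘
        KaneyamaData.toSpec := by
    funext g
    rw [Function.comp_apply, Function.comp_apply, KaneyamaData.toSpec, funext (h g),
      pointToPoint_aeval]
    rfl
  rw [this]
  exact (PrimeSpectrum.continuous_comap _).comp isInducing_toSpec.continuous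

/-- A gauge transformation: invertible matrices with the support condition that defines the
equivalence of Kaneyama data. -/
structure Gauge (A : MultiSection.{u} F) where
  h : ∀ σ : F.conesOfDim n, Matrix (A.Idx σ.1) (A.Idx σ.1) ℂ
  k : ∀ σ : F.conesOfDim n, Matrix (A.Idx σ.1) (A.Idx σ.1) ℂ
  hk : ∀ σ, h σ * k σ = 1
  kh : ∀ σ, k σ * h σ = 1
  support : ∀ σ α β, h σ α β ≠ 0 → ∀ x ∈ σ.1, 0 ≤ pair (A.slope α - A.slope β) x

/-- The action of gauge transformations on Kaneyama data. It uses that all lifts have a common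
point, so that the first part of the support condition is empty. -/
def Gauge.act (hv : ∃ p, ∀ σ' ∈ A.S.cones, p ∈ σ') (G : A.Gauge) (g : A.KaneyamaData) :
    A.KaneyamaData where
  g σ τ := G.k σ * g.g σ τ * G.h τ
  one σ := by rw [g.one, Matrix.mul_one, G.kh]
  mul σ τ ρ := by
    calc _ = G.k σ * g.g σ τ * (G.h τ * G.k τ) * g.g τ ρ * G.h ρ := by
          simp only [Matrix.mul_assoc]
      _ = _ := by rw [G.hk, Matrix.mul_one, Matrix.mul_assoc (G.k σ), g.mul]
  support σ τ α β hne := by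
    obtain ⟨p, hp⟩ := hv
    refine ⟨⟨p, hp _ (A.lift_mem α), hp _ (A.lift_mem β)⟩, ?_⟩
    rintro x ⟨hxσ, hxτ⟩
    rw [Matrix.mul_apply] at hne
    obtain ⟨δ, -, hδ⟩ := Finset.exists_ne_zero_of_sum_ne_zero hne
    have h1 := left_ne_zero_of_mul hδ
    rw [Matrix.mul_apply] at h1
    obtain ⟨γ, -, hγ⟩ := Finset.exists_ne_zero_of_sum_ne_zero h1
    have h2 := support_inv (R := fun α β : A.Idx σ.1 =>
      ∀ x ∈ σ.1, 0 ≤ pair (A.slope α - A.slope β) x) A.slope_le_refl A.slope_le_trans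
      (G.support σ) (G.hk σ) (G.kh σ) α γ (left_ne_zero_of_mul hγ) x hxσ
    have h3 := (g.support σ τ γ δ (right_ne_zero_of_mul hγ)).2 x ⟨hxσ, hxτ⟩
    have h4 := G.support τ δ β (right_ne_zero_of_mul hδ) x hxτ
    rw [pair_sub] at *
    linarith

lemma Gauge.equiv_act (hv : ∃ p, ∀ σ' ∈ A.S.cones, p ∈ σ') (G : A.Gauge) (g : A.KaneyamaData) :
    KaneyamaData.Equiv g (G.act hv g) := by
  refine ⟨G.h, fun σ => ⟨⟨_, _, G.hk σ, G.kh σ⟩, rfl⟩, G.support, fun σ τ => ?_⟩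
  calc _ = (G.h σ * G.k σ) * (g.g σ τ * G.h τ) := by rw [G.hk, Matrix.one_mul]
    _ = _ := by simp only [Gauge.act, Matrix.mul_assoc]

lemma exists_gauge (hv : ∃ p, ∀ σ' ∈ A.S.cones, p ∈ σ') {g g' : A.KaneyamaData}
    (h : KaneyamaData.Equiv g g') : ∃ G : A.Gauge, G.act hv g = g' := by
  obtain ⟨h, hu, hs, he⟩ := h
  choose w hw using hu
  have h1 : ∀ σ, h σ * ((w σ)⁻¹).1 = 1 := fun σ => by rw [← hw, Units.mul_inv]
  have h2 : ∀ σ, ((w σ)⁻¹).1 * h σ = 1 := fun σ => by rw [← hw, Units.inv_mul]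
  refine ⟨⟨h, fun σ => ((w σ)⁻¹).1, h1, h2, hs⟩, ?_⟩
  apply KaneyamaData.ext
  funext σ τ
  change ((w σ)⁻¹).1 * g.g σ τ * h τ = g'.g σ τ
  rw [Matrix.mul_assoc, he, ← Matrix.mul_assoc, h2, Matrix.one_mul]

lemma Gauge.continuous_act (hv : ∃ p, ∀ σ' ∈ A.S.cones, p ∈ σ') (G : A.Gauge) :
    Continuous (G.act hv) := by
  refine continuous_of_polynomial _ (fun i => ∑ δ, (∑ γ,
    MvPolynomial.C (G.k i.1.1 i.2.1 γ) * MvPolynomial.X ⟨i.1, γ, δ⟩) *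
      MvPolynomial.C (G.h i.1.2 δ i.2.2)) fun g i => ?_
  simp only [map_sum, map_mul, MvPolynomial.eval_C, MvPolynomial.eval_X]
  change (G.k i.1.1 * g.g i.1.1 i.1.2 * G.h i.1.2) i.2.1 i.2.2 = _
  simp only [Matrix.mul_apply]
  rfl

/-- The quotient map to the moduli space is open, being the quotient map of a group action by
homeomorphisms. -/
lemma isOpenMap_mk (hv : ∃ p, ∀ σ' ∈ A.S.cones, p ∈ σ') :
    IsOpenMap (Quotient.mk A.kaneyamaSetoid) := by
  intro U hU
  have h : Quotient.mk A.kaneyamaSetoid ⁻¹' (Quotient.mk A.kaneyamaSetoid '' U) =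
      ⋃ G : A.Gauge, G.act hv ⁻¹' U := by
    ext g
    rw [mem_iUnion]
    constructor
    · rintro ⟨u, hu, hug⟩
      obtain ⟨G, hG⟩ := exists_gauge hv (A.kaneyamaSetoid.symm (Quotient.exact hug))
      exact ⟨G, by rw [mem_preimage, hG]; exact hu⟩
    · rintro ⟨G, hG⟩
      exact ⟨_, hG, Quotient.sound (A.kaneyamaSetoid.symm (G.equiv_act hv g))⟩
  refine isQuotientMap_quot_mk.isOpen_preimage.1 ?_
  exact (congrArg IsOpen h).mpr (isOpen_iUnion fun G => hU.preimage (G.continuous_act hv))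

end MultiSection

/-- A continuous choice of representatives of Kaneyama data bounds the dimension of the moduli
space by that of the set of representatives. -/
lemma moduliDim_le {n : ℕ} {F : Fan n} {A : MultiSection.{u} F}
    (hv : ∃ p, ∀ σ' ∈ A.S.cones, p ∈ σ') {r : A.KaneyamaData → A.KaneyamaData} (hr : Continuous r)
    (hrg : ∀ g, MultiSection.KaneyamaData.Equiv g (r g))
    [TopologicalSpace.NoetherianSpace (range r)] :
    A.moduliDim ≤ topologicalKrullDim (range r) := by
  have hmk : ∀ g, Quotient.mk A.kaneyamaSetoid (r g) = Quotient.mk A.kaneyamaSetoid g := fun g =>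
    Quotient.sound (A.kaneyamaSetoid.symm (hrg g))
  refine topologicalKrullDim_le_of_isOpenMap (Y := A.Moduli)
    (f := fun s : range r => Quotient.mk A.kaneyamaSetoid s.1)
    (continuous_quotient_mk'.comp continuous_subtype_val) ?_ ?_
  · rintro _ ⟨U, hU, rfl⟩
    have h : (fun s : range r => Quotient.mk A.kaneyamaSetoid s.1) '' (Subtype.val ⁻¹' U) =
        Quotient.mk A.kaneyamaSetoid '' (r ⁻¹' U) := by
      ext y
      constructor
      · rintro ⟨⟨_, g, rfl⟩, hs, rfl⟩
        exact ⟨g, hs, (hmk g).symm⟩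
      · rintro ⟨g, hg, rfl⟩
        exact ⟨⟨r g, g, rfl⟩, hg, hmk g⟩
    exact (congrArg IsOpen h).mpr (MultiSection.isOpenMap_mk hv _ (hU.preimage hr))
  · intro y
    induction y using Quotient.inductionOn with
    | h g => exact ⟨⟨r g, g, rfl⟩, hmk g⟩

namespace MultiSection

/-! ### The dimension bound -/

section Rank2

variable {F : Fan 2} {A : MultiSection.{u} F} {hF : F.IsComplete}
  (lab : ∀ σ : F.conesOfDim 2, Fin 2 ≃ A.Idx σ.1)

/-- The transition matrices of Kaneyama data in rank two, with rows and columns numbered. -/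
def mat (g : A.KaneyamaData) (σ τ : F.conesOfDim 2) : Matrix (Fin 2) (Fin 2) ℂ :=
  (g.g σ τ).submatrix (lab σ) (lab τ)

lemma mat_apply (g : A.KaneyamaData) (σ τ : F.conesOfDim 2) (a b : Fin 2) :
    mat lab g σ τ a b = g.coord ⟨(σ, τ), lab σ a, lab τ b⟩ := rfl

variable {lab} {p : F.conesOfDim 2 → Equiv.Perm (Fin 2)} {top : F.conesOfDim 2 → Fin 2}

open Cyc

/-- Transition matrices are triangular with respect to the order of the values of `φ` on the ray. -/
lemma isTransition_mat
    (hp : ∀ σ a, pair (A.slope (lab σ a)) (F.left σ) =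
      pair (A.slope (lab (F.next hF σ) (p σ a))) (F.left σ))
    (htop : ∀ σ a, a ≠ top σ → pair (A.slope (lab σ a)) (F.left σ) <
      pair (A.slope (lab σ (top σ))) (F.left σ)) (g : A.KaneyamaData) :
    IsTransition (F.next hF) p top (mat lab g) where
  one σ := by
    rw [mat, g.one]
    exact Matrix.submatrix_one_equiv _
  mul σ τ ρ := by
    rw [mat, mat, Matrix.submatrix_mul_equiv, g.mul, mat]
  zero σ a b hb ha := by
    by_contra hne
    have h1 := (g.support _ _ _ _ hne).2 _ ⟨F.left_mem σ, F.left_mem_next hF σ⟩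
    have h2 : (p σ).symm b = top σ := by
      have h3 : (p σ).symm b ≠ a := fun h => hb (by rw [← h, Equiv.apply_symm_apply])
      omega
    have h3 := hp σ ((p σ).symm b)
    rw [Equiv.apply_symm_apply, h2] at h3
    rw [pair_sub, ← h3] at h1
    linarith [htop σ a ha]
  zero' σ a b hab ha := by
    by_contra hne
    have h1 := (g.support _ _ _ _ hne).2 _ ⟨F.left_mem_next hF σ, F.left_mem σ⟩
    have h2 : b = top σ := by omega
    rw [pair_sub, ← hp, h2] at h1
    linarith [htop σ a ha]

variable {ε₀ : F.conesOfDim 2 × Fin 2} (hc : ∀ ε, (cover (F.next hF) p).SameCycle ε₀ ε)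

variable (lab) in
/-- The diagonal gauge transformation that normalizes Kaneyama data. -/
def diagGauge (g : A.KaneyamaData) (hm : IsTransition (F.next hF) p top (mat lab g)) : A.Gauge where
  h σ := Matrix.diagonal fun α => gauge hc (mat lab g) (σ, (lab σ).symm α)
  k σ := Matrix.diagonal fun α => gaugeInv hc (mat lab g) (σ, (lab σ).symm α)
  hk σ := by
    rw [Matrix.diagonal_mul_diagonal, ← Matrix.diagonal_one]
    congr 1
    funext α
    rw [mul_comm, gaugeInv_mul_gauge hc hm]
  kh σ := by
    rw [Matrix.diagonal_mul_diagonal, ← Matrix.diagonal_one]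
    congr 1
    funext α
    rw [gaugeInv_mul_gauge hc hm]
  support σ α β h := by
    by_cases hab : α = β
    · subst hab
      exact A.slope_le_refl α
    · exact absurd (Matrix.diagonal_apply_ne _ hab) h

variable (hv : ∃ q, ∀ σ' ∈ A.S.cones, q ∈ σ')
  (hm : ∀ g : A.KaneyamaData, IsTransition (F.next hF) p top (mat lab g))

/-- The normalization of Kaneyama data by a diagonal gauge transformation. -/
def normalize (g : A.KaneyamaData) : A.KaneyamaData := (diagGauge lab hc g (hm g)).act hv g

lemma coord_normalize (g : A.KaneyamaData) (i : A.Entry) :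
    (normalize hc hv hm g).coord i = gaugeInv hc (mat lab g) (i.1.1, (lab i.1.1).symm i.2.1) *
      g.coord i * gauge hc (mat lab g) (i.1.2, (lab i.1.2).symm i.2.2) := by
  change ((diagGauge lab hc g (hm g)).k i.1.1 * g.g i.1.1 i.1.2 *
    (diagGauge lab hc g (hm g)).h i.1.2) i.2.1 i.2.2 = _
  simp only [diagGauge]
  rw [Matrix.mul_diagonal, Matrix.diagonal_mul]
  rfl

lemma continuous_normalize : Continuous (normalize hc hv hm) := by
  refine continuous_of_polynomial _ (fun i =>
    (∏ j ∈ Finset.range (index hc (i.1.1, (lab i.1.1).symm i.2.1)),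
      MvPolynomial.X ⟨(((cover (F.next hF) p)^[j] ε₀).1,
        F.next hF ((cover (F.next hF) p)^[j] ε₀).1), lab _ ((cover (F.next hF) p)^[j] ε₀).2,
        lab _ (p ((cover (F.next hF) p)^[j] ε₀).1 ((cover (F.next hF) p)^[j] ε₀).2)⟩) *
    MvPolynomial.X i *
    ∏ j ∈ Finset.range (index hc (i.1.2, (lab i.1.2).symm i.2.2)),
      MvPolynomial.X ⟨(F.next hF ((cover (F.next hF) p)^[j] ε₀).1,
        ((cover (F.next hF) p)^[j] ε₀).1),
        lab _ (p ((cover (F.next hF) p)^[j] ε₀).1 ((cover (F.next hF) p)^[j] ε₀).2),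
        lab _ ((cover (F.next hF) p)^[j] ε₀).2⟩) fun g i => ?_
  rw [coord_normalize]
  simp only [map_mul, map_prod, MvPolynomial.eval_X]
  rfl

lemma diag_normalize [DecidableEq (F.conesOfDim 2)] (g : A.KaneyamaData)
    (ε : F.conesOfDim 2 × Fin 2) :
    diag (F.next hF) p (mat lab (normalize hc hv hm g)) ε = normDiag (F.next hF) p ε₀ ε := by
  have : Nonempty (F.conesOfDim 2) := ⟨ε.1⟩
  rw [← gauge_normalizes (F.sameCycle_next hF) hc (hm g) ε]
  rw [diag, mat_apply, coord_normalize, Equiv.symm_apply_apply, Equiv.symm_apply_apply]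
  rfl

/-- The off-diagonal entries are coordinates on the set of normalized Kaneyama data: by the cocycle
condition every matrix is a product of transition matrices along a path, and so is polynomial in
these entries. -/
lemma isInducing_offDiag :
    IsInducing fun s : range (normalize hc hv hm) => (MvPolynomial.pointToPoint (k := ℂ)
      (offDiag (F.next hF) p top (mat lab s.1)) :
        PrimeSpectrum (MvPolynomial (F.conesOfDim 2) ℂ)) := by
  classical
  refine IsInducing.of_comp (g := PrimeSpectrum.comap (MvPolynomial.aeval fun i : A.Entry =>
    pathMatrix (F.next hF) p top ε₀ i.1.1 (index (F.sameCycle_next hF i.1.1) i.1.2)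
      ((lab i.1.1).symm i.2.1) ((lab i.1.2).symm i.2.2) :
        MvPolynomial A.Entry ℂ →ₐ[ℂ] MvPolynomial (F.conesOfDim 2) ℂ).toRingHom)
    ?_ (PrimeSpectrum.continuous_comap _) ?_
  · have h : (fun s : range (normalize hc hv hm) => (MvPolynomial.pointToPoint (k := ℂ)
        (offDiag (F.next hF) p top (mat lab s.1)) :
          PrimeSpectrum (MvPolynomial (F.conesOfDim 2) ℂ))) =
        PrimeSpectrum.comap (MvPolynomial.aeval fun σ : F.conesOfDim 2 => MvPolynomial.X
          (⟨(σ, F.next hF σ), lab σ (top σ), lab _ (p σ (top σ + 1))⟩ : A.Entry) :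
            MvPolynomial (F.conesOfDim 2) ℂ →ₐ[ℂ] MvPolynomial A.Entry ℂ).toRingHom ∘
          KaneyamaData.toSpec ∘ Subtype.val := by
      funext s
      rw [Function.comp_apply, Function.comp_apply, KaneyamaData.toSpec, ← pointToPoint_aeval]
      simp only [MvPolynomial.eval_X]
      rfl
    rw [h]
    exact (PrimeSpectrum.continuous_comap _).comp
      (isInducing_toSpec.continuous.comp continuous_subtype_val)
  · have h : PrimeSpectrum.comap (MvPolynomial.aeval fun i : A.Entry =>
        pathMatrix (F.next hF) p top ε₀ i.1.1 (index (F.sameCycle_next hF i.1.1) i.1.2)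
          ((lab i.1.1).symm i.2.1) ((lab i.1.2).symm i.2.2) :
            MvPolynomial A.Entry ℂ →ₐ[ℂ] MvPolynomial (F.conesOfDim 2) ℂ).toRingHom ∘
        (fun s : range (normalize hc hv hm) => (MvPolynomial.pointToPoint (k := ℂ)
          (offDiag (F.next hF) p top (mat lab s.1)) :
            PrimeSpectrum (MvPolynomial (F.conesOfDim 2) ℂ))) =
        KaneyamaData.toSpec ∘ Subtype.val := by
      funext s
      obtain ⟨_, g, rfl⟩ := s
      rw [Function.comp_apply, Function.comp_apply, KaneyamaData.toSpec, ← pointToPoint_aeval]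
      congr 1
      funext i
      have h1 := congrFun (congrFun (map_pathMatrix (hm (normalize hc hv hm g))
        (diag_normalize hc hv hm g) i.1.1 (index (F.sameCycle_next hF i.1.1) i.1.2))
          ((lab i.1.1).symm i.2.1)) ((lab i.1.2).symm i.2.2)
      rw [Matrix.map_apply, iterate_index, mat_apply, Equiv.apply_symm_apply,
        Equiv.apply_symm_apply] at h1
      exact h1
    rw [h]
    exact isInducing_toSpec.comp IsInducing.subtypeVal

/-- The normalized data satisfy the nontrivial equation that the product around the cycle is `1`. -/
lemma moduliDim_add_one_le (hc : ∀ ε, (cover (F.next hF) p).SameCycle ε₀ ε)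
    (hv : ∃ q, ∀ σ' ∈ A.S.cones, q ∈ σ')
    (hm : ∀ g : A.KaneyamaData, IsTransition (F.next hF) p top (mat lab g))
    (σ : F.conesOfDim 2) (a : Fin 2)
    (hmon : (cover (F.next hF) p)^[Function.minimalPeriod (F.next hF) σ] (σ, a) ≠ (σ, a)) :
    A.moduliDim + 1 ≤ (Nat.card (F.conesOfDim 2) : WithBot ℕ∞) := by
  classical
  have hT := isInducing_offDiag hc hv hm
  have := hT.noetherianSpace
  have h1 : A.moduliDim ≤ topologicalKrullDim (range (normalize hc hv hm)) :=
    moduliDim_le hv (continuous_normalize hc hv hm) fun g => Gauge.equiv_act hv _ g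
  refine (add_le_add h1 le_rfl).trans (topologicalKrullDim_add_one_le hT
    (loop_ne_zero (top := top) (ε₀ := ε₀) hmon) ?_)
  rintro ⟨_, g, rfl⟩
  rw [PrimeSpectrum.mem_zeroLocus, singleton_subset_iff]
  exact MvPolynomial.mem_vanishingIdeal_singleton_iff _ _ |>.2
    (eval_loop (hm _) (diag_normalize hc hv hm g) σ a)

end Rank2

end MultiSection

/-- The dimension bound in terms of the number of two-dimensional cones. -/
lemma MultiSection.moduliDim_add_one_le_card {F : Fan 2} (hF : F.IsComplete)
    {A : MultiSection.{u} F} (hrank : A.rank = 2) (hind : A.CombIndecomposable) :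
    A.moduliDim + 1 ≤ (Nat.card (F.conesOfDim 2) : WithBot ℕ∞) := by
  have hcard : ∀ σ : F.conesOfDim 2, Nat.card (A.Idx σ.1) = 2 := fun σ =>
    (A.card_idx hF σ.2.1).trans hrank
  have hlab : ∀ σ : F.conesOfDim 2, Nonempty (Fin 2 ≃ A.Idx σ.1) := fun σ =>
    ⟨(Finite.equivFinOfCardEq (hcard σ)).symm⟩
  have lab := fun σ => (hlab σ).some
  choose e he using fun σ : F.conesOfDim 2 => A.exists_matching hF σ.2.1 (F.next hF σ).2.1
    (F.left_mem σ) (F.left_mem_next hF σ)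
  let p : F.conesOfDim 2 → Equiv.Perm (Fin 2) := fun σ =>
    ((lab σ).trans (e σ)).trans (lab (F.next hF σ)).symm
  let va : F.conesOfDim 2 → Fin 2 → ℝ := fun σ a => pair (A.slope (lab σ a)) (F.left σ)
  let vb : F.conesOfDim 2 → Fin 2 → ℝ := fun σ b =>
    pair (A.slope (lab (F.next hF σ) b)) (F.left σ)
  have hp : ∀ σ a, va σ a = vb σ (p σ a) := by
    intro σ a
    simp only [va, vb, p, Equiv.trans_apply, Equiv.apply_symm_apply]
    rw [← A.φ_pt _ (F.left_mem σ), ← A.φ_pt _ (F.left_mem_next hF σ), he]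
  have hno : ∀ s : F.conesOfDim 2 → Fin 2, ¬ ∀ σ, va σ (s σ) = vb σ (s (F.next hF σ)) :=
    fun s => A.not_exists_section hF hrank hind fun σ => lab σ (s σ)
  have hν := F.sameCycle_next hF
  -- the sheet with the larger value on the ray: only its row can have an unmatched entry
  let top : F.conesOfDim 2 → Fin 2 := fun σ => if va σ 1 < va σ 0 then 0 else 1
  have htop : ∀ σ a, a ≠ top σ → va σ a < va σ (top σ) := by
    intro σ a ha
    have h1 := Cyc.va_injective hν hno hp σ
    by_cases h : va σ 1 < va σ 0
    · have ht : top σ = 0 := if_pos h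
      rw [ht] at ha ⊢
      obtain rfl : a = 1 := by omega
      exact h
    · have ht : top σ = 1 := if_neg h
      rw [ht] at ha ⊢
      obtain rfl : a = 0 := by omega
      exact lt_of_le_of_ne (not_lt.1 h) h1
  obtain ⟨σ₀, -⟩ := F.exists_sector_mem hF 0
  exact moduliDim_add_one_le (Cyc.sameCycle_cover hν hno hp (σ₀, 0)) (A.exists_vertex hF hind.1)
    (isTransition_mat hp htop) σ₀ 0 (Cyc.monodromy_ne hν hno hp σ₀ 0)

end TropicalMultiSection

end

theorem corollary5p7 (F : TropicalMultiSection.Fan 2) (hF : F.IsComplete)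
    (𝕃 : TropicalMultiSection.MultiSection.{u} F) (hrank : 𝕃.rank = 2)
    (hind : 𝕃.CombIndecomposable) :
    𝕃.moduliDim + 1 ≤ ((F.conesOfDim 1).ncard : WithBot ℕ∞) :=
  (𝕃.moduliDim_add_one_le_card hF hrank hind).trans (by exact_mod_cast F.card_sectors_le hF)
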